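/- Let $d\ge 1$ and let $\|\cdot\|$ be the Euclidean norm on $\mathbb R^d$. Let $\operatorname{erfc}(x)=\frac{2}{\sqrt\pi}\int_x^\infty e^{-y^2}\,dy$. \emph{Processes.} A process $X=(X_t)_{t\in\mathbb R^d}$ with values in $[0,\infty]$ has spectral functions $V_t\ge 0$ on a measure space $(S,\nu)$, where $\int V_t\,d\nu=1$ for all $t$, if $X$ has the same law as $\big(\sup_n U_nV_t(\omega_n)\big)_{t\in\mathbb R^d}$ for a Poisson point process $(U_n,\omega_n)_n$ on $(0,\infty)\times S$ with intensity $u^{-2}du\times\nu$. Then $X$ is max-stable with standard Fréchet marginals. Its tail correlation function (TCF) is $\chi(t)=\lim_{\tau\to\infty}\mathbb P(X_t\ge\tau\mid X_0\ge\tau)$, $t\in\mathbb R^d$. * M3 process with random shape $f$: here $f$ is a measurable process on $\mathbb R^d$ with values in $[0,\infty]$ and $\mathbb E\int_{\mathbb R^d} f(t)\,dt=1$; the measure is $\nu=dz\times\mathbb P_f$ and $V_t(z,f)=f(t-z)$. It is an M3r process if every realization of $f$ is radially symmetric and non-increasing in the radius. * MPS (mixed Poisson storm) process: the M3 process with shape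 $f=\mu_d(\Lambda)\mathbf 1_{\Lambda^{-1}C}$, where $\Lambda$ is a random variable with values in $(0,\infty)$, $C$ is the typical cell, independent of $\Lambda$, of the stationary isotropic Poisson hyperplane mosaic of intensity $1$ in $\mathbb R^d$, and $\mu_d(a)=1/\mathbb E\operatorname{vol}(a^{-1}C)$. (The hyperplanes are $\{x:\langle u,x\rangle=r\}$ with $(u,r)$ running through a Poisson process with intensity uniform distribution on the unit sphere times Lebesgue measure on $\mathbb R$; the law of $C$ is the normalized distribution of the cells with centre of mass in the unit cube, each translated so that its centre is the origin.) * BR (Brown–Resnick) process: $\nu$ is a probability measure and $V_t=\exp(W_t-\sigma^2(t)/2)$, where $W$ is a centred Gaussian process on $\mathbb R^d$ with stationary increments, $\sigma^2(t)=\operatorname{Var}W_t$, and the variogram $\gamma(t)=\mathbb E(W_t-W_0)^2$ is radially symmetric and grows monotonically to $\infty$ with the radius. * VBR (variance-mixed Brown–Resnick) process: as BR, but with $V_t=\exp(RW_t-R^2\sigma^2(t)/2)$ for a random variable $R$ with values in $(0,\infty)$ that is independent of $W$. Let $T^d_{\mathrm{M3r}},T^d_{\mathrm{MPS}},T^d_{\mathrm{BR}},T^d_{\mathrm{VBR}}$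 be the sets of TCFs of the processes on $\mathbb R^d$ in these classes. A function $\varphi$ on $[0,\infty)$ is identified with the radial function $\varphi(\|\cdot\|)$ on $\mathbb R^d$, and $T^\infty_{\mathrm{M3r}}=\bigcap_{k\ge1}T^k_{\mathrm{M3r}}$ is the set of functions on $[0,\infty)$ that belong to $T^k_{\mathrm{M3r}}$ for every dimension $k\ge 1$. \emph{Claim.} For every $d\ge1$: (a) $T^d_{\mathrm{MPS}}\subseteq T^\infty_{\mathrm{M3r}}\subseteq T^d_{\mathrm{M3r}}$. (b) $T^d_{\mathrm{BR}}\cup T^\infty_{\mathrm{M3r}}\subseteq T^d_{\mathrm{VBR}}$. (c) For $\alpha\in\mathbb R$ (with the conventions $0^0=1$ and $0^\alpha=0$ for $\alpha<0$), the function $t\mapsto\operatorname{erfc}(\|t\|^\alpha)$ belongs to $T^d_{\mathrm{MPS}}\cap T^d_{\mathrm{BR}}$ if and only if $\alpha\in(0,1/2]$. In particular, $T^d_{\mathrm{MPS}}\cap T^d_{\mathrm{BR}}\neq\emptyset$. -/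

import Mathlib

noncomputable section

open MeasureTheory ProbabilityTheory Set Filter Topology
open scoped ENNReal NNReal

/-- The complementary error function `(2/√π) ∫_x^∞ exp(-y²) dy`. -/
def erfc (x : ℝ) : ℝ :=
  2 / Real.sqrt Real.pi * ∫ y in Ioi x, Real.exp (-y ^ 2)

/-- `ℝ^d` with the Euclidean norm. -/
abbrev Euc (d : ℕ) : Type := EuclideanSpace ℝ (Fin d)

/-! ### Poisson point processes -/

/-- The number of points of the enumerated point process `Φ` that lie in `A`. -/
def pointCount {Ω S : Type*} (Φ : ℕ → Ω → S) (A : Set S) (ω : Ω) : ℝ≥0∞ :=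
  ∑' n, A.indicator 1 (Φ n ω)

/-- `Φ 0, Φ 1, …` enumerates a Poisson point process with intensity measure `μ` (a `σ`-finite
measure of infinite total mass): the number of points in a set of finite intensity is Poisson
distributed, and the numbers of points in disjoint sets are independent. -/
structure IsPoissonProcess {Ω S : Type*} [MeasurableSpace Ω] [MeasurableSpace S]
    (Φ : ℕ → Ω → S) (μ : Measure S) (P : Measure Ω) : Prop where
  measurable : ∀ n, Measurable (Φ n)
  count_law : ∀ A : Set S, MeasurableSet A → μ A ≠ ∞ →
    P.map (pointCount Φ A) = (poissonMeasure (μ A).toNNReal).map (fun k : ℕ => (k : ℝ≥0∞))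
  count_indep : ∀ (m : ℕ) (A : Fin m → Set S), (∀ i, MeasurableSet (A i)) →
    Pairwise (fun i j => Disjoint (A i) (A j)) → iIndepFun (fun i => pointCount Φ (A i)) P

/-! ### Max-stable processes and tail correlation functions -/

/-- The measure `u⁻² du` on `(0, ∞)`. -/
def invSqMeasure : Measure ℝ :=
  (volume.restrict (Ioi (0 : ℝ))).withDensity (fun u => ENNReal.ofReal ((u ^ 2)⁻¹))

/-- The process `X` has the spectral representation `X_t = sup_n U_n V_t(ω_n)` in distribution,
where `(U_n, ω_n)` is a Poisson point process with intensity `u⁻² du × ν` and the spectral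
functions `V_t ≥ 0` satisfy `∫ V_t dν = 1`. Such an `X` is max-stable with standard Fréchet
marginals. (Values lie in `[0, ∞]`, since shapes with a pole are allowed below.) -/
structure HasSpectralRepresentation {T Ω S : Type} [MeasurableSpace Ω] [MeasurableSpace S]
    (X : T → Ω → ℝ≥0∞) (P : Measure Ω) (ν : Measure S) (V : T → S → ℝ≥0∞) : Prop where
  measurable_spectral : ∀ t, Measurable (V t)
  lintegral_spectral : ∀ t, ∫⁻ w, V t w ∂ν = 1
  representation : ∃ (Ω' : Type) (_ : MeasurableSpace Ω') (P' : Measure Ω')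
    (Φ : ℕ → Ω' → ℝ × S), IsProbabilityMeasure P' ∧
      IsPoissonProcess Φ (invSqMeasure.prod ν) P' ∧
      IdentDistrib (fun ω t => X t ω)
        (fun ω' t => ⨆ n, ENNReal.ofReal (Φ n ω').1 * V t (Φ n ω').2) P P'

/-- `χ` is the tail correlation function of the process `X` on `ℝ^d`:
`χ(t) = lim P(X_t ≥ τ | X_o ≥ τ)` as `τ` increases to the upper endpoint of the marginal
distribution. All processes considered here have standard Fréchet marginals, for which this
endpoint is `∞`. -/
def IsTCF {d : ℕ} {Ω : Type} [MeasurableSpace Ω] (X : Euc d → Ω → ℝ≥0∞) (P : Measure Ω)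
    (χ : Euc d → ℝ) : Prop :=
  ∀ t, Tendsto
    (fun τ : ℝ => (ProbabilityTheory.cond P {ω | ENNReal.ofReal τ ≤ X 0 ω}).real
      {ω | ENNReal.ofReal τ ≤ X t ω})
    atTop (𝓝 (χ t))

/-- A class of stochastic processes on `ℝ^d`. -/
abbrev ProcessClass (d : ℕ) : Type 1 :=
  ∀ (Ω : Type) [MeasurableSpace Ω], (Euc d → Ω → ℝ≥0∞) → Measure Ω → Prop

/-- The set of tail correlation functions of the processes of a class. -/
def tcfSet {d : ℕ} (M : ProcessClass d) : Set (Euc d → ℝ) :=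
  {χ | ∃ (Ω : Type) (_ : MeasurableSpace Ω) (P : Measure Ω) (X : Euc d → Ω → ℝ≥0∞),
    IsProbabilityMeasure P ∧ M Ω X P ∧ IsTCF X P χ}

/-! ### Mixed moving maxima -/

/-- `X` is the mixed moving maxima process of the random shape function `f`, a measurable process
on the probability space `(S, Q)` with values in `[0, ∞]` and `E ∫ f(t) dt = 1`: the spectral
functions on `(ℝ^d × S, dz × Q)` are `V_t(z, s) = f_s(t - z)`. -/
structure IsM3 {d : ℕ} {Ω S : Type} [MeasurableSpace Ω] [MeasurableSpace S]
    (X : Euc d → Ω → ℝ≥0∞) (P : Measure Ω) (Q : Measure S) (f : S → Euc d → ℝ≥0∞) : Prop where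
  prob : IsProbabilityMeasure Q
  measurable_shape : Measurable (fun p : S × Euc d => f p.1 p.2)
  lintegral_shape : ∫⁻ s, (∫⁻ t, f s t ∂volume) ∂Q = 1
  spectral : HasSpectralRepresentation X P ((volume : Measure (Euc d)).prod Q)
    (fun t p => f p.2 (t - p.1))

/-- M3r processes: every realization of the random shape is radially symmetric and non-increasing
in the radius. -/
def IsM3r (d : ℕ) : ProcessClass d := fun _ _ X P =>
  ∃ (S : Type) (_ : MeasurableSpace S) (Q : Measure S) (f : S → Euc d → ℝ≥0∞),
    (∀ s x y, ‖x‖ ≤ ‖y‖ → f s y ≤ f s x) ∧ IsM3 X P Q f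

/-! ### Mixed Poisson storms -/

/-- A pair `(u, r)` of a unit vector and a real number stands for the hyperplane
`{x | ⟪u, x⟫ = r}`. -/
abbrev HyperplaneParam (d : ℕ) : Type := Metric.sphere (0 : Euc d) 1 × ℝ

/-- `⟪u, x⟫ - r`, whose sign tells on which side of the hyperplane `(u, r)` the point `x` lies. -/
def side {d : ℕ} (h : HyperplaneParam d) (x : Euc d) : ℝ :=
  inner ℝ (h.1 : Euc d) x - h.2

/-- The uniform distribution on the unit sphere. -/
def sphereUniform (d : ℕ) : Measure (Metric.sphere (0 : Euc d) 1) :=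
  ((volume : Measure (Euc d)).toSphere univ)⁻¹ • (volume : Measure (Euc d)).toSphere

/-- The intensity measure of the stationary isotropic Poisson hyperplane process of intensity `1`:
uniformly distributed normal direction times Lebesgue measure for the signed distance. -/
def hyperplaneIntensity (d : ℕ) : Measure (HyperplaneParam d) :=
  (sphereUniform d).prod volume

/-- The points that no hyperplane of the family strictly separates from `x`. -/
def cellAt {d : ℕ} (H : ℕ → HyperplaneParam d) (x : Euc d) : Set (Euc d) :=
  {y | ∀ n, 0 ≤ side (H n) x * side (H n) y}

/-- The (closed) cells of the mosaic generated by the hyperplanes. -/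
def mosaicCells {d : ℕ} (H : ℕ → HyperplaneParam d) : Set (Set (Euc d)) :=
  {K | ∃ x, (∀ n, side (H n) x ≠ 0) ∧ K = cellAt H x}

/-- The centre of mass, used as centre function of the cells. -/
def cellCentre {d : ℕ} (K : Set (Euc d)) : Euc d := ⨍ x in K, x

/-- The cell translated so that its centre is the origin. -/
def centredCell {d : ℕ} (K : Set (Euc d)) : Set (Euc d) := {x | x + cellCentre K ∈ K}

/-- The half-open unit cube. -/
def unitCube (d : ℕ) : Set (Euc d) := {x | ∀ i, 0 ≤ x i ∧ x i < 1}

/-- The expected number of cells with centre in the unit cube and centred shape in `A`. -/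
def cellIntensity {d : ℕ} {Ω : Type} [MeasurableSpace Ω] (Φ : ℕ → Ω → HyperplaneParam d)
    (P : Measure Ω) (A : Set (Set (Euc d))) : ℝ≥0∞ :=
  ∫⁻ ω, (({K ∈ mosaicCells (fun n => Φ n ω) |
    cellCentre K ∈ unitCube d ∧ centredCell K ∈ A}.encard : ℕ∞) : ℝ≥0∞) ∂P

/-- The random convex body `C` on `(S, Q)` is (distributed like) the typical cell of the stationary
isotropic Poisson hyperplane mosaic of intensity `1`: its law is the normalized mark distribution
of the centred cells. Sets of sets are measured by the `σ`-algebra generated by the events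
`{K | x ∈ K}`, `x ∈ ℝ^d`, which on convex bodies with interior points is the usual one. -/
structure IsTypicalCell {d : ℕ} {S : Type} [MeasurableSpace S] (C : S → Set (Euc d))
    (Q : Measure S) : Prop where
  convexBody : ∀ s, IsCompact (C s) ∧ Convex ℝ (C s) ∧ (interior (C s)).Nonempty
  measurable_graph : MeasurableSet {p : S × Euc d | p.2 ∈ C p.1}
  law : ∃ (Ω : Type) (_ : MeasurableSpace Ω) (P : Measure Ω) (Φ : ℕ → Ω → HyperplaneParam d),
    IsProbabilityMeasure P ∧ IsPoissonProcess Φ (hyperplaneIntensity d) P ∧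
    ∀ A : Set (Set (Euc d)), MeasurableSet A →
      Q (C ⁻¹' A) = cellIntensity Φ P A / cellIntensity Φ P univ

/-- `μ_d(a) = 1 / E(vol(a⁻¹ C))` with `a⁻¹ C = {t | a t ∈ C}`. -/
def stormHeight {d : ℕ} {S : Type} [MeasurableSpace S] (C : S → Set (Euc d)) (Q : Measure S)
    (a : ℝ) : ℝ≥0∞ :=
  (∫⁻ s, volume {t | a • t ∈ C s} ∂Q)⁻¹

/-- Mixed Poisson storm processes: M3 processes with random shape `μ_d(Λ) 1_{Λ⁻¹ C}`, where `Λ` is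
a random variable on `(0, ∞)` with distribution `F`, and `C` is an independent typical cell
(the pair `(Λ, C)` is realized on the product of `(ℝ, F)` and `(S, Q)`). -/
def IsMPS (d : ℕ) : ProcessClass d := fun _ _ X P =>
  ∃ (S : Type) (_ : MeasurableSpace S) (Q : Measure S) (C : S → Set (Euc d)) (F : Measure ℝ),
    IsProbabilityMeasure Q ∧ IsTypicalCell C Q ∧ IsProbabilityMeasure F ∧ F (Iic 0) = 0 ∧
    IsM3 X P (F.prod Q)
      (fun p t => {t : Euc d | p.1 • t ∈ C p.2}.indicator (fun _ => stormHeight C Q p.1) t)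

/-! ### (Variance-mixed) Brown-Resnick processes -/

/-- The variogram `γ(t) = E (W_t - W_o)²`. -/
def variogram {d : ℕ} {S : Type} [MeasurableSpace S] (W : Euc d → S → ℝ) (Q : Measure S)
    (t : Euc d) : ℝ :=
  ∫ s, (W t s - W 0 s) ^ 2 ∂Q

/-- `W` is a centred Gaussian process on `ℝ^d` with stationary increments whose variogram is
radially symmetric and grows monotonically to `∞` as the radius grows. -/
structure IsAdmissibleGaussian {d : ℕ} {S : Type} [MeasurableSpace S] (W : Euc d → S → ℝ)
    (Q : Measure S) : Prop where
  prob : IsProbabilityMeasure Q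
  measurable : ∀ t, Measurable (W t)
  gaussian : IsGaussianProcess W Q
  centred : ∀ t, ∫ s, W t s ∂Q = 0
  stationary_increments : ∀ h : Euc d,
    IdentDistrib (fun s t => W (t + h) s - W h s) (fun s t => W t s - W 0 s) Q Q
  radial_mono : ∀ x y : Euc d, ‖x‖ ≤ ‖y‖ → variogram W Q x ≤ variogram W Q y
  tendsto_variogram : Tendsto (variogram W Q) (cocompact (Euc d)) atTop

/-- Brown-Resnick processes: spectral process `V_t = exp(W_t - σ²(t)/2)`. -/
def IsBR (d : ℕ) : ProcessClass d := fun _ _ X P =>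
  ∃ (S : Type) (_ : MeasurableSpace S) (Q : Measure S) (W : Euc d → S → ℝ),
    IsAdmissibleGaussian W Q ∧
    HasSpectralRepresentation X P Q
      (fun t s => ENNReal.ofReal (Real.exp (W t s - variance (W t) Q / 2)))

/-- Variance-mixed Brown-Resnick processes: spectral process `V_t = exp(R W_t - R² σ²(t)/2)` with
an independent random variable `R` on `(0, ∞)` with distribution `G` (the pair `(W, R)` is
realized on the product of `(S, Q)` and `(ℝ, G)`). -/
def IsVBR (d : ℕ) : ProcessClass d := fun _ _ X P =>
  ∃ (S : Type) (_ : MeasurableSpace S) (Q : Measure S) (W : Euc d → S → ℝ) (G : Measure ℝ),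
    IsAdmissibleGaussian W Q ∧ IsProbabilityMeasure G ∧ G (Iic 0) = 0 ∧
    HasSpectralRepresentation X P (Q.prod G)
      (fun t p => ENNReal.ofReal
        (Real.exp (p.2 * W t p.1 - p.2 ^ 2 * variance (W t) Q / 2)))

/-! ### The classes of tail correlation functions -/

/-- Tail correlation functions of M3r processes on `ℝ^d`. -/
def tcfM3r (d : ℕ) : Set (Euc d → ℝ) := tcfSet (IsM3r d)

/-- Tail correlation functions of MPS processes on `ℝ^d`. -/
def tcfMPS (d : ℕ) : Set (Euc d → ℝ) := tcfSet (IsMPS d)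

/-- Tail correlation functions of BR processes on `ℝ^d`. -/
def tcfBR (d : ℕ) : Set (Euc d → ℝ) := tcfSet (IsBR d)

/-- Tail correlation functions of VBR processes on `ℝ^d`. -/
def tcfVBR (d : ℕ) : Set (Euc d → ℝ) := tcfSet (IsVBR d)

/-- The radial function on `ℝ^d` given by a function of the radius. -/
def radial (d : ℕ) (φ : ℝ≥0 → ℝ) : Euc d → ℝ := fun x => φ ‖x‖₊

/-- The functions of the radius that belong to the M3r class in every dimension `d ≥ 1`. -/
def tcfM3rInfty : Set (ℝ≥0 → ℝ) := ⋂ d ∈ Ici 1, {φ | radial d φ ∈ tcfM3r d}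

end

open MeasureTheory ProbabilityTheory Set Filter Topology
open scoped ENNReal NNReal

/-! ### Existence of Poisson processes -/

/-! For a process with spectral functions V_t, void probabilities of the Poisson process give χ(t) =
∫ min(V_0, V_t) dν (`HasSpectralRepresentation.isTCF_iff`). Each class of processes thus becomes a
class of integrals. Conversely, such integrals are tail correlation functions as soon as the
required Poisson process exists (`exists_isPoissonProcess`, `exists_hasSpectralRepresentation`). Two
families of functions of the radius then matter: Laplace transforms of probability measures on (0,∞)
(`IsLaplace`) and scale mixtures of erfc (`IsErfcMixture`).

Storms. By mass transport, E vol(C ∩ (C − t)) / E vol(C) is the probability that no hyperplane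
separates 0 from t, which is exp(−c‖t‖) by isotropy. Mixing over Λ yields exactly the Laplace
transforms, in every dimension (`mem_tcfMPS_iff`).

Radial shapes. For a radially non-increasing shape, χ(t) is the mass that the mean shape puts on the
points x with |⟨x,t⟩| beyond ‖t‖²/2. Gaussian shapes give erfc(s‖t‖), so erfc mixtures are attained
in all dimensions. Conversely, averaging over a standard Gaussian vector g and using Fubini turns
the mean of φ(r√k/‖g‖) into an erfc mixture. Since ‖g‖/√k → 1, compactness of the probability
measures on [0,∞] represents φ itself as a mixture (`isErfcMixture_of_mem_tcfM3rInfty`).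

For (a), exp(−r) is itself an erfc mixture (`exists_erfc_mixture_exp`), hence so is every Laplace
transform. For (b), the linear field W_t = √8⟨t,N⟩ with random factor R has the tail correlation
function E erfc(R‖t‖), and BR is the case R = 1.

For (c), a Gaussian field with variogram 8‖t‖^{2α} exists for 0 < α < 1 and has the tail correlation
function erfc(‖t‖^α). It remains to see when erfc(r^α) is a Laplace transform. If α ≤ 1/2, this
follows from erfc(x) = e^{−x²} E e^{−2|N|x} and positive stable laws. If α > 1/2, the decay is
faster than any exponential; if α ≤ 0, the behaviour at zero is wrong. -/

theorem iIndepFun_curry {Ω ι κ β : Type*} [MeasurableSpace Ω] [MeasurableSpace β] {P : Measure Ω}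
    {X : ι → κ → Ω → β} (mX : ∀ i j, Measurable (X i j))
    (h : iIndepFun (fun (p : ι × κ) ω => X p.1 p.2 ω) P) :
    iIndepFun (fun i ω j => X i j ω) P := by
  have := h.isProbabilityMeasure
  have hp : ∀ i j, IsProbabilityMeasure (P.map (X i j)) :=
    fun i j => Measure.isProbabilityMeasure_map (mX i j).aemeasurable
  have h2 : ∀ i, iIndepFun (X i) P := fun i =>
    h.precomp (g := fun j => (i, j)) (fun a b hab => by simpa using hab)
  have e1 : P.map (fun ω (p : ι × κ) => X p.1 p.2 ω) =
      Measure.infinitePi (fun p : ι × κ => P.map (X p.1 p.2)) :=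
    (iIndepFun_iff_map_fun_eq_infinitePi_map (by fun_prop)).1 h
  rw [iIndepFun_iff_map_fun_eq_infinitePi_map (by fun_prop)]
  have e2 : (fun ω i j => X i j ω) = (MeasurableEquiv.curry ι κ β) ∘
      (fun ω (p : ι × κ) => X p.1 p.2 ω) := by
    ext; rfl
  rw [e2, ← Measure.map_map (by fun_prop) (by fun_prop), e1,
    Measure.infinitePi_map_curry (fun i j => P.map (X i j))]
  congr 1
  funext i
  exact ((iIndepFun_iff_map_fun_eq_infinitePi_map (mX i)).1 (h2 i)).symm

/-- A Poisson(1) number together with an i.i.d. sequence with law `m`. -/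
noncomputable def blockMeasure {S : Type*} [MeasurableSpace S] (m : Measure S)
    [IsProbabilityMeasure m] : Measure (ℕ × (ℕ → S)) :=
  (poissonMeasure 1).prod (Measure.infinitePi fun _ : ℕ => m)

instance {S : Type*} [MeasurableSpace S] (m : Measure S) [IsProbabilityMeasure m] :
    IsProbabilityMeasure (blockMeasure m) := by
  unfold blockMeasure; infer_instance

/-- The sum of `h` over the points of a block. -/
noncomputable def blockSum {S : Type*} (h : S → ℝ) (p : ℕ × (ℕ → S)) : ℝ :=
  ∑ i ∈ Finset.range p.1, h (p.2 i)

theorem measurable_blockSum {S : Type*} [MeasurableSpace S] {h : S → ℝ} (hh : Measurable h) :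
    Measurable (blockSum h) := by
  apply measurable_from_prod_countable_right
  intro n
  simp only [blockSum]
  fun_prop

/-- Given N = n the product has mean zⁿ with z = ∫ g dm, and summing zⁿ against Poisson(1) weights
gives exp(z − 1). With g = exp(ith) this yields characteristic functions of block sums, with g =
exp(−rh) their Laplace transforms. -/
theorem integral_block_prod {S : Type*} [MeasurableSpace S] (m : Measure S)
    [IsProbabilityMeasure m] {g : S → ℂ} (hg : Measurable g) (hb : ∀ y, ‖g y‖ ≤ 1) :
    ∫ p, ∏ i ∈ Finset.range p.1, g (p.2 i) ∂(blockMeasure m) = Complex.exp (∫ y, (g y - 1) ∂m) := by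
  have hmeas : Measurable (fun p : ℕ × (ℕ → S) => ∏ i ∈ Finset.range p.1, g (p.2 i)) := by
    apply measurable_from_prod_countable_right
    intro n
    simp only
    fun_prop
  have hint : Integrable (fun p : ℕ × (ℕ → S) => ∏ i ∈ Finset.range p.1, g (p.2 i))
      (blockMeasure m) := by
    refine (integrable_const (1 : ℝ)).mono' hmeas.aestronglyMeasurable (ae_of_all _ fun p => ?_)
    rw [norm_prod]
    exact Finset.prod_le_one (fun _ _ => norm_nonneg _) (fun _ _ => hb _)
  have hgi : Integrable g m :=
    (integrable_const (1 : ℝ)).mono' hg.aestronglyMeasurable (ae_of_all _ hb)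
  rw [blockMeasure] at hint ⊢
  rw [integral_prod _ hint]
  have inner : ∀ n : ℕ, ∫ y, ∏ i ∈ Finset.range n, g (y i) ∂(Measure.infinitePi fun _ : ℕ => m)
      = (∫ y, g y ∂m) ^ n := by
    intro n
    have hi : iIndepFun (fun (i : Fin n) (y : ℕ → S) => g (y i))
        (Measure.infinitePi fun _ : ℕ => m) :=
      (iIndepFun_infinitePi (P := fun _ : ℕ => m) (X := fun _ => g) (fun _ => hg)).precomp
        (g := fun i : Fin n => (i : ℕ)) Fin.val_injective
    have := hi.integral_fun_prod_eq_prod_integral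
      (fun i => (hg.comp (measurable_pi_apply _)).aestronglyMeasurable)
    simp_rw [Finset.prod_range]
    rw [this]
    have e : ∀ i : Fin n, ∫ y, g (y i) ∂(Measure.infinitePi fun _ : ℕ => m) = ∫ y, g y ∂m := by
      intro i
      have := (measurePreserving_eval_infinitePi (fun _ : ℕ => m) (i : ℕ))
      have h := integral_map (f := g) (μ := Measure.infinitePi fun _ : ℕ => m) this.measurable.aemeasurable hg.aestronglyMeasurable
      rw [this.map_eq] at h
      exact h.symm
    simp [e]
  simp_rw [inner]
  rw [integral_poissonMeasure]
  rw [integral_sub hgi (integrable_const _)]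
  simp only [integral_const, probReal_univ, one_smul]
  set z := ∫ y, g y ∂m
  have : ∀ n : ℕ, (Real.exp (-(1 : ℝ≥0)) * (1 : ℝ≥0) ^ n / n.factorial : ℝ) • z ^ n
      = (Real.exp (-1) : ℂ) * (z ^ n / n.factorial) := by
    intro n
    rw [Complex.real_smul]
    push_cast
    simp
    ring
  simp_rw [this]
  rw [tsum_mul_left, (NormedSpace.expSeries_div_hasSum_exp z).tsum_eq, ← Complex.exp_eq_exp_ℂ,
    Complex.ofReal_exp, ← Complex.exp_add]
  congr 1
  push_cast
  ring

theorem charFun_blockSum {S : Type*} [MeasurableSpace S] (m : Measure S)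
    [IsProbabilityMeasure m] {h : S → ℝ} (hh : Measurable h) (t : ℝ) :
    charFun ((blockMeasure m).map (blockSum h)) t =
      Complex.exp (∫ y, (Complex.exp (t * h y * Complex.I) - 1) ∂m) := by
  rw [charFun_apply_real, integral_map (measurable_blockSum hh).aemeasurable (by fun_prop),
    ← integral_block_prod m (g := fun y => Complex.exp (t * h y * Complex.I)) (by fun_prop)]
  · congr 1
    funext p
    rw [← Complex.exp_sum, blockSum]
    push_cast
    rw [Finset.mul_sum, Finset.sum_mul]
  · intro y
    rw [← Complex.ofReal_mul, Complex.norm_exp_ofReal_mul_I]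

theorem blockSum_indicator_law {S : Type*} [MeasurableSpace S] (m : Measure S)
    [IsProbabilityMeasure m] {A : Set S} (hA : MeasurableSet A) :
    (blockMeasure m).map (blockSum (A.indicator 1)) =
      (poissonMeasure (m A).toNNReal).map (fun k : ℕ => (k : ℝ)) := by
  have hm : Measurable (A.indicator (1 : S → ℝ)) := measurable_one.indicator hA
  have : IsProbabilityMeasure ((blockMeasure m).map (blockSum (A.indicator 1))) :=
    Measure.isProbabilityMeasure_map (measurable_blockSum hm).aemeasurable
  have : IsProbabilityMeasure ((poissonMeasure (m A).toNNReal).map (fun k : ℕ => (k : ℝ))) :=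
    Measure.isProbabilityMeasure_map (by fun_prop)
  apply Measure.ext_of_charFun
  funext t
  rw [charFun_blockSum m hm, charFun_map_cast_poissonMeasure]
  congr 1
  have : ∀ y, Complex.exp (t * ((A.indicator (1 : S → ℝ) y : ℝ) : ℂ) * Complex.I) - 1 =
      A.indicator (fun _ => Complex.exp (t * Complex.I) - 1) y := by
    intro y
    by_cases hy : y ∈ A <;> simp [hy]
  simp_rw [this]
  rw [integral_indicator hA, setIntegral_const, Complex.real_smul]
  congr 1

/-- The joint characteristic function is that of the block sum of Σ tᵢ 1_{Aᵢ} at 1. A point lies in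
at most one Aᵢ, so the integrand exp(i Σ tᵢ 1_{Aᵢ}) − 1 is a sum over i and the exponential
factorizes. -/
theorem blockSum_indicator_indep {S : Type*} [MeasurableSpace S] (m : Measure S)
    [IsProbabilityMeasure m] {ι : Type*} [Fintype ι] {A : ι → Set S} (hA : ∀ i, MeasurableSet (A i))
    (hd : Pairwise fun i j => Disjoint (A i) (A j)) :
    iIndepFun (fun i => blockSum ((A i).indicator 1)) (blockMeasure m) := by
  classical
  have hm : ∀ i, Measurable ((A i).indicator (1 : S → ℝ)) := fun i => measurable_one.indicator (hA i)
  rw [iIndepFun_iff_charFun_pi (fun i => (measurable_blockSum (hm i)).aemeasurable)]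
  intro t
  have hs : Measurable (fun y => ∑ i, t i * (A i).indicator (1 : S → ℝ) y) := by fun_prop
  have e : charFun ((blockMeasure m).map
      (fun ω => WithLp.toLp 2 fun i => blockSum ((A i).indicator 1) ω)) t =
      charFun ((blockMeasure m).map
        (blockSum (fun y => ∑ i, t i * (A i).indicator (1 : S → ℝ) y))) 1 := by
    rw [charFun_apply, charFun_apply_real, integral_map, integral_map]
    · congr 1
      funext p
      congr 2
      simp only [blockSum, PiLp.inner_apply]
      simp only [RCLike.inner_apply, conj_trivial]
      push_cast
      rw [one_mul]
      simp_rw [Finset.mul_sum]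
      rw [Finset.sum_comm]
    · exact (measurable_blockSum hs).aemeasurable
    · fun_prop
    · have := fun i => measurable_blockSum (hm i)
      fun_prop
    · fun_prop
  rw [e, charFun_blockSum m hs]
  simp_rw [charFun_blockSum m (hm _)]
  rw [← Complex.exp_sum, ← integral_finsetSum]
  · congr 1
    congr 1
    funext y
    by_cases hy : ∃ i, y ∈ A i
    · obtain ⟨i, hi⟩ := hy
      have hne : ∀ j, j ≠ i → y ∉ A j := fun j hj hyj =>
        Set.disjoint_left.1 (hd hj) hyj hi
      rw [Finset.sum_eq_single i, Finset.sum_eq_single i]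
      · simp [hi]
      · intro j _ hj; simp [hne j hj]
      · simp
      · intro j _ hj; simp [hne j hj]
      · simp
    · push Not at hy
      simp [hy]
  · intro i _
    refine (integrable_const (2 : ℝ)).mono' (by fun_prop) (ae_of_all _ fun y => ?_)
    refine (norm_sub_le _ _).trans ?_
    rw [← Complex.ofReal_mul, Complex.norm_exp_ofReal_mul_I]
    norm_num

theorem lintegral_ofReal_map_poisson (r : ℝ≥0) :
    ∫⁻ x, ENNReal.ofReal x ∂((poissonMeasure r).map (fun k : ℕ => (k : ℝ))) = r := by
  rw [lintegral_map (by fun_prop) (by fun_prop), lintegral_countable']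
  simp_rw [poissonMeasure_singleton]
  rw [tsum_eq_zero_add' ENNReal.summable]
  have : ∀ k : ℕ, ENNReal.ofReal ((k + 1 : ℕ) : ℝ) *
      ENNReal.ofReal (Real.exp (-r) * r ^ (k + 1) / (k + 1).factorial) =
      r * ENNReal.ofReal (Real.exp (-r) * r ^ k / k.factorial) := by
    intro k
    rw [← ENNReal.ofReal_mul (by positivity), ← ENNReal.ofReal_coe_nnreal,
      ← ENNReal.ofReal_mul (by positivity)]
    congr 1
    rw [Nat.factorial_succ]
    push_cast
    field_simp
    ring
  simp_rw [this]
  rw [ENNReal.tsum_mul_left, ← ENNReal.ofReal_tsum_of_nonneg (fun _ => by positivity)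
    (hasSum_one_poissonMeasure r).summable, (hasSum_one_poissonMeasure r).tsum_eq]
  simp

/-- Summable means make the total finite almost surely, so the partial sums converge almost surely
and their Poisson characteristic functions converge to that of the total. -/
theorem map_tsum_poisson {Ω : Type*} [MeasurableSpace Ω] {P : Measure Ω} [IsProbabilityMeasure P]
    {C : ℕ → Ω → ℝ} (hC : ∀ k, Measurable (C k)) (h0 : ∀ k ω, 0 ≤ C k ω) (hi : iIndepFun C P)
    {p : ℕ → ℝ≥0} (hl : ∀ k, P.map (C k) = (poissonMeasure (p k)).map (fun k : ℕ => (k : ℝ)))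
    (hs : Summable p) :
    P.map (fun ω => ∑' k, ENNReal.ofReal (C k ω)) =
      (poissonMeasure (∑' k, p k)).map (fun k : ℕ => (k : ℝ≥0∞)) := by
  have hT : Measurable (fun ω => ∑' k, ENNReal.ofReal (C k ω)) := by fun_prop
  have hmean : ∀ k, ∫⁻ ω, ENNReal.ofReal (C k ω) ∂P = p k := by
    intro k
    rw [← lintegral_ofReal_map_poisson, ← hl k, lintegral_map (by fun_prop) (hC k)]
  have hfin : ∀ᵐ ω ∂P, ∑' k, ENNReal.ofReal (C k ω) ≠ ∞ := by
    have : ∫⁻ ω, ∑' k, ENNReal.ofReal (C k ω) ∂P ≠ ∞ := by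
      rw [lintegral_tsum (fun k => (by fun_prop))]
      simp_rw [hmean]
      exact ENNReal.tsum_coe_ne_top_iff_summable.2 hs
    exact (ae_lt_top hT this).mono fun ω h => h.ne
  have hsum : ∀ᵐ ω ∂P, HasSum (fun k => C k ω) (∑' k, ENNReal.ofReal (C k ω)).toReal := by
    filter_upwards [hfin] with ω h
    have : Summable fun k => C k ω := by
      have h2 := ENNReal.summable_toReal h
      simpa [ENNReal.toReal_ofReal (h0 _ ω)] using h2
    rw [ENNReal.tsum_toReal_eq (fun _ => ENNReal.ofReal_ne_top)]
    simpa [ENNReal.toReal_ofReal (h0 _ ω)] using this.hasSum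
  have key : P.map (fun ω => (∑' k, ENNReal.ofReal (C k ω)).toReal) =
      (poissonMeasure (∑' k, p k)).map (fun k : ℕ => (k : ℝ)) := by
    have : IsProbabilityMeasure (P.map (fun ω => (∑' k, ENNReal.ofReal (C k ω)).toReal)) :=
      Measure.isProbabilityMeasure_map (by fun_prop)
    have : IsProbabilityMeasure ((poissonMeasure (∑' k, p k)).map (fun k : ℕ => (k : ℝ))) :=
      Measure.isProbabilityMeasure_map (by fun_prop)
    apply Measure.ext_of_charFun
    funext t
    rw [charFun_map_cast_poissonMeasure]
    have l1 : Tendsto (fun n => charFun (P.map (fun ω => ∑ k ∈ Finset.range n, C k ω)) t) atTop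
        (𝓝 (charFun (P.map (fun ω => (∑' k, ENNReal.ofReal (C k ω)).toReal)) t)) := by
      simp_rw [charFun_apply_real]
      rw [integral_map (by fun_prop) (by fun_prop)]
      have : ∀ n, ∫ x, Complex.exp (t * x * Complex.I)
          ∂(P.map (fun ω => ∑ k ∈ Finset.range n, C k ω)) =
          ∫ ω, Complex.exp (t * ((∑ k ∈ Finset.range n, C k ω : ℝ) : ℂ) * Complex.I) ∂P :=
        fun n => integral_map (by fun_prop) (by fun_prop)
      simp_rw [this]
      refine tendsto_integral_of_dominated_convergence (fun _ => (1 : ℝ)) (fun n => by fun_prop)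
        (integrable_const _) (fun n => ae_of_all _ fun ω => ?_) ?_
      · rw [← Complex.ofReal_mul, Complex.norm_exp_ofReal_mul_I]
      · filter_upwards [hsum] with ω h
        have h3 := h.tendsto_sum_nat
        exact ((by fun_prop : Continuous fun x : ℝ =>
          Complex.exp (t * (x : ℂ) * Complex.I)).tendsto _).comp h3
    have l2 : ∀ n, charFun (P.map (fun ω => ∑ k ∈ Finset.range n, C k ω)) t =
        Complex.exp (((∑ k ∈ Finset.range n, p k : ℝ≥0) : ℝ) * (Complex.exp (t * Complex.I) - 1)) := by
      intro n
      rw [iIndepFun.charFun_map_fun_finsetSum_eq_prod (fun i _ => (hC i).aemeasurable)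
        (hi.precomp (g := ((↑) : Finset.range n → ℕ)) Subtype.val_injective)]
      rw [Finset.prod_apply]
      simp_rw [hl, charFun_map_cast_poissonMeasure]
      rw [← Complex.exp_sum, ← Finset.sum_mul]
      push_cast
      rfl
    simp_rw [l2] at l1
    refine tendsto_nhds_unique l1 ?_
    have l3 : Tendsto (fun n => ((∑ k ∈ Finset.range n, p k : ℝ≥0) : ℝ)) atTop
        (𝓝 ((∑' k, p k : ℝ≥0) : ℝ)) :=
      (NNReal.continuous_coe.tendsto _).comp hs.hasSum.tendsto_sum_nat
    exact ((by fun_prop : Continuous fun x : ℝ => Complex.exp ((x : ℂ) *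
      (Complex.exp (t * Complex.I) - 1))).tendsto _).comp l3
  have e : (fun ω => ∑' k, ENNReal.ofReal (C k ω)) =ᵐ[P]
      ENNReal.ofReal ∘ (fun ω => (∑' k, ENNReal.ofReal (C k ω)).toReal) := by
    filter_upwards [hfin] with ω h
    simp [ENNReal.ofReal_toReal h]
  rw [Measure.map_congr e, ← Measure.map_map (by fun_prop) (by fun_prop), key,
    Measure.map_map (by fun_prop) (by fun_prop)]
  congr 1
  funext k
  simp

/-- Independent blocks, one for each `m k`, superpose to the required process. By the second
Borel–Cantelli lemma infinitely many blocks are nonempty, so the points can be listed as a sequence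
without gaps. -/
theorem exists_isPoissonProcess {S : Type} [MeasurableSpace S] (m : ℕ → Measure S)
    [∀ k, IsProbabilityMeasure (m k)] :
    ∃ (Ω : Type) (_ : MeasurableSpace Ω) (P : Measure Ω) (Φ : ℕ → Ω → S),
      IsProbabilityMeasure P ∧ IsPoissonProcess Φ (Measure.sum m) P := by
  classical
  let Ω := ℕ → ℕ × (ℕ → S)
  let P : Measure Ω := Measure.infinitePi fun k => blockMeasure (m k)
  -- Slot `j` codes a pair (k, i) and is occupied when block k has more than i points.
  let p : Ω → ℕ → Prop := fun ω j => (Nat.unpair j).2 < (ω (Nat.unpair j).1).1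
  let y : ℕ → Ω → S := fun j ω => (ω (Nat.unpair j).1).2 (Nat.unpair j).2
  let c : Ω → ℕ → ℕ := fun ω j => ∑ i ∈ Finset.range j, if p ω i then 1 else 0
  -- The index of the `n`-th occupied slot. If there is none, `sInf ∅ = 0` produces a spurious
  -- point; `hinf` shows that this has probability zero.
  let idx : ℕ → Ω → ℕ := fun n ω => sInf {j | p ω j ∧ c ω j = n}
  have hcount : ∀ ω j, c ω j = Nat.count (p ω) j := fun ω j => by
    simp only [c, Nat.count_eq_card_filter_range, Finset.card_filter]
  have hpm : ∀ j, MeasurableSet {ω | p ω j} := fun j =>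
    measurableSet_lt measurable_const ((measurable_pi_apply _).fst)
  have hcm : ∀ j, Measurable fun ω => c ω j := fun j =>
    Finset.measurable_sum _ fun i _ => Measurable.ite (hpm i) measurable_const measurable_const
  have hidx : ∀ n, Measurable (idx n) := by
    intro n
    refine measurable_to_countable' fun j => ?_
    have hsub : ∀ ω a b, (p ω a ∧ c ω a = n) → (p ω b ∧ c ω b = n) → a = b := by
      intro ω a b ha hb
      rw [hcount] at ha hb
      exact Nat.count_injective ha.1 hb.1 (ha.2.trans hb.2.symm)
    have : idx n ⁻¹' {j} = {ω | p ω j ∧ c ω j = n} ∪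
        ({ω | j = 0} ∩ ⋂ i, {ω | p ω i ∧ c ω i = n}ᶜ) := by
      ext ω
      simp only [mem_preimage, mem_singleton_iff, mem_union, mem_inter_iff, mem_iInter,
        mem_compl_iff, mem_ofPred_eq, idx]
      by_cases hne : ∃ i, p ω i ∧ c ω i = n
      · obtain ⟨i, hi⟩ := hne
        have hs : {j | p ω j ∧ c ω j = n} = {i} := by
          ext b
          exact ⟨fun hb => hsub ω b i hb hi, fun hb => by rw [mem_singleton_iff] at hb; rwa [hb]⟩
        rw [hs, csInf_singleton]
        constructor
        · rintro rfl; exact Or.inl hi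
        · rintro (h | h)
          · exact hsub ω i j hi h
          · exact absurd hi (h.2 i)
      · have hs : {j | p ω j ∧ c ω j = n} = ∅ := by
          ext b; simp only [mem_ofPred_eq, mem_empty_iff_false, iff_false]
          exact fun hb => hne ⟨b, hb⟩
        rw [hs, Nat.sInf_empty]
        constructor
        · rintro rfl
          exact Or.inr ⟨rfl, fun i hi => hne ⟨i, hi⟩⟩
        · rintro (h | h)
          · exact absurd ⟨j, h⟩ hne
          · exact h.1.symm
    rw [this]
    have hm1 : ∀ j, MeasurableSet {ω | p ω j ∧ c ω j = n} := fun j =>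
      (hpm j).inter (measurableSet_eq_fun (hcm j) measurable_const)
    exact (hm1 j).union ((MeasurableSet.const _).inter (MeasurableSet.iInter fun i => (hm1 i).compl))
  have hym : ∀ j, Measurable (y j) := fun j =>
    (measurable_pi_apply _).comp (measurable_pi_apply _).snd
  have hPhi : ∀ n, Measurable fun ω => y (idx n ω) ω := by
    intro n
    have h2 : Measurable (fun q : ℕ × Ω => y q.1 q.2) :=
      measurable_from_prod_countable_right fun j => hym j
    exact h2.comp ((hidx n).prodMk measurable_id)
  have hindep : iIndepFun (fun k (ω : Ω) => ω k) P :=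
    iIndepFun_infinitePi (P := fun k => blockMeasure (m k)) (X := fun _ => id)
      (fun _ => measurable_id)
  have hmap : ∀ k, P.map (fun ω => ω k) = blockMeasure (m k) := fun k =>
    (measurePreserving_eval_infinitePi (fun k => blockMeasure (m k)) k).map_eq
  have hinf : ∀ᵐ ω ∂P, {j | p ω j}.Infinite := by
    let s : ℕ → Set Ω := fun k => {ω | 0 < (ω k).1}
    have hsm : ∀ k, MeasurableSet (s k) := fun k =>
      measurableSet_lt measurable_const ((measurable_pi_apply _).fst)
    have hsi : iIndepSet s P := by
      have := hindep.comp (fun _ q => 0 < q.1) (fun _ =>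
        measurableSet_setOfPred.1 (measurableSet_lt measurable_const measurable_fst))
      rw [iIndepSet_iff_meas_biInter hsm]
      intro t
      have h3 := this.meas_biInter (S := t) (s := s) (fun i _ => ⟨{True}, trivial, by
        ext ω; simp [s]⟩)
      exact h3
    have hmeas : ∀ k, P (s k) = poissonMeasure 1 {n | 0 < n} := by
      intro k
      have : s k = (fun ω : Ω => ω k) ⁻¹' {q | 0 < q.1} := rfl
      rw [this, ← Measure.map_apply (measurable_pi_apply k)
        (measurableSet_lt measurable_const measurable_fst), hmap, blockMeasure]
      have : {q : ℕ × (ℕ → S) | 0 < q.1} = {n | 0 < n} ×ˢ univ := by ext; simp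
      rw [this, Measure.prod_prod, measure_univ, mul_one]
    have hpos : poissonMeasure 1 {n | 0 < n} ≠ 0 := by
      intro h
      have h1 : poissonMeasure 1 {1} = 0 :=
        measure_mono_null (fun x hx => by simp only [mem_singleton_iff] at hx; simp [hx]) h
      rw [poissonMeasure_singleton, ENNReal.ofReal_eq_zero] at h1
      have : 0 < Real.exp (-(1 : ℝ≥0)) * (1 : ℝ≥0) ^ 1 / (Nat.factorial 1) := by positivity
      linarith
    have := measure_limsup_eq_one hsm hsi (by
      simp_rw [hmeas]
      exact ENNReal.tsum_const_eq_top_of_ne_zero hpos)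
    have hae : ∀ᵐ ω ∂P, ω ∈ limsup s atTop := by
      rw [← mem_ae_iff_prob_eq_one₀] at this
      · exact this
      · exact (MeasurableSet.measurableSet_limsup hsm).nullMeasurableSet
    filter_upwards [hae] with ω hω
    rw [mem_limsup_iff_frequently_mem, Nat.frequently_atTop_iff_infinite] at hω
    have hi : (fun k => Nat.pair k 0) '' {k | ω ∈ s k} ⊆ {j | p ω j} := by
      rintro _ ⟨k, hk, rfl⟩
      have hk : 0 < (ω k).1 := hk
      simpa [p] using hk
    refine Set.Infinite.mono hi (hω.image fun a _ b _ hab => ?_)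
    simpa using congrArg (fun z => (Nat.unpair z).1) hab
  have hcountA : ∀ A : Set S, ∀ᵐ ω ∂P, pointCount (fun n ω => y (idx n ω) ω) A ω =
      ∑' k, ENNReal.ofReal (blockSum (A.indicator 1) (ω k)) := by
    intro A
    filter_upwards [hinf] with ω hω
    have hnth : ∀ n, idx n ω = Nat.nth (p ω) n := by
      intro n
      have hs : {j | p ω j ∧ c ω j = n} = {Nat.nth (p ω) n} := by
        ext b
        simp only [mem_ofPred_eq, mem_singleton_iff, hcount]
        constructor
        · rintro ⟨h1, h2⟩
          rw [← h2, Nat.nth_count h1]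
        · rintro rfl
          exact ⟨Nat.nth_mem_of_infinite hω n, Nat.count_nth_of_infinite hω n⟩
      simp only [idx]
      rw [hs, csInf_singleton]
    simp only [pointCount, hnth]
    let f : ℕ → ℝ≥0∞ := fun j => if p ω j then A.indicator 1 (y j ω) else 0
    have e1 : ∀ n, A.indicator (1 : S → ℝ≥0∞) (y (Nat.nth (p ω) n) ω) = f (Nat.nth (p ω) n) := by
      intro n
      simp only [f]
      rw [if_pos (Nat.nth_mem_of_infinite hω n)]
    simp_rw [e1]
    rw [Function.Injective.tsum_eq (Nat.nth_injective hω) (f := f)]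
    · rw [← Nat.pairEquiv.tsum_eq, ENNReal.tsum_prod']
      congr 1
      funext k
      simp only [f, p, y, Nat.pairEquiv_apply, Function.uncurry_apply_pair, Nat.unpair_pair]
      rw [tsum_eq_sum (s := Finset.range (ω k).1), blockSum,
        ENNReal.ofReal_sum_of_nonneg]
      · refine Finset.sum_congr rfl fun i hi => ?_
        rw [if_pos (Finset.mem_range.1 hi)]
        by_cases h : (ω k).2 i ∈ A <;> simp [h]
      · intro i _
        exact indicator_nonneg (fun _ _ => zero_le_one) _
      · intro i hi
        rw [if_neg (by simpa using hi)]
    · intro j hj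
      have : p ω j := by
        by_contra h
        simp [f, h] at hj
      rw [Nat.range_nth_of_infinite hω]
      exact this
  have hbm : ∀ A : Set S, MeasurableSet A → Measurable (blockSum (A.indicator (1 : S → ℝ))) :=
    fun A hA => measurable_blockSum (measurable_one.indicator hA)
  have hb0 : ∀ (A : Set S) (q : ℕ × (ℕ → S)), 0 ≤ blockSum (A.indicator (1 : S → ℝ)) q :=
    fun A q => Finset.sum_nonneg fun i _ => indicator_nonneg (fun _ _ => zero_le_one) _
  refine ⟨Ω, inferInstance, P, fun n ω => y (idx n ω) ω, inferInstance, hPhi, ?_, ?_⟩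
  · intro A hA hfin
    rw [Measure.map_congr (hcountA A)]
    rw [Measure.sum_apply _ hA] at hfin ⊢
    have hk : ∀ k, m k A ≠ ∞ := fun k => measure_ne_top _ _
    rw [map_tsum_poisson (P := P) (C := fun k (ω : Ω) => blockSum (A.indicator 1) (ω k))
      (p := fun k => (m k A).toNNReal)]
    · rw [ENNReal.tsum_toNNReal_eq hk]
    · exact fun k => (hbm A hA).comp (measurable_pi_apply k)
    · exact fun k ω => hb0 A _
    · exact hindep.comp (fun _ => blockSum (A.indicator 1)) (fun _ => hbm A hA)
    · intro k
      rw [← blockSum_indicator_law (m k) hA, ← hmap k,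
        Measure.map_map (hbm A hA) (measurable_pi_apply k)]
      rfl
    · have := ENNReal.summable_toNNReal_of_tsum_ne_top hfin
      exact this
  · intro n A hA hd
    -- Independence of the blocks, together with independence over disjoint sets inside a block,
    -- makes the whole array of counts independent. Transposing it and summing each row over the
    -- blocks gives independence over the sets.
    have h1 : iIndepFun (fun (q : ℕ × Fin n) (ω : Ω) => blockSum ((A q.2).indicator 1) (ω q.1)) P := by
      refine iIndepFun_uncurry' (X := fun k i (ω : Ω) => blockSum ((A i).indicator 1) (ω k))
        (fun k i => (hbm _ (hA i)).comp (measurable_pi_apply k)) ?_ ?_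
      · exact hindep.comp (fun _ q i => blockSum ((A i).indicator 1) q)
          (fun _ => measurable_pi_lambda _ fun i => hbm _ (hA i))
      · intro k
        have h2 := blockSum_indicator_indep (m k) hA hd
        rw [← hmap k] at h2
        rw [iIndepFun_iff_measure_inter_preimage_eq_mul] at h2 ⊢
        intro t sets hsets
        have e : (⋂ i ∈ t, (fun ω : Ω => blockSum ((A i).indicator 1) (ω k)) ⁻¹' sets i) =
            (fun ω : Ω => ω k) ⁻¹' (⋂ i ∈ t, blockSum ((A i).indicator 1) ⁻¹' sets i) := by
          simp only [preimage_iInter]; rfl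
        have h4 := h2 t hsets
        rw [Measure.map_apply (measurable_pi_apply k)
          (Finset.measurableSet_biInter _ fun i hi => hbm _ (hA i) (hsets i hi)), ← e] at h4
        rw [h4]
        refine Finset.prod_congr rfl fun i hi => ?_
        rw [Measure.map_apply (measurable_pi_apply k) (hbm _ (hA i) (hsets i hi))]
        rfl
    have h2 : iIndepFun (fun (q : Fin n × ℕ) (ω : Ω) => blockSum ((A q.1).indicator 1) (ω q.2)) P :=
      h1.precomp (g := Prod.swap) Prod.swap_injective
    have h3 := iIndepFun_curry (X := fun i k (ω : Ω) => blockSum ((A i).indicator 1) (ω k))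
      (fun i k => (hbm _ (hA i)).comp (measurable_pi_apply k)) h2
    have h4 := h3.comp (fun _ g => ∑' k, ENNReal.ofReal (g k)) (fun _ => by fun_prop)
    exact h4.congr fun i => (hcountA (A i)).mono fun ω h => h.symm

/-! ### The measure `u⁻² du` -/

theorem invSqMeasure_Ioi {c : ℝ} (hc : 0 < c) : invSqMeasure (Ioi c) = ENNReal.ofReal c⁻¹ := by
  rw [invSqMeasure, withDensity_apply _ measurableSet_Ioi, Measure.restrict_restrict
    measurableSet_Ioi, inter_eq_left.2 (Ioi_subset_Ioi hc.le)]
  have h1 : IntegrableOn (fun u : ℝ => u ^ (-2 : ℝ)) (Ioi c) :=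
    integrableOn_Ioi_rpow_of_lt (by norm_num) hc
  have e : ∫⁻ u in Ioi c, ENNReal.ofReal ((u ^ 2)⁻¹) =
      ∫⁻ u in Ioi c, ENNReal.ofReal (u ^ (-2 : ℝ)) := by
    refine setLIntegral_congr_fun measurableSet_Ioi fun u hu => ?_
    have hu : 0 < u := hc.trans hu
    rw [Real.rpow_neg hu.le]
    norm_num
  rw [e, ← ofReal_integral_eq_lintegral_ofReal h1, integral_Ioi_rpow_of_lt (by norm_num) hc]
  · congr 1
    norm_num
    rw [Real.rpow_neg_one]
  · exact (ae_restrict_mem measurableSet_Ioi).mono fun u hu =>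
      Real.rpow_nonneg (hc.le.trans (le_of_lt hu)) _

instance : SigmaFinite invSqMeasure := by
  unfold invSqMeasure
  exact SigmaFinite.withDensity_of_ne_top (ae_of_all _ fun _ => ENNReal.ofReal_ne_top)

theorem invSqMeasure_Iic_zero : invSqMeasure (Iic 0) = 0 := by
  rw [invSqMeasure, withDensity_apply _ measurableSet_Iic, Measure.restrict_restrict
    measurableSet_Iic]
  have : Iic (0 : ℝ) ∩ Ioi 0 = ∅ := by ext; simp
  rw [this]
  simp

/-- The `k`-th piece of the partition of `(0, ∞)` into sets of `u⁻² du`-measure `1 / M`. -/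
def invSqPiece (M : ℝ) (k : ℕ) : Set ℝ := Ioi 0 ∩ (fun u => ⌊M / u⌋₊) ⁻¹' {k}

theorem measurableSet_invSqPiece (M : ℝ) (k : ℕ) : MeasurableSet (invSqPiece M k) :=
  measurableSet_Ioi.inter ((Nat.measurable_floor.comp (by fun_prop)) (measurableSet_singleton k))

/-- The piece is (M/(k+1), M/k], or (M, ∞) for k = 0, and (c, ∞) has mass 1/c. -/
theorem invSqMeasure_piece {M : ℝ} (hM : 0 < M) (k : ℕ) :
    invSqMeasure (invSqPiece M k) = ENNReal.ofReal M⁻¹ := by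
  rcases Nat.eq_zero_or_pos k with rfl | hk
  · have : invSqPiece M 0 = Ioi M := by
      ext u
      simp only [invSqPiece, mem_inter_iff, mem_Ioi, mem_preimage, mem_singleton_iff]
      constructor
      · rintro ⟨h1, h2⟩
        rw [Nat.floor_eq_zero, div_lt_one h1] at h2
        exact h2
      · intro h
        have h0 := hM.trans h
        exact ⟨h0, by rw [Nat.floor_eq_zero, div_lt_one h0]; exact h⟩
    rw [this, invSqMeasure_Ioi hM]
  · have hk' : (0 : ℝ) < k := by exact_mod_cast hk
    have : invSqPiece M k = Ioi (M / (k + 1)) \ Ioi (M / k) := by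
      ext u
      simp only [invSqPiece, mem_inter_iff, mem_Ioi, mem_preimage, mem_singleton_iff, Set.mem_sdiff,
        not_lt]
      constructor
      · rintro ⟨h1, h2⟩
        rw [Nat.floor_eq_iff (by positivity), le_div_iff₀ h1, div_lt_iff₀ h1] at h2
        constructor
        · rw [div_lt_iff₀ (by positivity)]; linarith
        · rw [le_div_iff₀ hk']; linarith
      · rintro ⟨h1, h2⟩
        have h0 : 0 < u := lt_trans (by positivity) h1
        rw [div_lt_iff₀ (by positivity)] at h1
        rw [le_div_iff₀ hk'] at h2
        refine ⟨h0, ?_⟩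
        rw [Nat.floor_eq_iff (by positivity), le_div_iff₀ h0, div_lt_iff₀ h0]
        constructor <;> linarith
    rw [this, measure_sdiff (Ioi_subset_Ioi (by gcongr; linarith)) measurableSet_Ioi.nullMeasurableSet,
      invSqMeasure_Ioi (by positivity), invSqMeasure_Ioi (by positivity),
      ← ENNReal.ofReal_sub _ (by positivity)]
    · congr 1
      field_simp
      ring
    · rw [invSqMeasure_Ioi (by positivity)]
      exact ENNReal.ofReal_ne_top

theorem invSqMeasure_eq_sum (M : ℝ) :
    invSqMeasure = Measure.sum fun k => invSqMeasure.restrict (invSqPiece M k) := by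
  rw [← Measure.restrict_iUnion]
  · have : ⋃ k, invSqPiece M k = Ioi 0 := by
      ext u
      simp [invSqPiece]
    rw [this, Measure.restrict_eq_self_of_ae_mem]
    rw [ae_iff]
    have : {a : ℝ | a ∉ Ioi (0 : ℝ)} = Iic 0 := by ext; simp
    rw [this, invSqMeasure_Iic_zero]
  · intro i j hij
    refine Set.disjoint_left.2 fun u hu hv => hij ?_
    exact hu.2.symm.trans hv.2
  · exact measurableSet_invSqPiece M

theorem exists_isPoissonProcess_of_countable {S ι : Type} [MeasurableSpace S] [Countable ι]
    [Infinite ι] (m : ι → Measure S) [∀ k, IsProbabilityMeasure (m k)] :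
    ∃ (Ω : Type) (_ : MeasurableSpace Ω) (P : Measure Ω) (Φ : ℕ → Ω → S),
      IsProbabilityMeasure P ∧ IsPoissonProcess Φ (Measure.sum m) P := by
  obtain ⟨e⟩ := nonempty_equiv_of_countable (α := ℕ) (β := ι)
  have := exists_isPoissonProcess (fun k => m (e k))
  have h : Measure.sum m = Measure.sum (fun k => m (e k)) := by
    ext s hs
    rw [Measure.sum_apply _ hs, Measure.sum_apply _ hs]
    exact (e.tsum_eq fun i => m i s).symm
  rwa [h]

/-- Split ν into finite measures and drop the zero ones. A piece of mass M is multiplied with the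
parts of the u-axis of mass 1/M, so that the intensity becomes a countable sum of probability
measures. -/
theorem exists_isPoissonProcess_invSq_prod {S : Type} [MeasurableSpace S] (ν : Measure S)
    [SFinite ν] (hν : ν ≠ 0) :
    ∃ (Ω : Type) (_ : MeasurableSpace Ω) (P : Measure Ω) (Φ : ℕ → Ω → ℝ × S),
      IsProbabilityMeasure P ∧ IsPoissonProcess Φ (invSqMeasure.prod ν) P := by
  let κ := {n : ℕ // sfiniteSeq ν n ≠ 0}
  have hκ : Nonempty κ := by
    by_contra h
    apply hν
    rw [← sum_sfiniteSeq ν]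
    have : ∀ n, sfiniteSeq ν n = 0 := fun n => by
      by_contra hn
      exact h ⟨⟨n, hn⟩⟩
    ext s hs
    simp [Measure.sum_apply _ hs, this]
  let M : κ → ℝ := fun n => (sfiniteSeq ν n univ).toReal
  have hM : ∀ n, 0 < M n := fun n => ENNReal.toReal_pos
    (by simpa using n.2) (measure_ne_top _ _)
  let m : κ × ℕ → Measure (ℝ × S) := fun p =>
    (invSqMeasure.restrict (invSqPiece (M p.1) p.2)).prod (sfiniteSeq ν p.1)
  have hm : ∀ p, IsProbabilityMeasure (m p) := by
    intro p
    constructor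
    simp only [m]
    rw [← univ_prod_univ, Measure.prod_prod, Measure.restrict_apply_univ,
      invSqMeasure_piece (hM _)]
    have : sfiniteSeq ν p.1 univ = ENNReal.ofReal (M p.1) :=
      (ENNReal.ofReal_toReal (measure_ne_top _ _)).symm
    rw [this, ← ENNReal.ofReal_mul (inv_nonneg.2 (hM _).le), inv_mul_cancel₀ (hM _).ne']
    simp
  have hsum : invSqMeasure.prod ν = Measure.sum m := by
    ext s hs
    rw [Measure.sum_apply _ hs, ENNReal.tsum_prod']
    have h1 : ∀ n : κ, ∑' k, m (n, k) s = (invSqMeasure.prod (sfiniteSeq ν n)) s := by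
      intro n
      conv_rhs => rw [invSqMeasure_eq_sum (M n), Measure.prod_sum_left, Measure.sum_apply _ hs]
    simp_rw [h1]
    conv_lhs => rw [← sum_sfiniteSeq ν, Measure.prod_sum_right, Measure.sum_apply _ hs]
    refine (tsum_subtype_eq_of_support_subset (s := {n | sfiniteSeq ν n ≠ 0})
      (f := fun n => (invSqMeasure.prod (sfiniteSeq ν n)) s) fun n hn hn' => hn ?_).symm
    simp [hn']
  rw [hsum]
  exact exists_isPoissonProcess_of_countable m

/-! ### Spectral representations -/

theorem exists_hasSpectralRepresentation {T S : Type} [Nonempty T] [MeasurableSpace S]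
    (ν : Measure S) [SFinite ν] {V : T → S → ℝ≥0∞} (hV : ∀ t, Measurable (V t))
    (h1 : ∀ t, ∫⁻ w, V t w ∂ν = 1) :
    ∃ (Ω : Type) (_ : MeasurableSpace Ω) (P : Measure Ω) (X : T → Ω → ℝ≥0∞),
      IsProbabilityMeasure P ∧ HasSpectralRepresentation X P ν V := by
  have hν : ν ≠ 0 := by
    rintro rfl
    simpa using h1 (Classical.arbitrary T)
  obtain ⟨Ω, _, P, Φ, hP, hΦ⟩ := exists_isPoissonProcess_invSq_prod ν hν
  refine ⟨Ω, _, P, fun t ω => ⨆ n, ENNReal.ofReal (Φ n ω).1 * V t (Φ n ω).2, hP, hV, h1,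
    Ω, _, P, Φ, hP, hΦ, IdentDistrib.refl ?_⟩
  refine (measurable_pi_lambda _ fun t => Measurable.iSup fun n => ?_).aemeasurable
  exact ((hΦ.measurable n).fst.ennreal_ofReal).mul ((hV t).comp (hΦ.measurable n).snd)

/-! ### Void probabilities and the formula for the tail correlation function -/

theorem IsPoissonProcess.measurable_pointCount {Ω S : Type*} [MeasurableSpace Ω]
    [MeasurableSpace S] {Φ : ℕ → Ω → S} {μ : Measure S} {P : Measure Ω}
    (h : IsPoissonProcess Φ μ P) {A : Set S} (hA : MeasurableSet A) :
    Measurable (pointCount Φ A) :=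
  Measurable.tsum fun n => (measurable_one.indicator hA).comp (h.measurable n)

theorem pointCount_eq_zero_iff {Ω S : Type*} (Φ : ℕ → Ω → S) (A : Set S) (ω : Ω) :
    pointCount Φ A ω = 0 ↔ ∀ n, Φ n ω ∉ A := by
  simp [pointCount, ENNReal.tsum_eq_zero]

theorem IsPoissonProcess.measure_void {Ω S : Type*} [MeasurableSpace Ω]
    [MeasurableSpace S] {Φ : ℕ → Ω → S} {μ : Measure S} {P : Measure Ω}
    (h : IsPoissonProcess Φ μ P) {A : Set S} (hA : MeasurableSet A) (hfin : μ A ≠ ∞) :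
    P {ω | ∀ n, Φ n ω ∉ A} = ENNReal.ofReal (Real.exp (-(μ A).toReal)) := by
  have e : {ω | ∀ n, Φ n ω ∉ A} = pointCount Φ A ⁻¹' {0} := by
    ext ω
    simp [pointCount_eq_zero_iff]
  rw [e, ← Measure.map_apply (h.measurable_pointCount hA) (measurableSet_singleton _),
    h.count_law A hA hfin, Measure.map_apply (by fun_prop) (measurableSet_singleton _)]
  have : (fun k : ℕ => (k : ℝ≥0∞)) ⁻¹' {0} = {0} := by ext; simp
  rw [this, poissonMeasure_singleton]
  simp [ENNReal.coe_toNNReal_eq_toReal]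

/-- For fixed w the admissible u form the half-line (a/W(w), ∞), of mass W(w)/a. -/
theorem invSq_prod_superlevel {S : Type*} [MeasurableSpace S] {ν : Measure S} [SFinite ν]
    {W : S → ℝ≥0∞} (hW : Measurable W) (hfin : ∫⁻ w, W w ∂ν ≠ ∞) {a : ℝ} (ha : 0 < a) :
    invSqMeasure.prod ν {p | ENNReal.ofReal a < ENNReal.ofReal p.1 * W p.2} =
      (∫⁻ w, W w ∂ν) / ENNReal.ofReal a := by
  have hm : MeasurableSet {p : ℝ × S | ENNReal.ofReal a < ENNReal.ofReal p.1 * W p.2} :=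
    measurableSet_lt measurable_const (by fun_prop)
  rw [Measure.prod_apply_symm hm, div_eq_mul_inv, ← lintegral_mul_const _ hW]
  refine lintegral_congr_ae ?_
  filter_upwards [ae_lt_top hW hfin] with w hw
  obtain ⟨v, hv⟩ : ∃ v : ℝ≥0, W w = v := ⟨(W w).toNNReal, (ENNReal.coe_toNNReal hw.ne).symm⟩
  rw [hv]
  rcases eq_or_ne v 0 with rfl | hv0
  · simp [hv]
  have hv' : 0 < (v : ℝ) := by positivity
  have : (fun x => (x, w)) ⁻¹' {p : ℝ × S | ENNReal.ofReal a < ENNReal.ofReal p.1 * W p.2} =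
      Ioi (a / v) := by
    ext u
    simp only [mem_preimage, mem_ofPred_eq, mem_Ioi, hv]
    rw [← ENNReal.ofReal_coe_nnreal, ← ENNReal.ofReal_mul' hv'.le, ENNReal.ofReal_lt_ofReal_iff',
      div_lt_iff₀ hv']
    exact ⟨fun h => h.1, fun h => ⟨h, ha.trans h⟩⟩
  rw [this, invSqMeasure_Ioi (by positivity), inv_div, ENNReal.ofReal_div_of_pos ha,
    ENNReal.ofReal_coe_nnreal, div_eq_mul_inv]

theorem IsPoissonProcess.measure_iSup_lt {Ω S : Type*} [MeasurableSpace Ω]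
    [MeasurableSpace S] {ν : Measure S} [SFinite ν] {Φ : ℕ → Ω → ℝ × S} {P : Measure Ω}
    (h : IsPoissonProcess Φ (invSqMeasure.prod ν) P) {W : S → ℝ≥0∞} (hW : Measurable W)
    (hfin : ∫⁻ w, W w ∂ν ≠ ∞) {τ : ℝ} (hτ : 0 < τ) :
    P {ω | (⨆ n, ENNReal.ofReal (Φ n ω).1 * W (Φ n ω).2) < ENNReal.ofReal τ} =
      ENNReal.ofReal (Real.exp (-((∫⁻ w, W w ∂ν).toReal / τ))) := by
  have hle : ∀ a : ℝ, 0 < a → P {ω | (⨆ n, ENNReal.ofReal (Φ n ω).1 * W (Φ n ω).2) ≤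
      ENNReal.ofReal a} = ENNReal.ofReal (Real.exp (-((∫⁻ w, W w ∂ν).toReal / a))) := by
    intro a ha
    have hm : MeasurableSet {p : ℝ × S | ENNReal.ofReal a < ENNReal.ofReal p.1 * W p.2} :=
      measurableSet_lt measurable_const (by fun_prop)
    have e := invSq_prod_superlevel hW hfin ha
    have e2 := h.measure_void hm (by
      rw [e]
      exact (ENNReal.div_lt_top hfin (by simpa using ha)).ne)
    rw [e, ENNReal.toReal_div, ENNReal.toReal_ofReal ha.le] at e2
    rw [← e2]
    congr 1
    ext ω
    simp
  set c := (∫⁻ w, W w ∂ν).toReal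
  -- The void event describes sup ≤ a. The strict inequality at τ follows by letting a increase to
  -- τ, since the limit law is continuous.
  have hcont : Tendsto (fun a : ℝ => ENNReal.ofReal (Real.exp (-(c / a)))) (𝓝[<] τ)
      (𝓝 (ENNReal.ofReal (Real.exp (-(c / τ))))) := by
    have h1 : ContinuousAt (fun a : ℝ => Real.exp (-(c / a))) τ :=
      (continuousAt_const.div continuousAt_id hτ.ne').neg.rexp
    exact (ENNReal.tendsto_ofReal h1.tendsto).mono_left nhdsWithin_le_nhds
  apply le_antisymm
  · rw [← hle τ hτ]
    refine measure_mono fun ω hω => ?_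
    rw [mem_ofPred_eq] at hω ⊢
    exact hω.le
  · refine le_of_tendsto hcont ?_
    filter_upwards [Ioo_mem_nhdsLT (show (0 : ℝ) < τ from hτ)] with a ha
    rw [← hle a ha.1]
    refine measure_mono fun ω hω => ?_
    rw [mem_ofPred_eq] at hω ⊢
    exact lt_of_le_of_lt hω ((ENNReal.ofReal_lt_ofReal_iff hτ).2 ha.2)

/-- With θ = ∫ max(V_0, V_t), inclusion–exclusion makes the numerator the probability of a joint
exceedance of τ, of order (2 − θ)/τ; the denominator, a single exceedance, is of order 1/τ. -/
theorem tendsto_one_sub_exp_div {θ : ℝ} :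
    Tendsto (fun τ : ℝ => (1 - 2 * Real.exp (-(1 / τ)) + Real.exp (-(θ / τ))) /
      (1 - Real.exp (-(1 / τ)))) atTop (𝓝 (2 - θ)) := by
  have key : ∀ c : ℝ, Tendsto (fun τ : ℝ => τ * (1 - Real.exp (-(c / τ)))) atTop (𝓝 c) := by
    intro c
    have h1 : HasDerivAt (fun x : ℝ => -Real.exp (-(c * x))) c 0 := by
      have := (((hasDerivAt_id' (0 : ℝ)).const_mul c).fun_neg.exp).fun_neg
      simpa using this
    have h2 := h1.tendsto_slope
    have h3 : Tendsto (fun τ : ℝ => τ⁻¹) atTop (𝓝[≠] 0) :=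
      tendsto_inv_atTop_nhdsGT_zero.mono_right (nhdsWithin_mono _ fun x hx => ne_of_gt hx)
    refine (h2.comp h3).congr' ?_
    filter_upwards [eventually_gt_atTop 0] with τ hτ
    simp only [Function.comp_apply, slope, vsub_eq_sub, smul_eq_mul, sub_zero, inv_inv, mul_zero,
      neg_zero, Real.exp_zero, div_eq_mul_inv]
    ring
  have h4 : Tendsto (fun τ : ℝ => 2 - (τ * (1 - Real.exp (-(θ / τ)))) /
      (τ * (1 - Real.exp (-(1 / τ))))) atTop (𝓝 (2 - θ / 1)) :=
    tendsto_const_nhds.sub ((key θ).div (key 1) one_ne_zero)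
  rw [div_one] at h4
  refine h4.congr' ?_
  filter_upwards [eventually_gt_atTop 0] with τ hτ
  have : Real.exp (-(1 / τ)) < 1 := by
    rw [Real.exp_lt_one_iff]
    have : 0 < 1 / τ := by positivity
    linarith
  have h5 : 1 - Real.exp (-(1 / τ)) ≠ 0 := by linarith
  rw [mul_div_mul_left _ _ hτ.ne']
  field_simp
  ring

/-- The joint law at level τ is governed by the maximum of the two spectral functions, and 2 − ∫ max
= ∫ min because both have integral one. -/
theorem HasSpectralRepresentation.tendsto_cond {d : ℕ} {Ω S : Type} [MeasurableSpace Ω]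
    [MeasurableSpace S] {X : Euc d → Ω → ℝ≥0∞} {P : Measure Ω} {ν : Measure S} [SFinite ν]
    {V : Euc d → S → ℝ≥0∞} (h : HasSpectralRepresentation X P ν V) (t : Euc d) :
    Tendsto (fun τ : ℝ => (ProbabilityTheory.cond P {ω | ENNReal.ofReal τ ≤ X 0 ω}).real
      {ω | ENNReal.ofReal τ ≤ X t ω}) atTop (𝓝 (∫⁻ w, min (V 0 w) (V t w) ∂ν).toReal) := by
  obtain ⟨hV, h1, Ω', _, P', Φ, hP', hΦ, hid⟩ := h
  set Y : Euc d → Ω' → ℝ≥0∞ := fun t ω' => ⨆ n, ENNReal.ofReal (Φ n ω').1 * V t (Φ n ω').2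
  have hYm : ∀ t, Measurable (Y t) := fun t => Measurable.iSup fun n =>
    ((hΦ.measurable n).fst.ennreal_ofReal).mul ((hV t).comp (hΦ.measurable n).snd)
  have hXm : ∀ t, AEMeasurable (X t) P := fun t =>
    (measurable_pi_apply t).comp_aemeasurable hid.aemeasurable_fst
  have hmin_le : ∫⁻ w, min (V 0 w) (V t w) ∂ν ≤ 1 :=
    (lintegral_mono fun w => min_le_left _ _).trans (h1 0).le
  have hsum : ∫⁻ w, min (V 0 w) (V t w) ∂ν + ∫⁻ w, max (V 0 w) (V t w) ∂ν = 2 := by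
    rw [← lintegral_add_left ((hV 0).min (hV t))]
    simp_rw [min_add_max]
    rw [lintegral_add_left (hV 0), h1, h1]
    norm_num
  have hmin_top : ∫⁻ w, min (V 0 w) (V t w) ∂ν ≠ ∞ := (hmin_le.trans_lt ENNReal.one_lt_top).ne
  have hmax_top : ∫⁻ w, max (V 0 w) (V t w) ∂ν ≠ ∞ := by
    intro h
    rw [h] at hsum
    simp at hsum
  have hmin : (∫⁻ w, min (V 0 w) (V t w) ∂ν).toReal =
      2 - (∫⁻ w, max (V 0 w) (V t w) ∂ν).toReal := by
    have := congrArg ENNReal.toReal hsum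
    rw [ENNReal.toReal_add hmin_top hmax_top] at this
    simp at this
    linarith
  rw [hmin]
  set θ := (∫⁻ w, max (V 0 w) (V t w) ∂ν).toReal
  refine tendsto_one_sub_exp_div.congr' ?_
  filter_upwards [eventually_gt_atTop 0] with τ hτ
  have p1 : ∀ t, P'.real {ω | Y t ω < ENNReal.ofReal τ} = Real.exp (-(1 / τ)) := by
    intro t
    rw [measureReal_def, hΦ.measure_iSup_lt (hV t) (by rw [h1]; exact ENNReal.one_ne_top) hτ, h1,
      ENNReal.toReal_ofReal (Real.exp_pos _).le, ENNReal.toReal_one]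
  have p2 : P'.real ({ω | Y 0 ω < ENNReal.ofReal τ} ∩ {ω | Y t ω < ENNReal.ofReal τ}) =
      Real.exp (-(θ / τ)) := by
    have : {ω | Y 0 ω < ENNReal.ofReal τ} ∩ {ω | Y t ω < ENNReal.ofReal τ} =
        {ω | (⨆ n, ENNReal.ofReal (Φ n ω).1 * max (V 0 (Φ n ω).2) (V t (Φ n ω).2))
          < ENNReal.ofReal τ} := by
      ext ω
      simp only [mem_inter_iff, mem_ofPred_eq, Y]
      simp_rw [mul_max]
      rw [← max_lt_iff]
      have := iSup_sup_eq (f := fun n => ENNReal.ofReal (Φ n ω).1 * V 0 (Φ n ω).2)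
        (g := fun n => ENNReal.ofReal (Φ n ω).1 * V t (Φ n ω).2)
      rw [this]
    rw [this, measureReal_def, hΦ.measure_iSup_lt ((hV 0).max (hV t)) hmax_top hτ,
      ENNReal.toReal_ofReal (Real.exp_pos _).le]
  have hms : ∀ t, MeasurableSet {ω | Y t ω < ENNReal.ofReal τ} := fun t =>
    measurableSet_lt (hYm t) measurable_const
  have hc : ∀ t, {ω | ENNReal.ofReal τ ≤ Y t ω} = {ω | Y t ω < ENNReal.ofReal τ}ᶜ := by
    intro t; ext ω; simp
  have q1 : P'.real {ω | ENNReal.ofReal τ ≤ Y 0 ω} = 1 - Real.exp (-(1 / τ)) := by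
    rw [hc, probReal_compl_eq_one_sub (hms 0), p1]
  have q2 : P'.real ({ω | ENNReal.ofReal τ ≤ Y 0 ω} ∩ {ω | ENNReal.ofReal τ ≤ Y t ω}) =
      1 - 2 * Real.exp (-(1 / τ)) + Real.exp (-(θ / τ)) := by
    rw [hc, hc, ← compl_union, probReal_compl_eq_one_sub ((hms 0).union (hms t))]
    have := measureReal_union_add_inter (μ := P') (s := {ω | Y 0 ω < ENNReal.ofReal τ}) (hms t)
    rw [p1, p1, p2] at this
    linarith
  have r1 : P {ω | ENNReal.ofReal τ ≤ X 0 ω} = P' {ω | ENNReal.ofReal τ ≤ Y 0 ω} :=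
    hid.measure_mem_eq (s := {f | ENNReal.ofReal τ ≤ f 0})
      (measurableSet_le measurable_const (measurable_pi_apply 0))
  have r2 : P ({ω | ENNReal.ofReal τ ≤ X 0 ω} ∩ {ω | ENNReal.ofReal τ ≤ X t ω}) =
      P' ({ω | ENNReal.ofReal τ ≤ Y 0 ω} ∩ {ω | ENNReal.ofReal τ ≤ Y t ω}) :=
    hid.measure_mem_eq (s := {f | ENNReal.ofReal τ ≤ f 0} ∩ {f | ENNReal.ofReal τ ≤ f t})
      ((measurableSet_le measurable_const (measurable_pi_apply 0)).inter
        (measurableSet_le measurable_const (measurable_pi_apply t)))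
  have hnull : NullMeasurableSet {ω | ENNReal.ofReal τ ≤ X 0 ω} P :=
    nullMeasurableSet_le aemeasurable_const (hXm 0)
  rw [measureReal_def, ProbabilityTheory.cond, Measure.smul_apply, Measure.restrict_apply₀' hnull,
    smul_eq_mul, inter_comm, r1, r2, ENNReal.toReal_mul, ENNReal.toReal_inv, ← measureReal_def,
    ← measureReal_def, q1, q2]
  rw [div_eq_inv_mul]

/-- This reduces every later statement on tail correlation functions to the computation of an
integral. -/
theorem HasSpectralRepresentation.isTCF_iff {d : ℕ} {Ω S : Type} [MeasurableSpace Ω]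
    [MeasurableSpace S] {X : Euc d → Ω → ℝ≥0∞} {P : Measure Ω} {ν : Measure S} [SFinite ν]
    {V : Euc d → S → ℝ≥0∞} (h : HasSpectralRepresentation X P ν V) (χ : Euc d → ℝ) :
    IsTCF X P χ ↔ ∀ t, χ t = (∫⁻ w, min (V 0 w) (V t w) ∂ν).toReal :=
  ⟨fun hχ t => tendsto_nhds_unique (hχ t) (h.tendsto_cond t),
    fun hχ t => by rw [hχ t]; exact h.tendsto_cond t⟩

/-! ### The complementary error function and Gaussian laws -/

theorem integrable_exp_neg_sq : Integrable fun y : ℝ => Real.exp (-y ^ 2) := by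
  simpa using integrable_exp_neg_mul_sq (b := 1) one_pos

theorem erfc_eq_gaussianReal (x : ℝ) : erfc x = 2 * (gaussianReal 0 (1 / 2)).real (Ioi x) := by
  rw [measureReal_def, gaussianReal_apply_eq_integral _ (by norm_num), ENNReal.toReal_ofReal
    (integral_nonneg fun x => gaussianPDFReal_nonneg _ _ _), erfc, div_mul_eq_mul_div,
    mul_div_assoc]
  congr 1
  rw [div_eq_inv_mul, ← integral_const_mul]
  congr 1
  funext y
  rw [gaussianPDFReal]
  push_cast
  congr 2
  · congr 1; ring
  · simp

theorem erfc_zero : erfc 0 = 1 := by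
  rw [erfc]
  have := integral_gaussian_Ioi 1
  simp only [neg_mul, one_mul, div_one] at this
  rw [this]
  have : √Real.pi ≠ 0 := by positivity
  field_simp

theorem erfc_nonneg (x : ℝ) : 0 ≤ erfc x := by
  rw [erfc_eq_gaussianReal]; positivity

theorem erfc_antitone : Antitone erfc := by
  intro x y h
  rw [erfc_eq_gaussianReal, erfc_eq_gaussianReal]
  have := measureReal_mono (μ := gaussianReal 0 (1 / 2)) (Ioi_subset_Ioi h)
  linarith

theorem erfc_le_one {x : ℝ} (hx : 0 ≤ x) : erfc x ≤ 1 := erfc_zero ▸ erfc_antitone hx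

theorem continuous_erfc : Continuous erfc := by
  have h : ∀ x, erfc x = 2 / √Real.pi * ((∫ y in Ioi 0, Real.exp (-y ^ 2)) -
      ∫ y in (0 : ℝ)..x, Real.exp (-y ^ 2)) := by
    intro x
    rw [erfc]
    congr 1
    have := intervalIntegral.integral_interval_add_Ioi (a := 0) (b := x)
      (integrable_exp_neg_sq.integrableOn) (integrable_exp_neg_sq.integrableOn)
    linarith
  have : erfc = fun x => 2 / √Real.pi * ((∫ y in Ioi 0, Real.exp (-y ^ 2)) -
      ∫ y in (0 : ℝ)..x, Real.exp (-y ^ 2)) := funext h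
  rw [this]
  have h2 := intervalIntegral.continuous_primitive (μ := volume)
    (fun a b => integrable_exp_neg_sq.intervalIntegrable (a := a) (b := b)) 0
  fun_prop

/-- Substitute y = w + x. The first factor carries the decay used for upper bounds; the second is
the Laplace transform of twice a half-normal variable. -/
theorem erfc_eq_exp_mul (x : ℝ) :
    erfc x = Real.exp (-x ^ 2) * (2 / √Real.pi *
      ∫ w in Ioi (0 : ℝ), Real.exp (-w ^ 2) * Real.exp (-(2 * w * x))) := by
  rw [erfc, mul_left_comm, ← integral_const_mul (Real.exp (-x ^ 2))]
  congr 1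
  rw [← integral_indicator measurableSet_Ioi, ← integral_indicator measurableSet_Ioi,
    ← integral_add_right_eq_self _ x]
  congr 1
  funext w
  by_cases hw : 0 < w
  · rw [indicator_of_mem (by simpa using hw), indicator_of_mem (by simpa using hw),
      ← Real.exp_add, ← Real.exp_add]
    congr 1
    ring
  · rw [indicator_of_notMem (by simpa using hw), indicator_of_notMem (by simpa using hw)]

theorem erfc_le_exp {x : ℝ} (hx : 0 ≤ x) : erfc x ≤ Real.exp (-x ^ 2) := by
  rw [erfc_eq_exp_mul]
  refine mul_le_of_le_one_right (Real.exp_pos _).le ?_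
  calc _ ≤ 2 / √Real.pi * ∫ w in Ioi (0 : ℝ), Real.exp (-w ^ 2) := by
        gcongr
        · refine integrable_exp_neg_sq.integrableOn.mono' (by fun_prop) ?_
          refine (ae_restrict_mem measurableSet_Ioi).mono fun w hw => ?_
          have hw : 0 < w := hw
          rw [Real.norm_of_nonneg (by positivity)]
          refine mul_le_of_le_one_right (Real.exp_pos _).le ?_
          rw [Real.exp_le_one_iff]
          have : 0 ≤ w * x := by positivity
          linarith
        · exact integrable_exp_neg_sq.integrableOn
        · exact measurableSet_Ioi.nullMeasurableSet
        · rename_i hw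
          have hw : 0 < w := hw
          refine mul_le_of_le_one_right (Real.exp_pos _).le ?_
          rw [Real.exp_le_one_iff]
          have : 0 ≤ w * x := by positivity
          linarith
    _ = erfc 0 := rfl
    _ = 1 := erfc_zero

theorem tendsto_erfc_atTop : Tendsto erfc atTop (𝓝 0) := by
  refine tendsto_of_tendsto_of_tendsto_of_le_of_le' tendsto_const_nhds ?_
    (Eventually.of_forall erfc_nonneg) ((eventually_ge_atTop 0).mono fun x hx => erfc_le_exp hx)
  refine Real.tendsto_exp_atBot.comp ?_
  exact tendsto_neg_atTop_atBot.comp (tendsto_pow_atTop two_ne_zero)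

theorem gaussianReal_half_abs_ge {x : ℝ} (hx : 0 ≤ x) :
    gaussianReal 0 (1 / 2) {y | x ≤ |y|} = ENNReal.ofReal (erfc x) := by
  have hn : NullSingletonClass (gaussianReal 0 (1 / 2)) :=
    nullSingletonClass_gaussianReal (by norm_num)
  rcases hx.eq_or_lt with rfl | hx
  · have : {y : ℝ | 0 ≤ |y|} = univ := by ext; simp
    rw [this, erfc_zero, measure_univ, ENNReal.ofReal_one]
  have e : {y : ℝ | x ≤ |y|} = Ici x ∪ (fun y => -y) ⁻¹' (Ici x) := by
    ext y
    simp only [le_abs, mem_union, mem_Ici, mem_preimage, mem_ofPred_eq]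
  have hd : Disjoint (Ici x) ((fun y => -y) ⁻¹' (Ici x)) := by
    refine Set.disjoint_left.2 fun y h1 h2 => ?_
    simp only [mem_preimage, mem_Ici] at h1 h2
    linarith
  rw [e, measure_union hd (measurable_neg measurableSet_Ici),
    ← Measure.map_apply measurable_neg measurableSet_Ici]
  have : (gaussianReal 0 (1 / 2)).map (fun x => -x) = gaussianReal 0 (1 / 2) := by
    rw [gaussianReal_map_neg]; simp
  rw [show Measure.map Neg.neg (gaussianReal 0 (1 / 2)) = gaussianReal 0 (1 / 2) from this]
  rw [← measure_congr (Ioi_ae_eq_Ici (μ := gaussianReal 0 (1 / 2)) (a := x)), ← two_mul,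
    erfc_eq_gaussianReal, ENNReal.ofReal_mul (by norm_num), measureReal_def,
    ENNReal.ofReal_toReal (measure_ne_top _ _)]
  norm_num

theorem gaussianReal_abs_ge {v : ℝ≥0} (hv : v ≠ 0) {x : ℝ} (hx : 0 ≤ x) :
    gaussianReal 0 v {y | x ≤ |y|} = ENNReal.ofReal (erfc (x / √(2 * v))) := by
  have hv' : 0 < (v : ℝ) := by positivity
  have hs : 0 < √(2 * (v : ℝ)) := by positivity
  rw [← gaussianReal_half_abs_ge (by positivity)]
  have h := gaussianReal_map_const_mul (μ := 0) (v := 1 / 2) (√(2 * (v : ℝ)))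
  have e : NNReal.mk ((√(2 * (v : ℝ))) ^ 2) (sq_nonneg _) * (1 / 2) = v := by
    ext
    rw [NNReal.coe_mul]
    simp only [NNReal.coe_mk]
    rw [Real.sq_sqrt (by positivity)]
    simp only [NNReal.coe_div, NNReal.coe_one, NNReal.coe_ofNat]
    ring
  rw [e, mul_zero] at h
  rw [← h, Measure.map_apply (by fun_prop) (measurableSet_le (by fun_prop) (by fun_prop))]
  congr 1
  ext y
  simp only [mem_preimage, mem_ofPred_eq, abs_mul, abs_of_pos hs]
  rw [div_le_iff₀ hs, mul_comm]

/-- Cameron–Martin in one dimension: completing the square shows that the density exp(x − v/2)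
shifts the mean by v. -/
theorem gaussianReal_tilt {v : ℝ≥0} (hv : v ≠ 0) {s : Set ℝ} (hs : MeasurableSet s) :
    ∫⁻ x in s, ENNReal.ofReal (Real.exp (x - v / 2)) ∂(gaussianReal 0 v) = gaussianReal v v s := by
  rw [gaussianReal_of_var_ne_zero _ hv, gaussianReal_of_var_ne_zero _ hv,
    withDensity_apply _ hs, setLIntegral_withDensity_eq_setLIntegral_mul _ (by fun_prop)
    (by fun_prop) hs]
  refine setLIntegral_congr_fun hs fun x _ => ?_
  simp only [Pi.mul_apply, gaussianPDF]
  rw [← ENNReal.ofReal_mul (gaussianPDFReal_nonneg _ _ _)]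
  congr 1
  have hv' : (v : ℝ) ≠ 0 := by simpa using hv
  rw [gaussianPDFReal, gaussianPDFReal, mul_assoc, ← Real.exp_add]
  congr 2
  field_simp
  ring

theorem lintegral_exp_gaussianReal (v : ℝ≥0) :
    ∫⁻ x, ENNReal.ofReal (Real.exp (x - v / 2)) ∂(gaussianReal 0 v) = 1 := by
  rcases eq_or_ne v 0 with rfl | hv
  · simp
  · rw [← setLIntegral_univ, gaussianReal_tilt hv MeasurableSet.univ, measure_univ]

/-- The minimum is 1 above v/2. Below, the tilted law is the Gaussian shifted by v, so its mass
there is that of the lower tail beyond −v/2. Together they give P(|N| ≥ v/2) with Var N = v. -/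
theorem lintegral_min_exp_gaussianReal (v : ℝ≥0) :
    ∫⁻ x, min 1 (ENNReal.ofReal (Real.exp (x - v / 2))) ∂(gaussianReal 0 v) =
      ENNReal.ofReal (erfc (√(v / 8))) := by
  rcases eq_or_ne v 0 with rfl | hv
  · simp [erfc_zero]
  have hv' : 0 < (v : ℝ) := by positivity
  have hn : NullSingletonClass (gaussianReal 0 v) := nullSingletonClass_gaussianReal hv
  have e1 : ∫⁻ x in Ici (v / 2 : ℝ), min 1 (ENNReal.ofReal (Real.exp (x - v / 2)))
      ∂(gaussianReal 0 v) = gaussianReal 0 v (Ici (v / 2 : ℝ)) := by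
    rw [← setLIntegral_one]
    refine setLIntegral_congr_fun measurableSet_Ici fun x hx => ?_
    have hx : (v / 2 : ℝ) ≤ x := hx
    refine min_eq_left ?_
    rw [← ENNReal.ofReal_one]
    exact ENNReal.ofReal_le_ofReal (Real.one_le_exp (by linarith))
  have e2 : ∫⁻ x in (Ici (v / 2 : ℝ))ᶜ, min 1 (ENNReal.ofReal (Real.exp (x - v / 2)))
      ∂(gaussianReal 0 v) = gaussianReal 0 v (Iio (-(v / 2) : ℝ)) := by
    have : gaussianReal 0 v (Iio (-(v / 2) : ℝ)) = gaussianReal v v (Iio (v / 2 : ℝ)) := by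
      have h := gaussianReal_map_add_const (μ := 0) (v := v) (v : ℝ)
      rw [zero_add] at h
      rw [← h, Measure.map_apply (by fun_prop) measurableSet_Iio]
      congr 1
      ext x
      simp only [mem_Iio, mem_preimage]
      constructor <;> intro h <;> linarith
    rw [this, ← gaussianReal_tilt hv measurableSet_Iio, compl_Ici]
    refine setLIntegral_congr_fun measurableSet_Iio fun x hx => ?_
    have hx : x < (v / 2 : ℝ) := hx
    refine min_eq_right ?_
    rw [← ENNReal.ofReal_one]
    exact ENNReal.ofReal_le_ofReal (by rw [Real.exp_le_one_iff]; linarith)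
  rw [← lintegral_add_compl _ (measurableSet_Ici (a := (v / 2 : ℝ))), e1, e2,
    measure_congr (Iio_ae_eq_Iic (μ := gaussianReal 0 v)), ← measure_union _ measurableSet_Iic]
  · have e : Ici (v / 2 : ℝ) ∪ Iic (-(v / 2) : ℝ) = {y | (v / 2 : ℝ) ≤ |y|} := by
      ext y
      simp only [mem_union, mem_Ici, mem_Iic, mem_ofPred_eq, le_abs]
      constructor <;> rintro (h | h) <;> first | (left; linarith) | (right; linarith)
    rw [e, gaussianReal_abs_ge hv (by positivity)]
    congr 2
    rw [eq_comm, Real.sqrt_eq_iff_mul_self_eq (by positivity) (by positivity), ← sq, div_pow, Real.sq_sqrt (by positivity)]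
    field_simp
    norm_num
  · refine Set.disjoint_left.2 fun y h1 h2 => ?_
    simp only [mem_Iic, mem_Ici] at h1 h2
    linarith

/-- Scale mixtures of the complementary error function. -/
def IsErfcMixture (φ : ℝ≥0 → ℝ) : Prop :=
  ∃ G : Measure ℝ, IsProbabilityMeasure G ∧ G (Iic 0) = 0 ∧ ∀ r : ℝ≥0, φ r = ∫ s, erfc (s * r) ∂G

theorem ae_pos_of_Iic {G : Measure ℝ} (h : G (Iic 0) = 0) : ∀ᵐ s ∂G, 0 < s := by
  rw [ae_iff]
  have : {a : ℝ | ¬ 0 < a} = Iic 0 := by ext; simp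
  rwa [this]

/-! ### Radially non-increasing shapes -/

/-- The complement of a symmetric half-open interval. -/
def twoTails (a : ℝ) : Set ℝ := Iic (-a) ∪ Ioi a

theorem measurableSet_twoTails (a : ℝ) : MeasurableSet (twoTails a) :=
  measurableSet_Iic.union measurableSet_Ioi

theorem gaussianReal_twoTails {v : ℝ≥0} (hv : v ≠ 0) {a : ℝ} (ha : 0 ≤ a) :
    gaussianReal 0 v (twoTails a) = ENNReal.ofReal (erfc (a / √(2 * v))) := by
  have hn : NullSingletonClass (gaussianReal 0 v) := nullSingletonClass_gaussianReal hv
  rw [← gaussianReal_abs_ge hv ha]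
  have h1 : (twoTails a : Set ℝ) =ᵐ[gaussianReal 0 v] (Iic (-a) ∪ Ici a : Set ℝ) :=
    (ae_eq_refl _).union Ioi_ae_eq_Ici
  rw [measure_congr h1]
  congr 1
  ext y
  simp only [mem_union, mem_Iic, mem_Ici, mem_ofPred_eq, le_abs]
  constructor <;> rintro (h | h) <;> first | (left; linarith) | (right; linarith)

/-- The minimum of f(x) and f(x + t) is the value at the point farther from the origin. The
comparison switches at ⟨x,t⟩ = −‖t‖²/2, and translating the open half-space by t moves its boundary
to +‖t‖²/2. Hence one closed and one open tail, which at t = 0 fill the whole space. -/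
theorem lintegral_min_shift {k : ℕ} {f : Euc k → ℝ≥0∞}
    (hr : ∀ x y, ‖x‖ ≤ ‖y‖ → f y ≤ f x) (t : Euc k) :
    ∫⁻ z, min (f (0 - z)) (f (t - z)) =
      ∫⁻ x in (fun x => inner ℝ x t) ⁻¹' twoTails (‖t‖ ^ 2 / 2), f x := by
  have hi : Measurable fun x : Euc k => inner ℝ x t := by fun_prop
  have hA : MeasurableSet {x : Euc k | inner ℝ x t ≤ -(‖t‖ ^ 2 / 2)} :=
    measurableSet_le hi measurable_const
  have hB : MeasurableSet {x : Euc k | ‖t‖ ^ 2 / 2 < inner ℝ x t} :=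
    measurableSet_lt measurable_const hi
  have e0 : ∫⁻ z, min (f (0 - z)) (f (t - z)) = ∫⁻ x, min (f x) (f (x + t)) := by
    rw [← lintegral_neg_eq_self (fun x => min (f x) (f (x + t)))]
    congr 1
    funext z
    rw [zero_sub, sub_eq_neg_add]
  have e1 : (fun x : Euc k => inner ℝ x t) ⁻¹' twoTails (‖t‖ ^ 2 / 2) =
      {x | inner ℝ x t ≤ -(‖t‖ ^ 2 / 2)} ∪ {x | ‖t‖ ^ 2 / 2 < inner ℝ x t} := by
    ext x; simp [twoTails]
  have hn : ∀ x : Euc k, ‖x + t‖ ≤ ‖x‖ ↔ inner ℝ x t ≤ -(‖t‖ ^ 2 / 2) := by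
    intro x
    rw [← sq_le_sq₀ (norm_nonneg _) (norm_nonneg _), norm_add_sq_real]
    constructor <;> intro h <;> linarith
  rw [e0, e1, lintegral_union hB, ← lintegral_add_compl _ hA]
  · congr 1
    · refine setLIntegral_congr_fun hA fun x hx => ?_
      exact min_eq_left (hr _ _ ((hn x).2 hx))
    · rw [← lintegral_indicator hA.compl, ← lintegral_indicator hB]
      conv_rhs => rw [← lintegral_add_right_eq_self _ t]
      congr 1
      funext x
      have hm : x + t ∈ {x : Euc k | ‖t‖ ^ 2 / 2 < inner ℝ x t} ↔
          x ∈ {x : Euc k | inner ℝ x t ≤ -(‖t‖ ^ 2 / 2)}ᶜ := by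
        simp only [mem_ofPred_eq, mem_compl_iff, not_le, inner_add_left,
          real_inner_self_eq_norm_sq]
        constructor <;> intro h <;> linarith
      by_cases hx : x ∈ {x : Euc k | inner ℝ x t ≤ -(‖t‖ ^ 2 / 2)}ᶜ
      · rw [indicator_of_mem hx, indicator_of_mem (hm.2 hx)]
        refine min_eq_right (hr _ _ ?_)
        by_contra h
        exact hx ((hn x).1 (not_le.1 h).le)
      · rw [indicator_of_notMem hx, indicator_of_notMem (fun h => hx (hm.1 h))]
  · refine Set.disjoint_left.2 fun x h1 h2 => ?_
    rw [mem_ofPred_eq] at h1 h2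
    have : 0 ≤ ‖t‖ ^ 2 / 2 := by positivity
    linarith

theorem lintegral_min_shift_prod {k : ℕ} {S : Type} [MeasurableSpace S] {Q : Measure S}
    [SFinite Q] {f : S → Euc k → ℝ≥0∞} (hf : Measurable (fun p : S × Euc k => f p.1 p.2))
    (hr : ∀ s x y, ‖x‖ ≤ ‖y‖ → f s y ≤ f s x) (t : Euc k) :
    ∫⁻ p, min (f p.2 (0 - p.1)) (f p.2 (t - p.1)) ∂((volume : Measure (Euc k)).prod Q) =
      ∫⁻ s, (∫⁻ x in (fun x => inner ℝ x t) ⁻¹' twoTails (‖t‖ ^ 2 / 2), f s x) ∂Q := by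
  have hm : ∀ t : Euc k, Measurable fun p : Euc k × S => f p.2 (t - p.1) := fun t =>
    hf.comp (measurable_snd.prodMk (measurable_const.sub measurable_fst))
  rw [lintegral_prod_symm _ ((hm 0).min (hm t)).aemeasurable]
  exact lintegral_congr fun s =>
    lintegral_min_shift (hr s) t

/-- The mean of a random shape, as a measure. -/
noncomputable def shapeMeasure {k : ℕ} {S : Type} [MeasurableSpace S] (Q : Measure S)
    (f : S → Euc k → ℝ≥0∞) : Measure (Euc k) :=
  volume.withDensity fun x => ∫⁻ s, f s x ∂Q

theorem shapeMeasure_apply {k : ℕ} {S : Type} [MeasurableSpace S] (Q : Measure S) [SFinite Q]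
    {f : S → Euc k → ℝ≥0∞} (hf : Measurable (fun p : S × Euc k => f p.1 p.2)) {B : Set (Euc k)}
    (hB : MeasurableSet B) : shapeMeasure Q f B = ∫⁻ s, (∫⁻ x in B, f s x) ∂Q := by
  rw [shapeMeasure, withDensity_apply _ hB, lintegral_lintegral_swap]
  exact (hf.comp measurable_swap).aemeasurable

/-- The region of integration does not depend on the realization, so only the mean shape enters. Its
absolute continuity is recorded to exclude mass on hyperplanes and at the origin. -/
theorem exists_measure_of_mem_tcfM3r {k : ℕ} {χ : Euc k → ℝ} (hχ : χ ∈ tcfM3r k) :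
    ∃ m : Measure (Euc k), IsProbabilityMeasure m ∧ m ≪ volume ∧
      ∀ t, ENNReal.ofReal (χ t) = m ((fun x => inner ℝ x t) ⁻¹' twoTails (‖t‖ ^ 2 / 2)) ∧
        0 ≤ χ t := by
  obtain ⟨Ω, _, P, X, hP, ⟨S, _, Q, f, hr, hM3⟩, hT⟩ := hχ
  have := hM3.prob
  have hT := (hM3.spectral.isTCF_iff χ).1 hT
  have hB : ∀ t : Euc k, MeasurableSet ((fun x => inner ℝ x t) ⁻¹' twoTails (‖t‖ ^ 2 / 2)) :=
    fun t => (by fun_prop : Measurable fun x : Euc k => inner ℝ x t) (measurableSet_twoTails _)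
  have hprob : IsProbabilityMeasure (shapeMeasure Q f) := by
    constructor
    rw [shapeMeasure_apply Q hM3.measurable_shape MeasurableSet.univ]
    simpa using hM3.lintegral_shape
  refine ⟨shapeMeasure Q f, hprob, withDensity_absolutelyContinuous _ _, fun t => ⟨?_, ?_⟩⟩
  · rw [hT t, lintegral_min_shift_prod hM3.measurable_shape hr t,
      ← shapeMeasure_apply Q hM3.measurable_shape (hB t), ENNReal.ofReal_toReal (measure_ne_top _ _)]
  · rw [hT t]; exact ENNReal.toReal_nonneg

theorem mem_tcfM3r_of_shape {k : ℕ} {S : Type} [MeasurableSpace S] {Q : Measure S}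
    [IsProbabilityMeasure Q] {f : S → Euc k → ℝ≥0∞}
    (hf : Measurable (fun p : S × Euc k => f p.1 p.2))
    (hr : ∀ s x y, ‖x‖ ≤ ‖y‖ → f s y ≤ f s x) (h1 : ∫⁻ s, (∫⁻ t, f s t) ∂Q = 1) :
    (fun t : Euc k => (∫⁻ s, (∫⁻ x in (fun x => inner ℝ x t) ⁻¹' twoTails (‖t‖ ^ 2 / 2), f s x)
      ∂Q).toReal) ∈ tcfM3r k := by
  have hm : ∀ t : Euc k, Measurable fun p : Euc k × S => f p.2 (t - p.1) := fun t =>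
    hf.comp (measurable_snd.prodMk (measurable_const.sub measurable_fst))
  obtain ⟨Ω, _, P, X, hP, hX⟩ := exists_hasSpectralRepresentation
    ((volume : Measure (Euc k)).prod Q) (V := fun (t : Euc k) p => f p.2 (t - p.1)) hm (fun t => by
      rw [lintegral_prod_symm _ (hm t).aemeasurable, ← h1]
      exact lintegral_congr fun s => lintegral_sub_left_eq_self (f s) t)
  refine ⟨Ω, _, P, X, hP, ⟨S, _, Q, f, hr, inferInstance, hf, h1, hX⟩, ?_⟩
  rw [hX.isTCF_iff]
  intro t
  rw [lintegral_min_shift_prod hf hr t]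

/-! ### Gaussian shapes -/

/-- The centred Gaussian density with covariance `1 / (8 s²)` times the identity. -/
noncomputable def gaussianShape (k : ℕ) (s : ℝ) (x : Euc k) : ℝ :=
  (Real.pi / (4 * s ^ 2)) ^ (-(k / 2 : ℝ)) * Real.exp (-(4 * s ^ 2) * ‖x‖ ^ 2)

theorem gaussianShape_nonneg (k : ℕ) (s : ℝ) (x : Euc k) : 0 ≤ gaussianShape k s x := by
  unfold gaussianShape; positivity

theorem integrable_gaussianShape {k : ℕ} {s : ℝ} (hs : 0 < s) :
    Integrable (gaussianShape k s) := by
  have := (GaussianFourier.integrable_cexp_neg_mul_sq_norm_add (V := Euc k) (b := 4 * s ^ 2)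
    (by norm_cast; positivity) 0 0).norm
  refine (this.const_mul ((Real.pi / (4 * s ^ 2)) ^ (-(k / 2 : ℝ)))).congr (ae_of_all _ fun x => ?_)
  simp only [gaussianShape, Complex.norm_exp]
  congr 2
  norm_cast
  simp

/-- Comparison of characteristic functions. The case t = 0 also provides the normalization of the
shape. -/
theorem gaussianShape_map_inner {k : ℕ} {s : ℝ} (hs : 0 < s) (t : Euc k) :
    (volume.withDensity fun x => ENNReal.ofReal (gaussianShape k s x)).map
      (fun x => inner ℝ x t) = gaussianReal 0 (‖t‖ ^ 2 / (8 * s ^ 2)).toNNReal := by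
  have hm : Measurable (gaussianShape k s) := by unfold gaussianShape; fun_prop
  have : IsFiniteMeasure (volume.withDensity fun x => ENNReal.ofReal (gaussianShape k s x)) :=
    isFiniteMeasure_withDensity_ofReal (integrable_gaussianShape hs).2
  apply Measure.ext_of_charFun
  funext u
  rw [charFun_gaussianReal, charFun_apply_real, integral_map (by fun_prop) (by fun_prop),
    integral_withDensity_eq_integral_toReal_smul (by fun_prop) (by simp)]
  have h4 : (0 : ℝ) < 4 * s ^ 2 := by positivity
  have e := GaussianFourier.integral_cexp_neg_mul_sq_norm_add (V := Euc k)
    (b := ((4 * s ^ 2 : ℝ) : ℂ)) (by norm_cast) (u * Complex.I) t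
  have : ∀ x : Euc k, (ENNReal.ofReal (gaussianShape k s x)).toReal •
      Complex.exp (u * (inner ℝ x t : ℝ) * Complex.I) =
      (((Real.pi / (4 * s ^ 2)) ^ (-(k / 2 : ℝ)) : ℝ) : ℂ) *
      Complex.exp (-((4 * s ^ 2 : ℝ) : ℂ) * ‖x‖ ^ 2 + u * Complex.I * (inner ℝ t x : ℝ)) := by
    intro x
    rw [ENNReal.toReal_ofReal (gaussianShape_nonneg _ _ _), Complex.real_smul, gaussianShape,
      Complex.exp_add, real_inner_comm]
    push_cast
    rw [mul_assoc]
    congr 3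
    ring
  simp_rw [this]
  rw [integral_const_mul, e, ← mul_assoc]
  have hc : (((Real.pi / (4 * s ^ 2)) ^ (-(k / 2 : ℝ)) : ℝ) : ℂ) *
      (Real.pi / ((4 * s ^ 2 : ℝ) : ℂ)) ^ ((Module.finrank ℝ (Euc k) : ℂ) / 2) = 1 := by
    have : ((Real.pi / ((4 * s ^ 2 : ℝ) : ℂ)) ^ ((Module.finrank ℝ (Euc k) : ℂ) / 2)) =
        (((Real.pi / (4 * s ^ 2)) ^ ((k / 2 : ℝ)) : ℝ) : ℂ) := by
      rw [Complex.ofReal_cpow (by positivity)]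
      simp
    rw [this, ← Complex.ofReal_mul, ← Real.rpow_add (by positivity)]
    simp
  rw [hc, one_mul, Real.coe_toNNReal _ (by positivity)]
  congr 1
  have : (s : ℂ) ≠ 0 := by exact_mod_cast hs.ne'
  push_cast
  field_simp
  rw [Complex.I_sq]
  ring

/-- Under the Gaussian shape ⟨x,t⟩ has variance ‖t‖²/(8s²), and its tails beyond ‖t‖²/2 have mass
erfc(s‖t‖). The random scale s has the mixing law. -/
theorem IsErfcMixture.radial_mem_tcfM3r {φ : ℝ≥0 → ℝ} (hφ : IsErfcMixture φ) (k : ℕ) :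
    radial k φ ∈ tcfM3r k := by
  obtain ⟨G, hG, hG0, hφ⟩ := hφ
  have hpos := ae_pos_of_Iic hG0
  have hmap : ∀ s, 0 < s → ∀ (t : Euc k) (A : Set ℝ), MeasurableSet A →
      ∫⁻ x in (fun x => inner ℝ x t) ⁻¹' A, ENNReal.ofReal (gaussianShape k s x) =
        gaussianReal 0 (‖t‖ ^ 2 / (8 * s ^ 2)).toNNReal A := by
    intro s hs t A hA
    have hm : Measurable fun x : Euc k => inner ℝ x t := by fun_prop
    rw [← gaussianShape_map_inner hs t, Measure.map_apply hm hA, withDensity_apply _ (hm hA)]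
  have hmem := mem_tcfM3r_of_shape (k := k) (Q := G)
    (f := fun s x => ENNReal.ofReal (gaussianShape k s x)) (by unfold gaussianShape; fun_prop)
    (fun s x y h => by
      refine ENNReal.ofReal_le_ofReal ?_
      unfold gaussianShape
      gcongr ?_ * Real.exp ?_
      have : ‖x‖ ^ 2 ≤ ‖y‖ ^ 2 := by gcongr
      nlinarith [sq_nonneg s])
    (by
      rw [lintegral_congr_ae (g := fun _ => 1)]
      · simp
      · filter_upwards [hpos] with s hs
        have := hmap s hs 0 univ MeasurableSet.univ
        simpa using this)
  convert hmem using 1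
  funext t
  rw [radial, hφ, integral_eq_lintegral_of_nonneg_ae (ae_of_all _ fun s => erfc_nonneg _)
    (continuous_erfc.comp (by fun_prop)).aestronglyMeasurable]
  congr 1
  refine lintegral_congr_ae ?_
  filter_upwards [hpos] with s hs
  rw [hmap s hs t _ (measurableSet_twoTails _)]
  rcases eq_or_ne t 0 with rfl | ht
  · simp [twoTails, erfc_zero, Iic_union_Ioi]
  have ht' : 0 < ‖t‖ := norm_pos_iff.2 ht
  have hv : 0 < ‖t‖ ^ 2 / (8 * s ^ 2) := by positivity
  rw [gaussianReal_twoTails (by simpa using hv) (by positivity), Real.coe_toNNReal _ hv.le]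
  congr 2
  have : √(2 * (‖t‖ ^ 2 / (8 * s ^ 2))) = ‖t‖ / (2 * s) := by
    rw [Real.sqrt_eq_iff_mul_self_eq (by positivity) (by positivity)]
    field_simp
    norm_num
  rw [this]
  simp only [coe_nnnorm]
  field_simp

/-! ### Tail correlation functions that are M3r in every dimension -/

theorem volume_hyperplane {k : ℕ} {u : Euc k} (hu : u ≠ 0) (a : ℝ) :
    volume {x : Euc k | inner ℝ u x = a} = 0 := by
  rcases Set.eq_empty_or_nonempty {x : Euc k | inner ℝ u x = a} with h | ⟨x₀, hx₀⟩
  · rw [h, measure_empty]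
  · rw [mem_ofPred_eq] at hx₀
    let p : Submodule ℝ (Euc k) := LinearMap.ker (innerSL ℝ u).toLinearMap
    have hp : p ≠ ⊤ := by
      intro h
      have : u ∈ p := h ▸ Submodule.mem_top
      simp [p, hu] at this
    have e : {x : Euc k | inner ℝ u x = a} = (fun x => x + -x₀) ⁻¹' (p : Set (Euc k)) := by
      ext x
      simp only [mem_ofPred_eq, mem_preimage, SetLike.mem_coe, p, LinearMap.mem_ker,
        ContinuousLinearMap.coe_coe, innerSL_apply_apply, inner_add_right, inner_neg_right, hx₀]
      constructor <;> intro h <;> linarith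
    rw [e, measure_preimage_add_right]
    exact Measure.addHaar_submodule _ p hp

theorem mul_mem_twoTails {a : ℝ} (ha : 0 < a) (b y : ℝ) :
    a * y ∈ twoTails (a * b) ↔ y ∈ twoTails b := by
  simp only [twoTails, mem_union, mem_Iic, mem_Ioi, ← mul_neg]
  rw [mul_le_mul_iff_right₀ ha, mul_lt_mul_iff_right₀ ha]

theorem stdGaussian_map_inner {k : ℕ} (x : Euc k) :
    (stdGaussian (Euc k)).map (fun g => inner ℝ x g) = gaussianReal 0 (‖x‖ ^ 2).toNNReal := by
  apply Measure.ext_of_charFun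
  funext u
  rw [charFun_gaussianReal, charFun_apply_real, integral_map (by fun_prop) (by fun_prop)]
  have := charFun_stdGaussian (E := Euc k) (u • x)
  rw [charFun_apply] at this
  have e : ∀ g : Euc k, Complex.exp (u * (inner ℝ x g : ℝ) * Complex.I) =
      Complex.exp ((inner ℝ g (u • x) : ℝ) * Complex.I) := by
    intro g
    rw [inner_smul_right, real_inner_comm]
    push_cast
    rfl
  simp_rw [e]
  rw [this, Real.coe_toNNReal _ (by positivity), norm_smul]
  congr 1
  have h2 : ((|u| : ℝ) : ℂ) ^ 2 = (u : ℂ) ^ 2 := by norm_cast; exact sq_abs u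
  push_cast
  rw [Real.norm_eq_abs, mul_pow, h2]
  ring

/-- Take t = r·e in dimension one and divide the condition on ⟨x,t⟩ by r. This supplies the
regularity of φ that the limit argument needs: continuity, φ(0) = 1 and decay to zero. -/
theorem exists_tails_of_radial_mem {φ : ℝ≥0 → ℝ} (h : radial 1 φ ∈ tcfM3r 1) :
    ∃ ρ : Measure ℝ, IsProbabilityMeasure ρ ∧ (∀ a, ρ {a} = 0) ∧
      ∀ r : ℝ≥0, φ r = ρ.real (twoTails (r / 2)) := by
  obtain ⟨m, hm, hac, hχ⟩ := exists_measure_of_mem_tcfM3r h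
  let e : Euc 1 := EuclideanSpace.single 0 1
  have he : ‖e‖ = 1 := by simp [e]
  have he0 : e ≠ 0 := by
    intro h
    rw [h] at he
    simp at he
  have hi : Measurable fun x : Euc 1 => inner ℝ x e := by fun_prop
  refine ⟨m.map (fun x => inner ℝ x e), Measure.isProbabilityMeasure_map hi.aemeasurable,
    fun a => ?_, fun r => ?_⟩
  · rw [Measure.map_apply hi (measurableSet_singleton a)]
    refine hac ?_
    convert volume_hyperplane he0 a using 2
    ext x
    simp [real_inner_comm]
  · have h1 := hχ ((r : ℝ) • e)
    have hn : ‖(r : ℝ) • e‖₊ = r := by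
      ext
      rw [coe_nnnorm, norm_smul, he]
      simp
    have hn' : ‖(r : ℝ) • e‖ = r := by rw [← coe_nnnorm, hn]
    rw [radial, hn, hn'] at h1
    rw [measureReal_def, Measure.map_apply hi (measurableSet_twoTails _),
      ← ENNReal.toReal_ofReal h1.2, h1.1]
    congr 2
    ext x
    simp only [mem_preimage, inner_smul_right]
    rcases eq_or_ne r 0 with rfl | hr
    · simp [twoTails, Iic_union_Ioi]
    · rw [show ((r : ℝ) ^ 2 / 2) = r * (r / 2) by ring]
      exact mul_mem_twoTails (by positivity) _ _

theorem mem_twoTails_iff_of_ne {a y : ℝ} (h : y ≠ -a) : y ∈ twoTails a ↔ a < |y| := by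
  simp only [twoTails, mem_union, mem_Iic, mem_Ioi, lt_abs]
  constructor
  · rintro (h' | h')
    · right
      have := lt_of_le_of_ne h' h
      linarith
    · exact Or.inl h'
  · rintro (h' | h')
    · exact Or.inr h'
    · left; linarith

/-- Without atoms, the boundary points ±r/2 are negligible, so the indicators converge almost
everywhere. -/
theorem continuous_tails {φ : ℝ≥0 → ℝ} {ρ : Measure ℝ} [IsProbabilityMeasure ρ]
    (h0 : ∀ a, ρ {a} = 0) (h : ∀ r : ℝ≥0, φ r = ρ.real (twoTails (r / 2))) : Continuous φ := by
  rw [continuous_iff_continuousAt]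
  intro r
  have hφ : φ = fun r : ℝ≥0 => ∫ y, (twoTails (r / 2)).indicator (fun _ => (1 : ℝ)) y ∂ρ := by
    funext r
    rw [h r, integral_indicator (measurableSet_twoTails _)]
    simp
  have hm : ∀ r : ℝ≥0, Measurable ((twoTails (r / 2)).indicator (fun _ => (1 : ℝ))) := fun r =>
    measurable_const.indicator (measurableSet_twoTails _)
  rw [hφ]
  refine continuousAt_of_dominated (bound := fun _ => 1)
    (Eventually.of_forall fun r => (hm r).aestronglyMeasurable)
    (Eventually.of_forall fun r => ae_of_all _ fun y => ?_) (integrable_const _) ?_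
  · by_cases hy : y ∈ twoTails (r / 2) <;> simp [hy]
  · have hne : ∀ a, ∀ᵐ y ∂ρ, y ≠ a := fun a => by
      rw [ae_iff]; simpa using h0 a
    filter_upwards [hne (r / 2), hne (-(r / 2))] with y h1 h2
    have hy : |y| ≠ r / 2 := by
      intro h
      rcases abs_eq (by positivity) |>.1 h with h | h
      · exact h1 h
      · exact h2 h
    have hev : ∀ᶠ r' : ℝ≥0 in 𝓝 r, (y ∈ twoTails (r' / 2) ↔ y ∈ twoTails (r / 2)) := by
      have hc : Continuous fun r' : ℝ≥0 => ((r' : ℝ) / 2) := by fun_prop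
      rw [mem_twoTails_iff_of_ne h2]
      rcases lt_or_gt_of_ne hy with hlt | hgt
      · filter_upwards [hc.continuousAt.eventually (lt_mem_nhds hlt)] with r' hr'
        rw [mem_twoTails_iff_of_ne (by
          intro h
          rw [h, abs_neg, abs_of_nonneg (by positivity)] at hr'
          exact lt_irrefl _ hr')]
        constructor <;> intro h <;> linarith
      · filter_upwards [hc.continuousAt.eventually (gt_mem_nhds hgt)] with r' hr'
        rw [mem_twoTails_iff_of_ne (by
          intro h
          rw [h, abs_neg, abs_of_nonneg (by positivity)] at hr'
          exact lt_irrefl _ hr')]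
        constructor <;> intro h <;> linarith
    refine continuousAt_const.congr (f := fun _ => (twoTails (r / 2)).indicator (fun _ => (1 : ℝ)) y) ?_
    filter_upwards [hev] with r' hr'
    by_cases h' : y ∈ twoTails (r / 2)
    · rw [indicator_of_mem h', indicator_of_mem (hr'.2 h')]
    · rw [indicator_of_notMem h', indicator_of_notMem (fun h => h' (hr'.1 h))]

theorem tendsto_tails_zero {φ : ℝ≥0 → ℝ} {ρ : Measure ℝ} [IsProbabilityMeasure ρ]
    (h : ∀ r : ℝ≥0, φ r = ρ.real (twoTails (r / 2))) :
    Tendsto (fun n : ℕ => φ n) atTop (𝓝 0) := by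
  have hφ : ∀ n : ℕ, φ n = ∫ y, (twoTails (n / 2)).indicator (fun _ => (1 : ℝ)) y ∂ρ := by
    intro n
    rw [h n, integral_indicator (measurableSet_twoTails _)]
    simp
  simp_rw [hφ]
  rw [show (0 : ℝ) = ∫ _, 0 ∂ρ by simp]
  refine tendsto_integral_of_dominated_convergence (fun _ => 1) (fun n =>
    (measurable_const.indicator (measurableSet_twoTails _)).aestronglyMeasurable)
    (integrable_const _) (fun n => ae_of_all _ fun y => ?_) (ae_of_all _ fun y => ?_)
  · by_cases hy : y ∈ twoTails (n / 2) <;> simp [hy]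
  · refine tendsto_const_nhds.congr' ?_
    have : Tendsto (fun n : ℕ => (n : ℝ) / 2) atTop atTop :=
      tendsto_natCast_atTop_atTop.atTop_div_const (by norm_num)
    filter_upwards [this.eventually_gt_atTop |y|] with n hn
    rw [indicator_of_notMem]
    simp only [twoTails, mem_union, mem_Iic, mem_Ioi, not_or, not_le, not_lt]
    exact ⟨by linarith [neg_abs_le y], by linarith [le_abs_self y]⟩

/-- Both sides are the mass, under γ × m with γ the standard Gaussian law, of the event that ⟨x,g⟩
lies in the two tails beyond c/2. For fixed g, the vector t = (c/‖g‖²)g has norm c/‖g‖ and turns the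
event into the tail formula for φ. For fixed x, the variable ⟨x,g⟩ is centred normal with variance
‖x‖². -/
theorem lintegral_stdGaussian_radial {k : ℕ} (hk : 1 ≤ k) {φ : ℝ≥0 → ℝ} {m : Measure (Euc k)}
    [IsProbabilityMeasure m] (hac : m ≪ volume)
    (hχ : ∀ t : Euc k, ENNReal.ofReal (radial k φ t) =
      m ((fun x => inner ℝ x t) ⁻¹' twoTails (‖t‖ ^ 2 / 2)))
    {c : ℝ≥0} (hc : 0 < c) :
    ∫⁻ g, ENNReal.ofReal (φ (c / ‖g‖₊)) ∂(stdGaussian (Euc k)) =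
      ∫⁻ x, ENNReal.ofReal (erfc (c / (2 * √2 * ‖x‖))) ∂m := by
  have hc' : (0 : ℝ) < c := hc
  have : Nonempty (Fin k) := ⟨⟨0, hk⟩⟩
  have hvol0 : (volume : Measure (Euc k)) {0} = 0 := by
    have : Nontrivial (Euc k) := inferInstance
    simp
  have hm0 : ∀ᵐ x ∂m, x ≠ 0 := by
    rw [ae_iff]
    simpa using hac hvol0
  have hg0 : ∀ᵐ g ∂(stdGaussian (Euc k)), g ≠ 0 := by
    let e : Euc k := EuclideanSpace.single ⟨0, hk⟩ 1
    have he : ‖e‖ = 1 := by simp [e]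
    have h1 := stdGaussian_map_inner e
    have : NullSingletonClass (gaussianReal 0 (‖e‖ ^ 2).toNNReal) :=
      nullSingletonClass_gaussianReal (by rw [he]; simp)
    have h2 : (stdGaussian (Euc k)).map (fun g => inner ℝ e g) {0} = 0 := by
      rw [h1]; exact measure_singleton 0
    rw [Measure.map_apply (by fun_prop) (measurableSet_singleton 0)] at h2
    rw [ae_iff]
    refine measure_mono_null (fun g hg => ?_) h2
    simp only [not_not, mem_ofPred_eq] at hg
    simp [hg]
  let D : Set (Euc k × Euc k) := (fun p => inner ℝ p.2 p.1) ⁻¹' twoTails (c / 2)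
  have hD : MeasurableSet D :=
    (by fun_prop : Measurable fun p : Euc k × Euc k => inner ℝ p.2 p.1) (measurableSet_twoTails _)
  have e1 : ∫⁻ g, ENNReal.ofReal (φ (c / ‖g‖₊)) ∂(stdGaussian (Euc k)) =
      ((stdGaussian (Euc k)).prod m) D := by
    rw [Measure.prod_apply hD]
    refine lintegral_congr_ae ?_
    filter_upwards [hg0] with g hg
    have hg' : 0 < ‖g‖ := norm_pos_iff.2 hg
    have h2 := hχ ((c / ‖g‖ ^ 2 : ℝ) • g)
    have hn : ‖((c / ‖g‖ ^ 2 : ℝ) • g)‖ = c / ‖g‖ := by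
      rw [norm_smul, Real.norm_of_nonneg (by positivity)]
      field_simp
    have hn' : ‖((c / ‖g‖ ^ 2 : ℝ) • g)‖₊ = c / ‖g‖₊ := by
      ext
      rw [coe_nnnorm, hn]
      simp
    rw [radial, hn', hn] at h2
    rw [h2]
    congr 1
    ext x
    simp only [mem_preimage, D, inner_smul_right]
    rw [show ((c : ℝ) / ‖g‖) ^ 2 / 2 = c / ‖g‖ ^ 2 * (c / 2) by field_simp]
    exact mul_mem_twoTails (by positivity) _ _
  have e2 : ∫⁻ x, ENNReal.ofReal (erfc (c / (2 * √2 * ‖x‖))) ∂m =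
      ((stdGaussian (Euc k)).prod m) D := by
    rw [Measure.prod_apply_symm hD]
    refine lintegral_congr_ae ?_
    filter_upwards [hm0] with x hx
    have hx' : 0 < ‖x‖ := norm_pos_iff.2 hx
    have : (fun g => (g, x)) ⁻¹' D = (fun g => inner ℝ x g) ⁻¹' twoTails (c / 2) := rfl
    rw [this, ← Measure.map_apply (by fun_prop) (measurableSet_twoTails _), stdGaussian_map_inner,
      gaussianReal_twoTails (by simpa using hx) (by positivity),
      Real.coe_toNNReal _ (by positivity), Real.sqrt_mul (by norm_num), Real.sqrt_sq hx'.le]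
    congr 2
    field_simp
  rw [e1, e2]

/-! ### Letting the dimension grow: concentration of Gaussian norms and compactness -/

/-- The strong law for the squares of one i.i.d. sequence, which realizes the Gaussian vectors of
all dimensions on a common space. -/
theorem ae_tendsto_norm_gaussian :
    ∀ᵐ ξ : ℕ → ℝ ∂(Measure.infinitePi fun _ => gaussianReal 0 1),
      Tendsto (fun k : ℕ => √(∑ i ∈ Finset.range k, ξ i ^ 2) / √k) atTop (𝓝 1) := by
  set P : Measure (ℕ → ℝ) := Measure.infinitePi fun _ => gaussianReal 0 1
  have hmap : ∀ i, MeasurePreserving (fun ξ : ℕ → ℝ => ξ i) P (gaussianReal 0 1) := fun i =>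
    measurePreserving_eval_infinitePi (fun _ : ℕ => gaussianReal 0 1) i
  have hL2 : MemLp id 2 (gaussianReal 0 1) := memLp_id_gaussianReal 2
  have h2 : Integrable (fun x : ℝ => x ^ 2) (gaussianReal 0 1) := hL2.integrable_sq
  have hint : ∫ x, x ^ 2 ∂(gaussianReal 0 1) = 1 := by
    have h := variance_id_gaussianReal (μ := 0) (v := 1)
    rw [variance_eq_sub hL2] at h
    simpa [integral_id_gaussianReal] using h
  have h := strong_law_ae_real (μ := P) (fun i ξ => ξ i ^ 2)
    (((hmap 0).integrable_comp h2.aestronglyMeasurable).2 h2) ?_ ?_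
  · filter_upwards [h] with ξ hξ
    have e : ∫ ξ, ξ 0 ^ 2 ∂P = 1 := by
      rw [← hint, ← (hmap 0).map_eq,
        integral_map (hmap 0).measurable.aemeasurable (by fun_prop)]
    rw [e] at hξ
    have := (Real.continuous_sqrt.tendsto _).comp hξ
    rw [Real.sqrt_one] at this
    refine this.congr fun k => ?_
    simp only [Function.comp_apply]
    rw [Real.sqrt_div' _ (Nat.cast_nonneg _)]
  · intro i j hij
    have hi : iIndepFun (fun (i : ℕ) (ξ : ℕ → ℝ) => ξ i ^ 2) P :=
      iIndepFun_infinitePi (P := fun _ : ℕ => gaussianReal 0 1) (X := fun _ x => x ^ 2)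
        (fun _ => by fun_prop)
    exact hi.indepFun hij
  · intro i
    have h1 : IdentDistrib (fun ξ : ℕ → ℝ => ξ i) (fun ξ : ℕ → ℝ => ξ 0) P P :=
      ⟨(hmap i).measurable.aemeasurable, (hmap 0).measurable.aemeasurable,
        (hmap i).map_eq.trans (hmap 0).map_eq.symm⟩
    exact h1.comp (u := fun x => x ^ 2) (by fun_prop)

theorem map_gaussian_eq_stdGaussian (k : ℕ) :
    (Measure.infinitePi fun _ : ℕ => gaussianReal 0 1).map
      (fun ξ => (WithLp.toLp 2 fun i : Fin k => ξ i : Euc k)) = stdGaussian (Euc k) := by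
  rw [← map_pi_eq_stdGaussian, ← Measure.infinitePi_eq_pi,
    ← Measure.map_infinitePi_infinitePi_of_inj (P := fun _ : ℕ => gaussianReal 0 1)
      (f := fun i : Fin k => (i : ℕ)) Fin.val_injective, Measure.map_map (by fun_prop) (by fun_prop)]
  rfl

theorem tendsto_integral_stdGaussian {φ : ℝ≥0 → ℝ} (hc : Continuous φ) (hb : ∀ r, |φ r| ≤ 1)
    (r : ℝ≥0) :
    Tendsto (fun k : ℕ => ∫ g, φ (r * NNReal.sqrt k / ‖g‖₊) ∂(stdGaussian (Euc k))) atTop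
      (𝓝 (φ r)) := by
  set P : Measure (ℕ → ℝ) := Measure.infinitePi fun _ => gaussianReal 0 1
  have e : ∀ k : ℕ, ∫ g, φ (r * NNReal.sqrt k / ‖g‖₊) ∂(stdGaussian (Euc k)) =
      ∫ ξ, φ (r * NNReal.sqrt k / ‖(WithLp.toLp 2 fun i : Fin k => ξ i : Euc k)‖₊) ∂P := by
    intro k
    have hm : Measurable fun g : Euc k => φ (r * NNReal.sqrt k / ‖g‖₊) := by fun_prop
    have ht : Measurable fun ξ : ℕ → ℝ => (WithLp.toLp 2 fun i : Fin k => ξ i : Euc k) := by fun_prop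
    rw [← map_gaussian_eq_stdGaussian k, integral_map ht.aemeasurable hm.aestronglyMeasurable]
  simp_rw [e]
  rw [show φ r = ∫ _, φ r ∂P by simp]
  refine tendsto_integral_of_dominated_convergence (fun _ => 1) (fun k =>
    (by fun_prop : Measurable fun ξ : ℕ → ℝ => φ (r * NNReal.sqrt k /
      ‖(WithLp.toLp 2 fun i : Fin k => ξ i : Euc k)‖₊)).aestronglyMeasurable)
    (integrable_const _) (fun n => ae_of_all _ fun y => by simpa using hb _) ?_
  filter_upwards [ae_tendsto_norm_gaussian] with ξ hξ
  refine (hc.tendsto r).comp ?_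
  rw [← NNReal.tendsto_coe]
  have h1 := (hξ.inv₀ one_ne_zero).const_mul (r : ℝ)
  rw [inv_one, mul_one] at h1
  refine h1.congr fun k => ?_
  rw [inv_div]
  push_cast
  rw [EuclideanSpace.norm_eq]
  simp only [Real.norm_eq_abs, sq_abs]
  rw [← Finset.sum_range (fun i => ξ i ^ 2), mul_div_assoc]

/-- The complementary error function on `[0, ∞]`, with value `0` at `∞`. -/
noncomputable def erfcTop (s : ℝ≥0∞) : ℝ := if s = ∞ then 0 else erfc s.toReal

theorem erfcTop_nonneg (s : ℝ≥0∞) : 0 ≤ erfcTop s := by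
  unfold erfcTop; split_ifs; exacts [le_rfl, erfc_nonneg _]

theorem erfcTop_le_one (s : ℝ≥0∞) : erfcTop s ≤ 1 := by
  unfold erfcTop; split_ifs; exacts [zero_le_one, erfc_le_one ENNReal.toReal_nonneg]

theorem continuous_erfcTop : Continuous erfcTop := by
  rw [continuous_iff_continuousAt]
  intro s
  by_cases hs : s = ∞
  · subst hs
    rw [ContinuousAt, show erfcTop ∞ = 0 by simp [erfcTop]]
    rw [Metric.tendsto_nhds]
    intro ε hε
    obtain ⟨N, hN⟩ := (tendsto_erfc_atTop.eventually (gt_mem_nhds hε)).exists_forall_of_atTop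
    filter_upwards [lt_mem_nhds (ENNReal.ofReal_lt_top (r := N))] with s hs
    rw [Real.dist_eq, sub_zero, abs_of_nonneg (erfcTop_nonneg _)]
    by_cases h : s = ∞
    · simpa [erfcTop, h] using hε
    · rw [erfcTop, if_neg h]
      exact hN _ ((ENNReal.ofReal_le_iff_le_toReal h).1 hs.le)
  · have h1 : ContinuousAt (fun s : ℝ≥0∞ => erfc s.toReal) s :=
      continuous_erfc.continuousAt.comp (ENNReal.tendsto_toReal hs)
    refine h1.congr ?_
    filter_upwards [isOpen_ne.mem_nhds hs] with s' hs'
    rw [erfcTop, if_neg hs']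

theorem tendsto_inv_succ_nnreal :
    Tendsto (fun n : ℕ => ((n + 1 : ℝ≥0)⁻¹ : ℝ≥0)) atTop (𝓝 0) := by
  rw [← NNReal.tendsto_coe]
  simpa [one_div] using tendsto_one_div_add_atTop_nhds_zero_nat (𝕜 := ℝ)

/-- A Helly-type selection: the mixing laws have a limit on [0,∞], and the behaviour of φ at
infinity and at zero forbids mass escaping to the end points. -/
theorem isErfcMixture_of_tendsto {φ : ℝ≥0 → ℝ} (hc : Continuous φ) (h0 : φ 0 = 1)
    (hinf : Tendsto (fun n : ℕ => φ n) atTop (𝓝 0)) (σ : ℕ → ProbabilityMeasure ℝ≥0∞)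
    (hσ : ∀ r : ℝ≥0, 0 < r →
      Tendsto (fun k => ∫ s, erfcTop (r * s) ∂(σ k : Measure ℝ≥0∞)) atTop (𝓝 (φ r))) :
    IsErfcMixture φ := by
  -- The probability measures on the compact space [0,∞] are compact for weak convergence, so `σ`
  -- converges along an ultrafilter and no subsequence is needed.
  let G : ProbabilityMeasure ℝ≥0∞ := ((hyperfilter ℕ).map σ).lim
  have hG : Tendsto σ (hyperfilter ℕ) (𝓝 G) := ((hyperfilter ℕ).map σ).le_nhds_lim
  rw [ProbabilityMeasure.tendsto_iff_forall_integral_tendsto] at hG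
  have hcont : ∀ r : ℝ≥0, Continuous fun s : ℝ≥0∞ => erfcTop (r * s) := fun r =>
    continuous_erfcTop.comp (ENNReal.continuous_const_mul ENNReal.coe_ne_top)
  have hφ : ∀ r : ℝ≥0, 0 < r → φ r = ∫ s, erfcTop (r * s) ∂(G : Measure ℝ≥0∞) := by
    intro r hr
    have h1 := hG (BoundedContinuousFunction.mkOfCompact ⟨_, hcont r⟩)
    exact tendsto_nhds_unique ((hσ r hr).mono_left Nat.hyperfilter_le_atTop) h1
  have hbd : ∀ (r : ℝ≥0) (s : ℝ≥0∞), ‖erfcTop (r * s)‖ ≤ 1 := fun r s => by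
    rw [Real.norm_of_nonneg (erfcTop_nonneg _)]; exact erfcTop_le_one _
  -- As n → ∞, erfc(ns) tends to the indicator of s = 0, while φ(n) → 0.
  have hG0 : (G : Measure ℝ≥0∞) {0} = 0 := by
    have h1 : Tendsto (fun n : ℕ => ∫ s, erfcTop ((n : ℝ≥0) * s) ∂(G : Measure ℝ≥0∞)) atTop
        (𝓝 (∫ s, ({0} : Set ℝ≥0∞).indicator (fun _ => (1 : ℝ)) s ∂(G : Measure ℝ≥0∞))) := by
      refine tendsto_integral_of_dominated_convergence (fun _ => 1) (fun n =>
        (hcont n).aestronglyMeasurable) (integrable_const _) (fun n => ae_of_all _ (hbd n))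
        (ae_of_all _ fun s => ?_)
      rcases eq_or_ne s 0 with rfl | hs
      · simp [erfcTop, erfc_zero]
      · rw [indicator_of_notMem (by simpa using hs), show (0 : ℝ) = erfcTop ∞ by simp [erfcTop]]
        refine (continuous_erfcTop.tendsto _).comp ?_
        have h3 : Tendsto (fun n : ℕ => ((n : ℝ≥0) : ℝ≥0∞)) atTop (𝓝 ∞) := by
          simpa using ENNReal.tendsto_nat_nhds_top
        have := ENNReal.Tendsto.mul_const h3 (b := s) (Or.inl ENNReal.top_ne_zero)
        rwa [ENNReal.top_mul hs] at this
    rw [integral_indicator (measurableSet_singleton _)] at h1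
    have h2 : Tendsto (fun n : ℕ => ∫ s, erfcTop ((n : ℝ≥0) * s) ∂(G : Measure ℝ≥0∞)) atTop
        (𝓝 0) := by
      refine hinf.congr' ?_
      filter_upwards [eventually_gt_atTop 0] with n hn
      exact hφ n (by exact_mod_cast hn)
    have h3 := tendsto_nhds_unique h1 h2
    simpa [measureReal_def, ENNReal.toReal_eq_zero_iff] using h3
  -- As r → 0, erfc(rs) tends to the indicator of s ≠ ∞, while φ(r) → φ(0) = 1.
  have hGtop : (G : Measure ℝ≥0∞) {∞} = 0 := by
    have h1 : Tendsto (fun n : ℕ => ∫ s, erfcTop (((n + 1 : ℝ≥0)⁻¹ : ℝ≥0) * s)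
        ∂(G : Measure ℝ≥0∞)) atTop
        (𝓝 (∫ s, ({∞}ᶜ : Set ℝ≥0∞).indicator (fun _ => (1 : ℝ)) s ∂(G : Measure ℝ≥0∞))) := by
      refine tendsto_integral_of_dominated_convergence (fun _ => 1) (fun n =>
        (hcont _).aestronglyMeasurable) (integrable_const _) (fun n => ae_of_all _ (hbd _))
        (ae_of_all _ fun s => ?_)
      rcases eq_or_ne s ∞ with rfl | hs
      · rw [indicator_of_notMem (by simp)]
        refine tendsto_const_nhds.congr fun n => ?_
        rw [ENNReal.mul_top (by simp), erfcTop, if_pos rfl]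
      · rw [indicator_of_mem (by simpa using hs), show (1 : ℝ) = erfcTop (0 * s) by
          simp [erfcTop, erfc_zero]]
        refine (continuous_erfcTop.tendsto _).comp ?_
        refine ENNReal.Tendsto.mul_const ?_ (Or.inr hs)
        rw [← ENNReal.coe_zero, ENNReal.tendsto_coe]
        exact tendsto_inv_succ_nnreal
    have h2 : Tendsto (fun n : ℕ => ∫ s, erfcTop (((n + 1 : ℝ≥0)⁻¹ : ℝ≥0) * s)
        ∂(G : Measure ℝ≥0∞)) atTop (𝓝 1) := by
      rw [← h0]
      refine ((hc.tendsto 0).comp tendsto_inv_succ_nnreal).congr fun n => ?_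
      exact hφ _ (by positivity)
    have h3 := tendsto_nhds_unique h1 h2
    rw [integral_indicator (measurableSet_singleton _).compl] at h3
    simp only [integral_const, MeasurableSet.univ, measureReal_restrict_apply, univ_inter,
      smul_eq_mul, mul_one] at h3
    rw [probReal_compl_eq_one_sub (measurableSet_singleton _)] at h3
    have h4 : (G : Measure ℝ≥0∞).real {∞} = 0 := by linarith
    simpa [measureReal_def, ENNReal.toReal_eq_zero_iff] using h4
  have hae : ∀ᵐ s ∂(G : Measure ℝ≥0∞), s ≠ 0 ∧ s ≠ ∞ := by
    have h1 : ∀ᵐ s ∂(G : Measure ℝ≥0∞), s ≠ 0 := by rw [ae_iff]; simpa using hG0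
    have h2 : ∀ᵐ s ∂(G : Measure ℝ≥0∞), s ≠ ∞ := by rw [ae_iff]; simpa using hGtop
    filter_upwards [h1, h2] with s a b using ⟨a, b⟩
  have hm : Measurable ENNReal.toReal := by fun_prop
  have hp : IsProbabilityMeasure ((G : Measure ℝ≥0∞).map ENNReal.toReal) :=
    Measure.isProbabilityMeasure_map (by fun_prop)
  refine ⟨(G : Measure ℝ≥0∞).map ENNReal.toReal, hp, ?_, fun r => ?_⟩
  · rw [Measure.map_apply hm measurableSet_Iic]
    have := ae_iff.1 hae
    refine measure_mono_null (fun s hs => ?_) this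
    simp only [mem_preimage, mem_Iic] at hs
    simp only [mem_ofPred_eq]
    rintro ⟨h1, h2⟩
    exact absurd (ENNReal.toReal_pos h1 h2) (not_lt.2 hs)
  · rcases eq_or_ne r 0 with rfl | hr
    · simp [erfc_zero, h0]
    · have hcr : Continuous fun s : ℝ => erfc (s * r) := continuous_erfc.comp (by fun_prop)
      rw [hφ r (pos_iff_ne_zero.2 hr), integral_map hm.aemeasurable hcr.aestronglyMeasurable]
      refine integral_congr_ae ?_
      filter_upwards [hae] with s hs
      rw [erfcTop, if_neg (ENNReal.mul_ne_top ENNReal.coe_ne_top hs.2), ENNReal.toReal_mul,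
        mul_comm]
      rfl

/-- Schoenberg's argument: in high dimension r√k/‖g‖ is nearly r, so φ(r) is nearly its Gaussian
average, which is exactly an erfc mixture. -/
theorem isErfcMixture_of_mem_tcfM3rInfty {φ : ℝ≥0 → ℝ} (hφ : φ ∈ tcfM3rInfty) :
    IsErfcMixture φ := by
  have hφ : ∀ k : ℕ, 1 ≤ k → radial k φ ∈ tcfM3r k := by
    intro k hk
    simp only [tcfM3rInfty, mem_iInter] at hφ
    exact hφ k hk
  obtain ⟨ρ, hρ, hρ0, hρφ⟩ := exists_tails_of_radial_mem (hφ 1 le_rfl)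
  have hc := continuous_tails hρ0 hρφ
  have h01 : ∀ r, 0 ≤ φ r ∧ φ r ≤ 1 := fun r => by
    rw [hρφ]; exact ⟨measureReal_nonneg, measureReal_le_one⟩
  have h0 : φ 0 = 1 := by
    rw [hρφ]
    simp [twoTails, Iic_union_Ioi]
  have hb : ∀ r, |φ r| ≤ 1 := fun r => by rw [abs_of_nonneg (h01 r).1]; exact (h01 r).2
  have hm : ∀ k : ℕ, ∃ m : Measure (Euc (k + 1)), IsProbabilityMeasure m ∧ m ≪ volume ∧
      ∀ t, ENNReal.ofReal (radial (k + 1) φ t) =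
        m ((fun x => inner ℝ x t) ⁻¹' twoTails (‖t‖ ^ 2 / 2)) := by
    intro k
    obtain ⟨m, h1, h2, h3⟩ := exists_measure_of_mem_tcfM3r (hφ (k + 1) (by omega))
    exact ⟨m, h1, h2, fun t => (h3 t).1⟩
  choose m hprob hac hχ using hm
  -- The scale for which c = r√(k+1) turns the argument c/(2√2‖x‖) of erfc into r times the scale.
  let S : ∀ k : ℕ, Euc (k + 1) → ℝ≥0∞ := fun k x =>
    ENNReal.ofReal (√((k + 1 : ℕ) : ℝ) / (2 * √2 * ‖x‖))
  have hS : ∀ k, Measurable (S k) := fun k => by fun_prop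
  refine isErfcMixture_of_tendsto hc h0 (tendsto_tails_zero hρφ)
    (fun k => ⟨(m k).map (S k), Measure.isProbabilityMeasure_map (hS k).aemeasurable⟩) fun r hr => ?_
  have hlim := (tendsto_integral_stdGaussian hc hb r).comp (tendsto_add_atTop_nat 1)
  refine hlim.congr fun k => ?_
  have hpos : 0 < r * NNReal.sqrt ((k + 1 : ℕ) : ℝ≥0) := by positivity
  have e := lintegral_stdGaussian_radial (by omega) (hac k) (hχ k) hpos
  simp only [Function.comp_apply, ProbabilityMeasure.coe_mk]
  have hcr : Continuous fun s : ℝ≥0∞ => erfcTop (r * s) :=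
    continuous_erfcTop.comp (ENNReal.continuous_const_mul ENNReal.coe_ne_top)
  have hmr : Measurable fun x => erfcTop (r * S k x) := hcr.measurable.comp (hS k)
  rw [integral_map (hS k).aemeasurable hcr.aestronglyMeasurable,
    integral_eq_lintegral_of_nonneg_ae (ae_of_all _ fun g => (h01 _).1)
    (by fun_prop : Measurable fun g : Euc (k + 1) =>
      φ (r * NNReal.sqrt ((k + 1 : ℕ) : ℝ≥0) / ‖g‖₊)).aestronglyMeasurable,
    integral_eq_lintegral_of_nonneg_ae (ae_of_all _ fun g => erfcTop_nonneg _) hmr.aestronglyMeasurable]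
  congr 1
  rw [e]
  refine lintegral_congr fun x => ?_
  congr 1
  rw [erfcTop, if_neg (ENNReal.mul_ne_top ENNReal.coe_ne_top ENNReal.ofReal_ne_top),
    ENNReal.toReal_mul, ENNReal.toReal_ofReal (by positivity)]
  congr 1
  push_cast
  rw [mul_div_assoc]
  rfl

/-! ### Isonormal Gaussian processes -/

/-- The bound |e^{if} − e^{ig}| ≤ |f − g| and the comparison of L¹ with L² norms give the Lipschitz
constant one. It lets Gaussianity pass to L² limits. -/
theorem continuous_integral_cexp_Lp {S : Type*} [MeasurableSpace S] (Q : Measure S)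
    [IsProbabilityMeasure Q] :
    Continuous fun f : Lp ℝ 2 Q => ∫ x, Complex.exp (f x * Complex.I) ∂Q := by
  have hint : ∀ f : Lp ℝ 2 Q, Integrable (fun x => Complex.exp (f x * Complex.I)) Q := fun f => by
    have hf := (Lp.stronglyMeasurable f).measurable
    refine Integrable.of_bound (C := 1)
      (by fun_prop : Measurable fun x => Complex.exp (f x * Complex.I)).aestronglyMeasurable
      (ae_of_all _ fun x => ?_)
    rw [Complex.norm_exp_ofReal_mul_I]
  refine LipschitzWith.continuous (K := 1) (LipschitzWith.of_dist_le_mul fun f g => ?_)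
  rw [dist_eq_norm, ← integral_sub (hint f) (hint g), NNReal.coe_one, one_mul, dist_eq_norm]
  have hfg : MemLp (f - g : Lp ℝ 2 Q) 2 Q := Lp.memLp _
  have h1 : Integrable (fun x => (f - g : Lp ℝ 2 Q) x) Q := hfg.integrable (by norm_num)
  calc ‖∫ x, (Complex.exp (f x * Complex.I) - Complex.exp (g x * Complex.I)) ∂Q‖
      ≤ ∫ x, ‖(f - g : Lp ℝ 2 Q) x‖ ∂Q := by
        refine norm_integral_le_of_norm_le h1.norm ?_
        filter_upwards [Lp.coeFn_sub f g] with x hx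
        rw [hx, Pi.sub_apply, ← dist_eq_norm]
        have := Real.norm_exp_I_mul_ofReal_sub_one_le (x := f x - g x)
        calc dist (Complex.exp (f x * Complex.I)) (Complex.exp (g x * Complex.I))
            = ‖Complex.exp (g x * Complex.I) *
                (Complex.exp (Complex.I * ((f x - g x : ℝ) : ℂ)) - 1)‖ := by
              rw [dist_eq_norm, mul_sub, ← Complex.exp_add, mul_one]
              congr 3
              push_cast; ring
          _ ≤ ‖f x - g x‖ := by
              rw [norm_mul, Complex.norm_exp_ofReal_mul_I, one_mul]; exact this
    _ = (eLpNorm (f - g : Lp ℝ 2 Q) 1 Q).toReal := by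
        rw [integral_norm_eq_lintegral_enorm h1.aestronglyMeasurable, eLpNorm_one_eq_lintegral_enorm]
    _ ≤ (eLpNorm (f - g : Lp ℝ 2 Q) 2 Q).toReal := by
        refine ENNReal.toReal_mono hfg.eLpNorm_ne_top ?_
        exact eLpNorm_le_eLpNorm_of_exponent_le (by norm_num) h1.aestronglyMeasurable
    _ = ‖f - g‖ := (Lp.norm_def _).symm

theorem map_eq_gaussianReal_of_integral_cexp {S : Type*} [MeasurableSpace S] {Q : Measure S}
    [IsProbabilityMeasure Q] {X : S → ℝ} (hX : AEMeasurable X Q) {v : ℝ≥0}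
    (h : ∀ t : ℝ, ∫ x, Complex.exp ((t * X x : ℝ) * Complex.I) ∂Q
      = Complex.exp (-(t ^ 2 * v / 2 : ℝ))) :
    Q.map X = gaussianReal 0 v := by
  have := Measure.isProbabilityMeasure_map (μ := Q) hX
  refine Measure.ext_of_charFun (funext fun t => ?_)
  rw [charFun_gaussianReal, charFun_apply_real, integral_map hX (by fun_prop)]
  convert h t using 2
  · push_cast; ring_nf
  · push_cast; ring_nf

/-- Every real Hilbert space embeds isometrically into a space of centred Gaussian random
variables. -/
theorem exists_isonormal (H : Type) [NormedAddCommGroup H] [InnerProductSpace ℝ H]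
    [CompleteSpace H] :
    ∃ (S : Type) (_ : MeasurableSpace S) (Q : Measure S) (J : H →ₗᵢ[ℝ] Lp ℝ 2 Q),
      IsProbabilityMeasure Q ∧ ∀ h, Q.map (J h) = gaussianReal 0 (‖h‖₊ ^ 2) := by
  classical
  obtain ⟨w, b, -⟩ := exists_hilbertBasis ℝ H
  let Q : Measure (w → ℝ) := Measure.infinitePi fun _ => gaussianReal 0 1
  have hmp : ∀ i, MeasurePreserving (fun s : w → ℝ => s i) Q (gaussianReal 0 1) := fun i =>
    measurePreserving_eval_infinitePi _ i
  have hL : ∀ i, MemLp (fun s : w → ℝ => s i) 2 Q := fun i =>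
    (memLp_id_gaussianReal' 2 (by simp)).comp_measurePreserving (hmp i)
  have hind : iIndepFun (fun i (s : w → ℝ) => s i) Q :=
    iIndepFun_infinitePi (X := fun _ x => x) (by fun_prop)
  have hcomp : ∀ (i : w) (g : ℝ → ℂ), Continuous g →
      ∫ s, g (s i) ∂Q = ∫ x, g x ∂(gaussianReal 0 1) := fun i g hg => by
    rw [← (hmp i).map_eq, integral_map (hmp i).measurable.aemeasurable hg.aestronglyMeasurable]
  have hcompr : ∀ (i : w) (g : ℝ → ℝ), Continuous g →
      ∫ s, g (s i) ∂Q = ∫ x, g x ∂(gaussianReal 0 1) := fun i g hg => by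
    rw [← (hmp i).map_eq, integral_map (hmp i).measurable.aemeasurable hg.aestronglyMeasurable]
  have hmean : ∀ i, ∫ s, s i ∂Q = 0 := fun i => by
    rw [hcompr i (fun x => x) continuous_id, integral_id_gaussianReal]
  have hsq : ∀ i, ∫ s, s i * s i ∂Q = 1 := fun i => by
    have h3 : Var[id; gaussianReal 0 1] = ∫ x, x ^ 2 ∂(gaussianReal 0 1) :=
      variance_of_integral_eq_zero (by fun_prop) integral_id_gaussianReal
    rw [variance_id_gaussianReal] at h3
    rw [hcompr i (fun x => x * x) (by fun_prop)]
    simp only [← sq]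
    rw [← h3]; rfl
  let ξ : w → Lp ℝ 2 Q := fun i => (hL i).toLp _
  have hξ : ∀ i, ξ i =ᵐ[Q] fun s => s i := fun i => (hL i).coeFn_toLp
  have horth : Orthonormal ℝ ξ := by
    rw [orthonormal_iff_ite]
    intro i j
    have : inner ℝ (ξ i) (ξ j) = ∫ s, s i * s j ∂Q := by
      rw [L2.inner_def]
      refine integral_congr_ae ?_
      filter_upwards [hξ i, hξ j] with s h1 h2
      rw [h1, h2]; simp [mul_comm]
    rw [this]
    split_ifs with hij
    · rw [hij]; exact hsq j
    · have := (hind.indepFun hij).integral_fun_mul_eq_mul_integral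
        (hL i).aestronglyMeasurable (hL j).aestronglyMeasurable
      rw [this, hmean, zero_mul]
  -- The coordinates of a product of standard normals over a Hilbert basis are orthonormal in L².
  -- Expansions in the basis become L² sums of independent normals, whose characteristic functions
  -- are computed on finite partial sums.
  let J₀ := horth.orthogonalFamily.linearIsometry
  have hsum : ∀ (s : Finset w) (c : w → ℝ), ∫ x, Complex.exp ((∑ i ∈ s, c i • ξ i : Lp ℝ 2 Q) x *
      Complex.I) ∂Q = Complex.exp (-(‖∑ i ∈ s, c i • ξ i‖ ^ 2 / 2 : ℝ)) := by
    intro s c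
    have hn : ‖∑ i ∈ s, c i • ξ i‖ ^ 2 = ∑ i ∈ s, c i ^ 2 := by
      rw [← real_inner_self_eq_norm_sq, horth.inner_sum]
      simp [sq]
    have hae : (∑ i ∈ s, c i • ξ i : Lp ℝ 2 Q) =ᵐ[Q] fun x => ∑ i ∈ s, c i * x i := by
      refine (Lp.coeFn_finsetSum s fun i => c i • ξ i).trans ?_
      have : ∀ᵐ x ∂Q, ∀ i ∈ s, (c i • ξ i : Lp ℝ 2 Q) x = c i * x i := by
        rw [Filter.eventually_all_finset]
        intro i _
        filter_upwards [Lp.coeFn_smul (c i) (ξ i), hξ i] with x h1 h2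
        rw [h1, Pi.smul_apply, h2, smul_eq_mul]
      filter_upwards [this] with x hx
      rw [Finset.sum_apply]
      exact Finset.sum_congr rfl hx
    rw [hn, integral_congr_ae (g := fun x => ∏ i : s, Complex.exp (c i * x i * Complex.I))]
    · have hi : iIndepFun (fun (i : s) (x : w → ℝ) => x i) Q :=
        hind.precomp Subtype.val_injective
      have := iIndepFun.integral_fun_prod_comp (X := fun (i : s) (x : w → ℝ) => x i) (μ := Q) hi
        (f := fun (i : s) x => Complex.exp (c i * x * Complex.I)) (mX := fun i => (hmp i).measurable.aemeasurable)
        (fun i => Continuous.aestronglyMeasurable (by fun_prop))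
      rw [this]
      have h1 : ∀ i : w, ∫ x, Complex.exp (c i * (x i : ℝ) * Complex.I) ∂Q
          = Complex.exp (-(c i ^ 2 / 2 : ℝ)) := fun i => by
        rw [hcomp i (fun x => Complex.exp (c i * x * Complex.I)) (by fun_prop), ← charFun_apply_real, charFun_gaussianReal]
        congr 1
        push_cast; ring
      have h3 : ∏ i : s, Complex.exp (-(c i ^ 2 / 2 : ℝ)) = Complex.exp (-((∑ i ∈ s, c i ^ 2) / 2 : ℝ)) := by
        rw [← Complex.exp_sum, Finset.sum_coe_sort s fun i => (-((c i ^ 2 / 2 : ℝ) : ℂ))]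
        congr 1
        push_cast
        rw [Finset.sum_neg_distrib, Finset.sum_div]
      rw [← h3]
      exact Finset.prod_congr rfl fun i _ => h1 i
    · filter_upwards [hae] with x hx
      rw [hx, ← Complex.exp_sum, Finset.sum_coe_sort s fun i => (c i * x i * Complex.I : ℂ),
        ← Finset.sum_mul]
      push_cast
      rfl
  have hJ₀ : ∀ f, ∫ x, Complex.exp (J₀ f x * Complex.I) ∂Q = Complex.exp (-(‖J₀ f‖ ^ 2 / 2 : ℝ)) := by
    intro f
    have ht : Tendsto (fun s : Finset w => ∑ i ∈ s, f i • ξ i) atTop (𝓝 (J₀ f)) :=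
      horth.orthogonalFamily.hasSum_linearIsometry f
    refine tendsto_nhds_unique (((continuous_integral_cexp_Lp Q).tendsto _).comp ht) ?_
    have hc : Continuous fun g : Lp ℝ 2 Q => Complex.exp (-(‖g‖ ^ 2 / 2 : ℝ)) := by fun_prop
    exact ((hc.tendsto _).comp ht).congr fun s => (hsum s _).symm
  refine ⟨w → ℝ, inferInstance, Q, J₀.comp b.repr.toLinearIsometry, inferInstance, fun h => ?_⟩
  refine map_eq_gaussianReal_of_integral_cexp (Lp.stronglyMeasurable _).measurable.aemeasurable
    fun t => ?_
  have h1 := hJ₀ (b.repr (t • h))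
  rw [J₀.norm_map, b.repr.norm_map, norm_smul, mul_pow] at h1
  simp only [Real.norm_eq_abs, sq_abs] at h1
  push_cast at h1 ⊢
  rw [← h1]
  refine integral_congr_ae ?_
  have h2 : J₀ (b.repr (t • h)) = t • J₀ (b.repr h) := by simp
  rw [h2]
  filter_upwards [Lp.coeFn_smul t (J₀ (b.repr h))] with x hx
  rw [hx]
  simp

section isonormal

variable {H S : Type} [NormedAddCommGroup H] [InnerProductSpace ℝ H] [MeasurableSpace S]
  {Q : Measure S} {J : H →ₗᵢ[ℝ] Lp ℝ 2 Q}

theorem integral_isonormal (hJ : ∀ h, Q.map (J h) = gaussianReal 0 (‖h‖₊ ^ 2)) (h : H) :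
    ∫ s, J h s ∂Q = 0 := by
  have := integral_map (Lp.stronglyMeasurable (J h)).measurable.aemeasurable (μ := Q)
    (f := fun x : ℝ => x) (by fun_prop)
  rw [hJ, integral_id_gaussianReal] at this
  exact this.symm

theorem integral_cexp_isonormal (hJ : ∀ h, Q.map (J h) = gaussianReal 0 (‖h‖₊ ^ 2)) (h : H) :
    ∫ s, Complex.exp (J h s * Complex.I) ∂Q = Complex.exp (-(‖h‖ ^ 2 / 2 : ℝ)) := by
  have := integral_map (Lp.stronglyMeasurable (J h)).measurable.aemeasurable (μ := Q)
    (f := fun x : ℝ => Complex.exp (x * Complex.I)) (by fun_prop)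
  rw [← this, hJ]
  have h2 := charFun_gaussianReal (μ := 0) (v := ‖h‖₊ ^ 2) 1
  rw [charFun_apply_real] at h2
  simp only [Complex.ofReal_one, one_mul] at h2
  rw [h2]
  congr 1
  push_cast
  simp

theorem variance_isonormal (hJ : ∀ h, Q.map (J h) = gaussianReal 0 (‖h‖₊ ^ 2)) (h : H) :
    variance (J h) Q = ‖h‖ ^ 2 := by
  have := variance_map (X := fun x : ℝ => x) (μ := Q) (Y := J h) (by fun_prop)
    (Lp.stronglyMeasurable (J h)).measurable.aemeasurable
  rw [hJ, variance_fun_id_gaussianReal] at this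
  have h2 : (fun x : ℝ => x) ∘ J h = J h := rfl
  rw [h2] at this
  simpa using this.symm

theorem dual_pi_isonormal {ι : Type*} [Fintype ι] [DecidableEq ι] (k : ι → H)
    (L : StrongDual ℝ (ι → ℝ)) :
    (fun s => L fun i => J (k i) s) =ᵐ[Q] J (∑ i, L (Pi.single i 1) • k i) := by
  have h1 : J (∑ i, L (Pi.single i 1) • k i) = ∑ i, L (Pi.single i 1) • J (k i) := by simp
  rw [h1]
  refine EventuallyEq.trans ?_ (Lp.coeFn_finsetSum _ _).symm
  have h2 : ∀ᵐ s ∂Q, ∀ i, (L (Pi.single i 1) • J (k i) : Lp ℝ 2 Q) s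
      = L (Pi.single i 1) * J (k i) s := by
    rw [ae_all_iff]
    intro i
    filter_upwards [Lp.coeFn_smul (L (Pi.single i 1)) (J (k i))] with s hs
    rw [hs]; rfl
  filter_upwards [h2] with s hs
  rw [Finset.sum_apply]
  simp only [hs]
  conv_lhs => rw [pi_eq_sum_univ' fun i => J (k i) s]
  rw [map_sum]
  refine Finset.sum_congr rfl fun i _ => ?_
  rw [map_smul, smul_eq_mul, mul_comm]

/-- A finite-dimensional law depends on the vectors only through their Gram matrix, which is what
makes increments comparable. -/
theorem charFunDual_isonormal (hJ : ∀ h, Q.map (J h) = gaussianReal 0 (‖h‖₊ ^ 2))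
    {ι : Type*} [Fintype ι] [DecidableEq ι] (k : ι → H) (L : StrongDual ℝ (ι → ℝ)) :
    charFunDual (Q.map fun s i => J (k i) s) L
      = Complex.exp (-(‖∑ i, L (Pi.single i 1) • k i‖ ^ 2 / 2 : ℝ)) := by
  have hm : Measurable fun s i => J (k i) s :=
    measurable_pi_lambda _ fun i => (Lp.stronglyMeasurable (J (k i))).measurable
  rw [charFunDual_apply, integral_map hm.aemeasurable (by fun_prop), ← integral_cexp_isonormal hJ]
  refine integral_congr_ae ?_
  filter_upwards [dual_pi_isonormal (Q := Q) (J := J) k L] with s hs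
  rw [hs]

theorem isGaussianProcess_isonormal [IsProbabilityMeasure Q]
    (hJ : ∀ h, Q.map (J h) = gaussianReal 0 (‖h‖₊ ^ 2)) {T : Type*} (k : T → H) :
    IsGaussianProcess (fun t => J (k t)) Q := by
  classical
  refine ⟨fun I => ⟨?_⟩⟩
  have hm : Measurable fun s (i : I) => J (k i) s :=
    measurable_pi_lambda _ fun i => (Lp.stronglyMeasurable (J (k i))).measurable
  have := Measure.isProbabilityMeasure_map (μ := Q) hm.aemeasurable
  change IsGaussian (Q.map fun s (i : I) => J (k i) s)
  refine isGaussian_of_charFunDual_eq fun L => ?_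
  have hd := dual_pi_isonormal (Q := Q) (J := J) (fun i : I => k i) L
  rw [charFunDual_isonormal hJ, integral_complex_ofReal, integral_map hm.aemeasurable (by fun_prop),
    variance_map (by fun_prop) hm.aemeasurable, integral_congr_ae hd, integral_isonormal hJ,
    show (L ∘ fun s (i : I) => J (k i) s) = fun s => L fun i : I => J (k i) s from rfl,
    variance_congr (Y := J (∑ i : I, L (Pi.single i 1) • k i)) hd, variance_isonormal hJ]
  simp

/-- By polarization the Gram matrix of the vectors k(x + a) − k(a) is (g‖x‖ + g‖y‖ − g‖x − y‖)/2. It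
does not involve a, so the increments are stationary. An admissible field is thus obtained from any
embedding that realizes the variogram. -/
theorem isAdmissibleGaussian_isonormal {d : ℕ} [IsProbabilityMeasure Q]
    (hJ : ∀ h, Q.map (J h) = gaussianReal 0 (‖h‖₊ ^ 2)) {k : Euc d → H} {g : ℝ → ℝ}
    (hg : MonotoneOn g (Ici 0)) (hg' : Tendsto g atTop atTop)
    (hk : ∀ s t, ‖k s - k t‖ ^ 2 = g ‖s - t‖) :
    IsAdmissibleGaussian (fun t => J (k t)) Q := by
  classical
  have hvar : ∀ t, variogram (fun t => J (k t)) Q t = g ‖t‖ := fun t => by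
    have h1 : ∫ s, (J (k t - k 0) s) ^ 2 ∂Q = g ‖t‖ := by
      rw [← variance_of_integral_eq_zero (Lp.stronglyMeasurable _).measurable.aemeasurable
        (integral_isonormal hJ _), variance_isonormal hJ, hk, sub_zero]
    rw [← h1, variogram]
    refine integral_congr_ae ?_
    rw [map_sub]
    filter_upwards [Lp.coeFn_sub (J (k t)) (J (k 0))] with s hs
    rw [hs]; rfl
  have hm : ∀ t, Measurable (J (k t)) := fun t => (Lp.stronglyMeasurable _).measurable
  refine ⟨inferInstance, hm, isGaussianProcess_isonormal hJ k, fun t => integral_isonormal hJ _,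
    fun a => ?_, fun x y h => ?_, ?_⟩
  · have hms : ∀ x y : Euc d → Euc d, AEMeasurable (fun s t => J (k (x t)) s - J (k (y t)) s) Q :=
      fun x y => (measurable_pi_lambda _ fun t => (hm _).sub (hm _)).aemeasurable
    rw [identDistrib_iff_forall_finset_identDistrib (hms (fun t => t + a) fun _ => a)
      (hms (fun t => t) fun _ => 0)]
    intro I
    have hmI : ∀ f : I → Euc d × Euc d, Measurable fun s i => J (k (f i).1 - k (f i).2) s :=
      fun f => measurable_pi_lambda _ fun t => (Lp.stronglyMeasurable _).measurable
    have key : ∀ f : I → Euc d × Euc d, (fun s (i : I) => J (k (f i).1) s - J (k (f i).2) s) =ᵐ[Q]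
        fun s i => J (k (f i).1 - k (f i).2) s := fun f => by
      have : ∀ᵐ s ∂Q, ∀ i, J (k (f i).1 - k (f i).2) s = J (k (f i).1) s - J (k (f i).2) s := by
        rw [ae_all_iff]
        intro i
        rw [map_sub]
        filter_upwards [Lp.coeFn_sub (J (k (f i).1)) (J (k (f i).2))] with s hs
        rw [hs]; rfl
      filter_upwards [this] with s hs
      funext i
      rw [hs]
    refine (IdentDistrib.of_ae_eq (by fun_prop) (key fun i => (i.1 + a, a))).trans
      (IdentDistrib.trans ?_ (IdentDistrib.of_ae_eq (by fun_prop) (key fun i => (i.1, 0))).symm)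
    refine ⟨(hmI _).aemeasurable, (hmI _).aemeasurable, ?_⟩
    have p1 := Measure.isProbabilityMeasure_map (μ := Q) (hmI fun i => (i.1 + a, a)).aemeasurable
    have p2 := Measure.isProbabilityMeasure_map (μ := Q) (hmI fun i => (i.1, 0)).aemeasurable
    refine Measure.ext_of_charFunDual (funext fun L => ?_)
    rw [charFunDual_isonormal hJ, charFunDual_isonormal hJ]
    have hin : ∀ x y a : Euc d, inner ℝ (k (x + a) - k a) (k (y + a) - k a)
        = (g ‖x‖ + g ‖y‖ - g ‖x - y‖) / 2 := fun x y a => by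
      rw [real_inner_eq_norm_mul_self_add_norm_mul_self_sub_norm_sub_mul_self_div_two]
      simp only [← sq, sub_sub_sub_cancel_right, hk, add_sub_cancel_right, add_sub_add_right_eq_sub]
    have hin0 : ∀ x y : Euc d, inner ℝ (k x - k 0) (k y - k 0)
        = (g ‖x‖ + g ‖y‖ - g ‖x - y‖) / 2 := fun x y => by
      simpa using hin x y 0
    have : ‖∑ i : I, L (Pi.single i 1) • (k (i.1 + a) - k a)‖ ^ 2
        = ‖∑ i : I, L (Pi.single i 1) • (k i.1 - k 0)‖ ^ 2 := by
      simp only [← real_inner_self_eq_norm_sq, sum_inner, inner_sum, real_inner_smul_left,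
        real_inner_smul_right, hin, hin0]
    rw [this]
  · rw [hvar, hvar]
    exact hg (norm_nonneg _) (norm_nonneg _) h
  · refine (hg'.comp (tendsto_norm_cocompact_atTop (E := Euc d))).congr fun t => (hvar t).symm

end isonormal

/-! ### Tail correlation functions of (variance-mixed) Brown-Resnick processes -/

theorem map_eq_of_isAdmissibleGaussian {d : ℕ} {S : Type} [MeasurableSpace S] {W : Euc d → S → ℝ}
    {Q : Measure S} (hW : IsAdmissibleGaussian W Q) (t : Euc d) :
    Q.map (W t) = gaussianReal 0 (variance (W t) Q).toNNReal := by
  have := (hW.gaussian.hasGaussianLaw_eval t).map_eq_gaussianReal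
  rwa [hW.centred t] at this

theorem lintegral_exp_scaled {d : ℕ} {S : Type} [MeasurableSpace S] {W : Euc d → S → ℝ}
    {Q : Measure S} (hW : IsAdmissibleGaussian W Q) (t : Euc d) (a : ℝ) {f : ℝ≥0∞ → ℝ≥0∞}
    (hf : Measurable f) :
    ∫⁻ s, f (ENNReal.ofReal (Real.exp (a * W t s - a ^ 2 * variance (W t) Q / 2))) ∂Q
      = ∫⁻ x, f (ENNReal.ofReal (Real.exp (x - (a ^ 2 * variance (W t) Q).toNNReal / 2)))
          ∂(gaussianReal 0 (a ^ 2 * variance (W t) Q).toNNReal) := by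
  have h1 : Q.map (fun s => a * W t s) = gaussianReal 0 (a ^ 2 * variance (W t) Q).toNNReal := by
    have := Measure.map_map (μ := Q) (measurable_const_mul a) (hW.measurable t)
    rw [map_eq_of_isAdmissibleGaussian hW, gaussianReal_map_const_mul] at this
    rw [show (fun s => a * W t s) = (fun x => a * x) ∘ W t from rfl, ← this, mul_zero]
    congr 1
    ext
    simp [variance_nonneg, mul_nonneg, sq_nonneg]
  rw [← h1, lintegral_map (by fun_prop) ((hW.measurable t).const_mul a)]
  rw [Real.coe_toNNReal _ (mul_nonneg (sq_nonneg a) (variance_nonneg _ _))]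

theorem lintegral_exp_admissible {d : ℕ} {S : Type} [MeasurableSpace S] {W : Euc d → S → ℝ}
    {Q : Measure S} (hW : IsAdmissibleGaussian W Q) (t : Euc d) (a : ℝ) :
    ∫⁻ s, ENNReal.ofReal (Real.exp (a * W t s - a ^ 2 * variance (W t) Q / 2)) ∂Q = 1 := by
  have := lintegral_exp_scaled hW t a measurable_id
  simp only [id] at this
  rw [this, lintegral_exp_gaussianReal]

/-- Vanishing at the origin makes the first term 1, which leaves a one-dimensional Gaussian
integral. -/
theorem lintegral_min_admissible {d : ℕ} {S : Type} [MeasurableSpace S] {W : Euc d → S → ℝ}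
    {Q : Measure S} (hW : IsAdmissibleGaussian W Q) (h0 : W 0 =ᵐ[Q] 0) (t : Euc d) {a : ℝ}
    (ha : 0 ≤ a) :
    ∫⁻ s, min (ENNReal.ofReal (Real.exp (a * W 0 s - a ^ 2 * variance (W 0) Q / 2)))
        (ENNReal.ofReal (Real.exp (a * W t s - a ^ 2 * variance (W t) Q / 2))) ∂Q
      = ENNReal.ofReal (erfc (a * √(variance (W t) Q / 8))) := by
  have h1 : ∫⁻ s, min (ENNReal.ofReal (Real.exp (a * W 0 s - a ^ 2 * variance (W 0) Q / 2)))
        (ENNReal.ofReal (Real.exp (a * W t s - a ^ 2 * variance (W t) Q / 2))) ∂Q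
      = ∫⁻ s, min 1 (ENNReal.ofReal (Real.exp (a * W t s - a ^ 2 * variance (W t) Q / 2))) ∂Q := by
    refine lintegral_congr_ae ?_
    filter_upwards [h0] with s hs
    have : variance (W 0) Q = 0 := by
      rw [variance_congr h0]; exact variance_zero _
    rw [hs, this]
    simp
  rw [h1, lintegral_exp_scaled hW t a (f := fun x => min 1 x) (by fun_prop),
    lintegral_min_exp_gaussianReal, Real.coe_toNNReal _ (mul_nonneg (sq_nonneg a) (variance_nonneg _ _)),
    mul_div_assoc, Real.sqrt_mul (sq_nonneg a), Real.sqrt_sq ha]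

theorem mem_tcfBR_of_admissible {d : ℕ} {S : Type} [MeasurableSpace S] {W : Euc d → S → ℝ}
    {Q : Measure S} (hW : IsAdmissibleGaussian W Q) (h0 : W 0 =ᵐ[Q] 0) :
    (fun t => erfc √(variance (W t) Q / 8)) ∈ tcfBR d := by
  have := hW.prob
  obtain ⟨Ω, _, P, X, hP, hX⟩ := exists_hasSpectralRepresentation Q
    (V := fun t s => ENNReal.ofReal (Real.exp (W t s - variance (W t) Q / 2)))
    (fun t => by have := hW.measurable t; fun_prop)
    (fun t => by simpa using lintegral_exp_admissible hW t 1)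
  refine ⟨Ω, _, P, X, hP, ⟨S, _, Q, W, hW, hX⟩, ?_⟩
  rw [hX.isTCF_iff]
  intro t
  have := lintegral_min_admissible hW h0 t zero_le_one
  simp only [one_pow, one_mul] at this
  rw [this, ENNReal.toReal_ofReal (erfc_nonneg _)]

theorem mem_tcfVBR_of_admissible {d : ℕ} {S : Type} [MeasurableSpace S] {W : Euc d → S → ℝ}
    {Q : Measure S} (hW : IsAdmissibleGaussian W Q) {G : Measure ℝ} [IsProbabilityMeasure G]
    (hG : G (Iic 0) = 0) :
    (fun t => (∫⁻ a, (∫⁻ s, min (ENNReal.ofReal (Real.exp (a * W 0 s - a ^ 2 * variance (W 0) Q / 2)))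
        (ENNReal.ofReal (Real.exp (a * W t s - a ^ 2 * variance (W t) Q / 2))) ∂Q) ∂G).toReal)
      ∈ tcfVBR d := by
  have := hW.prob
  have hm : ∀ t, Measurable fun p : S × ℝ => ENNReal.ofReal
        (Real.exp (p.2 * W t p.1 - p.2 ^ 2 * variance (W t) Q / 2)) := fun t => by
    have := (hW.measurable t).comp (measurable_fst : Measurable (Prod.fst : S × ℝ → S))
    have h2 : Measurable fun p : S × ℝ => W t p.1 := this
    exact (((measurable_snd.mul h2).sub (by fun_prop)).exp).ennreal_ofReal
  obtain ⟨Ω, _, P, X, hP, hX⟩ := exists_hasSpectralRepresentation (Q.prod G)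
    (V := fun (t : Euc d) p => ENNReal.ofReal
        (Real.exp (p.2 * W t p.1 - p.2 ^ 2 * variance (W t) Q / 2))) hm
    (fun t => by
      rw [lintegral_prod_symm _ (hm t).aemeasurable]
      simp only [lintegral_exp_admissible hW t, lintegral_one, measure_univ])
  refine ⟨Ω, _, P, X, hP, ⟨S, _, Q, W, G, hW, inferInstance, hG, hX⟩, ?_⟩
  rw [hX.isTCF_iff]
  intro t
  rw [lintegral_prod_symm _ ((hm 0).min (hm t)).aemeasurable]

theorem tcfBR_subset_tcfVBR (d : ℕ) : tcfBR d ⊆ tcfVBR d := by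
  rintro χ ⟨Ω, _, P, X, hP, ⟨S, _, Q, W, hW, hX⟩, hχ⟩
  have := hW.prob
  rw [hX.isTCF_iff] at hχ
  -- R = 1. Here `W 0` need not vanish, so the integrals are matched without being evaluated.
  have := mem_tcfVBR_of_admissible hW (G := Measure.dirac 1) (by simp)
  convert this using 1
  funext t
  rw [hχ t]
  have hm : Measurable fun p : ℝ × S =>
      min (ENNReal.ofReal (Real.exp (p.1 * W 0 p.2 - p.1 ^ 2 * variance (W 0) Q / 2)))
        (ENNReal.ofReal (Real.exp (p.1 * W t p.2 - p.1 ^ 2 * variance (W t) Q / 2))) := by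
    have h1 : ∀ t, Measurable fun p : ℝ × S => W t p.2 := fun t =>
      (hW.measurable t).comp measurable_snd
    have h2 : ∀ t, Measurable fun p : ℝ × S =>
        ENNReal.ofReal (Real.exp (p.1 * W t p.2 - p.1 ^ 2 * variance (W t) Q / 2)) := fun t =>
      (((measurable_fst.mul (h1 t)).sub (by fun_prop)).exp).ennreal_ofReal
    exact (h2 0).min (h2 t)
  rw [lintegral_dirac' _ hm.lintegral_prod_right']
  simp

/-- The isonormal process on ℝ^d itself, scaled by √8, has variance 8‖t‖². The 8 cancels the one in
erfc(a√(Var/8)), and a is distributed by the mixing law. -/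
theorem IsErfcMixture.radial_mem_tcfVBR {φ : ℝ≥0 → ℝ} (h : IsErfcMixture φ) (d : ℕ) :
    radial d φ ∈ tcfVBR d := by
  obtain ⟨G, hG, hG0, hφ⟩ := h
  obtain ⟨S, _, Q, J, hQ, hJ⟩ := exists_isonormal (Euc d)
  have hW := isAdmissibleGaussian_isonormal (d := d) (Q := Q) hJ (k := fun t => √8 • t)
    (g := fun r => 8 * r ^ 2) (fun a ha b _ hab => by
      simp only [mem_Ici] at ha
      dsimp only
      gcongr) ((tendsto_pow_atTop two_ne_zero).const_mul_atTop (by norm_num)) fun s t => by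
      rw [← smul_sub, norm_smul, mul_pow, Real.norm_of_nonneg (by positivity), Real.sq_sqrt (by norm_num)]
  have h0 : J (√8 • (0 : Euc d)) =ᵐ[Q] 0 := by
    rw [smul_zero, map_zero]; exact Lp.coeFn_zero _ _ _
  convert mem_tcfVBR_of_admissible hW hG0 using 1
  funext t
  rw [radial, hφ, integral_eq_lintegral_of_nonneg_ae (ae_of_all _ fun s => erfc_nonneg _)
    (continuous_erfc.comp (by fun_prop)).aestronglyMeasurable]
  congr 1
  refine lintegral_congr_ae ?_
  filter_upwards [ae_pos_of_Iic hG0] with a ha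
  rw [lintegral_min_admissible hW h0 t ha.le, variance_isonormal hJ, norm_smul, mul_pow,
    Real.norm_of_nonneg (by positivity), Real.sq_sqrt (by norm_num),
    mul_div_cancel_left₀ _ (by norm_num), Real.sqrt_sq (norm_nonneg _)]
  rfl

/-! ### Exponentials as mixtures of complementary error functions -/

/-- `φ` is the Laplace transform of a probability measure on `(0, ∞)`. -/
def IsLaplace (φ : ℝ≥0 → ℝ) : Prop :=
  ∃ F : Measure ℝ, IsProbabilityMeasure F ∧ F (Iic 0) = 0 ∧
    ∀ r : ℝ≥0, φ r = ∫ a, Real.exp (-(a * r)) ∂F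

/-- The Cauchy–Schlömilch substitution: y ↦ a/y preserves the exponent and shows that inserting the
weight a/y² does not change the integral. The sum of both versions carries the Jacobian of the
bijection y ↦ y − a/y from (0,∞) to ℝ, hence equals √π. -/
theorem lintegral_exp_neg_sub_div_sq {a : ℝ} (ha : 0 < a) :
    ∫⁻ y in Ioi (0 : ℝ), ENNReal.ofReal (Real.exp (-(y - a / y) ^ 2))
      = ENNReal.ofReal (√Real.pi / 2) := by
  set A := ∫⁻ y in Ioi (0 : ℝ), ENNReal.ofReal (Real.exp (-(y - a / y) ^ 2)) with hA
  have h1 : A = ∫⁻ y in Ioi (0 : ℝ), ENNReal.ofReal (a / y ^ 2) *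
      ENNReal.ofReal (Real.exp (-(y - a / y) ^ 2)) := by
    have him : (fun y : ℝ => a / y) '' Ioi 0 = Ioi 0 := by
      ext x
      simp only [mem_image, mem_Ioi]
      refine ⟨?_, fun hx => ⟨a / x, by positivity, by field_simp⟩⟩
      rintro ⟨y, hy, rfl⟩
      positivity
    have := lintegral_image_eq_lintegral_abs_deriv_mul (s := Ioi (0 : ℝ)) (f := fun y => a / y)
      (f' := fun y => -a / y ^ 2) measurableSet_Ioi (fun y hy => by
        have hy' : y ≠ 0 := (mem_Ioi.1 hy).ne'
        have h := (hasDerivAt_inv hy').const_mul a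
        have e : a * -(y ^ 2)⁻¹ = -a / y ^ 2 := by ring
        rw [e] at h
        exact h.hasDerivWithinAt) (fun x hx y hy h => by
        have hx' : x ≠ 0 := (mem_Ioi.1 hx).ne'
        have hy' : y ≠ 0 := (mem_Ioi.1 hy).ne'
        simp only at h
        field_simp at h
        exact h.symm) (fun y => ENNReal.ofReal (Real.exp (-(y - a / y) ^ 2)))
    rw [him] at this
    rw [hA, this]
    refine setLIntegral_congr_fun measurableSet_Ioi fun y hy => ?_
    have hy' : 0 < y := hy
    rw [abs_div, abs_neg, abs_of_pos ha, abs_of_pos (by positivity : 0 < y ^ 2)]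
    congr 3
    field_simp
    ring
  have h2 : ∫⁻ y in Ioi (0 : ℝ), ENNReal.ofReal (1 + a / y ^ 2) *
      ENNReal.ofReal (Real.exp (-(y - a / y) ^ 2)) = ENNReal.ofReal √Real.pi := by
    have him : (fun y : ℝ => y - a / y) '' Ioi 0 = univ := by
      ext x
      simp only [mem_image, mem_Ioi, mem_univ, iff_true]
      have hs : √(x ^ 2 + 4 * a) ^ 2 = x ^ 2 + 4 * a := Real.sq_sqrt (by positivity)
      have hlt : |x| < √(x ^ 2 + 4 * a) := by
        rw [← Real.sqrt_sq_eq_abs]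
        exact Real.sqrt_lt_sqrt (by positivity) (by linarith)
      have hp : 0 < x + √(x ^ 2 + 4 * a) := by linarith [neg_abs_le x]
      refine ⟨(x + √(x ^ 2 + 4 * a)) / 2, by positivity, ?_⟩
      field_simp
      nlinarith
    have := lintegral_image_eq_lintegral_abs_deriv_mul (s := Ioi (0 : ℝ)) (f := fun y => y - a / y)
      (f' := fun y => 1 + a / y ^ 2) measurableSet_Ioi (fun y hy => by
        have hy' : y ≠ 0 := (mem_Ioi.1 hy).ne'
        have h := (hasDerivAt_id y).sub ((hasDerivAt_inv hy').const_mul a)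
        have e : 1 - a * -(y ^ 2)⁻¹ = 1 + a / y ^ 2 := by ring
        rw [e] at h
        exact h.hasDerivWithinAt) (fun x hx y hy h => by
        have hx' : 0 < x := hx
        have hy' : 0 < y := hy
        simp only at h
        field_simp at h
        have : (x - y) * (x * y + a) = 0 := by linear_combination h
        rcases mul_eq_zero.1 this with h | h
        · linarith
        · have := mul_pos hx' hy'; linarith) (fun y => ENNReal.ofReal (Real.exp (-y ^ 2)))
    rw [him, setLIntegral_univ, ← ofReal_integral_eq_lintegral_ofReal integrable_exp_neg_sq
      (ae_of_all _ fun _ => (Real.exp_pos _).le)] at this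
    have h3 := integral_gaussian 1
    simp only [neg_mul, one_mul, div_one] at h3
    rw [h3] at this
    rw [this]
    refine setLIntegral_congr_fun measurableSet_Ioi fun y hy => ?_
    have hy' : 0 < y := hy
    rw [abs_of_pos (by positivity : 0 < 1 + a / y ^ 2)]
  have h3 : A + A = ENNReal.ofReal √Real.pi := by
    rw [← h2]
    nth_rw 2 [h1]
    rw [hA, ← lintegral_add_left (by fun_prop)]
    refine setLIntegral_congr_fun measurableSet_Ioi fun y hy => ?_
    have hy' : 0 < y := hy
    rw [ENNReal.ofReal_add zero_le_one (by positivity), ENNReal.ofReal_one, add_mul, one_mul]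
  rw [← two_mul] at h3
  rw [ENNReal.ofReal_div_of_pos two_pos, ← h3, ENNReal.ofReal_ofNat, mul_comm,
    ENNReal.mul_div_cancel_right (by norm_num) (by norm_num)]

/-- Complete the square: y² + r²/(4y²) = (y − r/(2y))² + r. -/
theorem lintegral_exp_neg_div_sq_gaussianReal {r : ℝ} (hr : 0 < r) :
    2 * ∫⁻ y in Ioi (0 : ℝ), ENNReal.ofReal (Real.exp (-(r ^ 2 / (4 * y ^ 2))))
      ∂(gaussianReal 0 (1 / 2)) = ENNReal.ofReal (Real.exp (-r)) := by
  rw [gaussianReal_of_var_ne_zero _ (by norm_num), setLIntegral_withDensity_eq_setLIntegral_mul _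
    (by fun_prop) (by fun_prop) measurableSet_Ioi]
  have h := lintegral_exp_neg_sub_div_sq (a := r / 2) (by positivity)
  have : ∀ y ∈ Ioi (0 : ℝ), (gaussianPDF 0 (1 / 2) * fun y =>
      ENNReal.ofReal (Real.exp (-(r ^ 2 / (4 * y ^ 2))))) y
      = ENNReal.ofReal ((√Real.pi)⁻¹ * Real.exp (-r)) *
        ENNReal.ofReal (Real.exp (-(y - r / 2 / y) ^ 2)) := fun y hy => by
    have hy' : 0 < y := hy
    rw [Pi.mul_apply, gaussianPDF, gaussianPDFReal, ← ENNReal.ofReal_mul (by positivity),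
      ← ENNReal.ofReal_mul (by positivity), mul_assoc (√(2 * Real.pi * _))⁻¹,
      mul_assoc (√Real.pi)⁻¹, ← Real.exp_add, ← Real.exp_add]
    congr 2
    · push_cast
      congr 2
      ring
    · congr 1
      push_cast
      field_simp
      ring
  rw [setLIntegral_congr_fun measurableSet_Ioi this, lintegral_const_mul _ (by fun_prop), h,
    ← ENNReal.ofReal_mul (by positivity), ← ENNReal.ofReal_ofNat, ← ENNReal.ofReal_mul (by norm_num)]
  congr 1
  field_simp

/-- The scale is s = 1/(2√E) with E = −log u standard exponential. Write erfc(sr) as 2P(N > sr),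
with N centred normal of variance 1/2, and integrate over E first. For y > 0 the event sr < y is E >
r²/(4y²), of probability exp(−r²/(4y²)); the remaining Gaussian integral is exp(−r). -/
theorem exists_erfc_mixture_exp : ∃ G : Measure ℝ, IsProbabilityMeasure G ∧ G (Iic 0) = 0 ∧
    ∀ r : ℝ, 0 ≤ r → ∫⁻ s, ENNReal.ofReal (erfc (s * r)) ∂G = ENNReal.ofReal (Real.exp (-r)) := by
  let U : Measure ℝ := volume.restrict (Ioo 0 1)
  have hU : IsProbabilityMeasure U := ⟨by simp [U]⟩
  let f : ℝ → ℝ := fun u => (2 * √(-Real.log u))⁻¹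
  have hf : Measurable f := by fun_prop
  have hpos : ∀ u ∈ Ioo (0 : ℝ) 1, 0 < √(-Real.log u) := fun u hu =>
    Real.sqrt_pos.2 (by linarith [Real.log_neg hu.1 hu.2])
  have hprob : IsProbabilityMeasure (U.map f) := Measure.isProbabilityMeasure_map hf.aemeasurable
  refine ⟨U.map f, hprob, ?_, fun r hr => ?_⟩
  · rw [Measure.map_apply hf measurableSet_Iic, Measure.restrict_apply (hf measurableSet_Iic)]
    convert measure_empty (μ := (volume : Measure ℝ)) using 2
    rw [← disjoint_iff_inter_eq_empty, Set.disjoint_left]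
    intro u hu hu'
    have h1 := hpos u hu'
    have h2 : 0 < f u := by positivity
    exact absurd h2 (not_lt.2 hu)
  rcases hr.eq_or_lt with rfl | hr
  · simp [erfc_zero]
  have hcr : Measurable fun s : ℝ => ENNReal.ofReal (erfc (s * r)) :=
    (continuous_erfc.measurable.comp (by fun_prop)).ennreal_ofReal
  rw [lintegral_map hcr hf]
  set N := gaussianReal 0 (1 / 2)
  let E : Set (ℝ × ℝ) := {p | f p.1 * r < p.2}
  have hE : MeasurableSet E := measurableSet_lt (by fun_prop) measurable_snd
  have h1 : ∀ u, ENNReal.ofReal (erfc (f u * r)) = 2 * N (Prod.mk u ⁻¹' E) := fun u => by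
    rw [erfc_eq_gaussianReal, ENNReal.ofReal_mul two_pos.le, ENNReal.ofReal_ofNat, ofReal_measureReal]
    rfl
  simp only [h1]
  rw [lintegral_const_mul _ (measurable_measure_prodMk_left hE), ← Measure.prod_apply hE,
    Measure.prod_apply_symm hE, ← lintegral_exp_neg_div_sq_gaussianReal hr,
    ← lintegral_indicator measurableSet_Ioi]
  congr 1
  refine lintegral_congr fun y => ?_
  rw [Measure.restrict_apply (measurable_prodMk_right hE)]
  by_cases hy : 0 < y
  · rw [indicator_of_mem (mem_Ioi.2 hy)]
    have : (fun u => (u, y)) ⁻¹' E ∩ Ioo 0 1 = Ioo 0 (Real.exp (-(r ^ 2 / (4 * y ^ 2)))) := by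
      ext u
      simp only [mem_inter_iff, mem_preimage, mem_Ioo, E, mem_ofPred_eq, f]
      have key : u ∈ Ioo (0 : ℝ) 1 → ((2 * √(-Real.log u))⁻¹ * r < y ↔
          u < Real.exp (-(r ^ 2 / (4 * y ^ 2)))) := fun hu => by
        have hs := hpos u hu
        rw [← Real.log_lt_iff_lt_exp hu.1, lt_neg, inv_mul_lt_iff₀ (by positivity)]
        have : r < 2 * √(-Real.log u) * y ↔ r / (2 * y) < √(-Real.log u) := by
          rw [div_lt_iff₀ (by positivity)]
          ring_nf
        rw [this, Real.lt_sqrt (by positivity)]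
        ring_nf
      constructor
      · rintro ⟨a, b⟩
        exact ⟨b.1, (key b).1 a⟩
      · rintro ⟨a, b⟩
        have h3 : Real.exp (-(r ^ 2 / (4 * y ^ 2))) < 1 := by
          rw [Real.exp_lt_one_iff]
          have : 0 < r ^ 2 / (4 * y ^ 2) := by positivity
          linarith
        have hu : u ∈ Ioo (0 : ℝ) 1 := ⟨a, b.trans h3⟩
        exact ⟨(key hu).2 b, hu⟩
    rw [this, Real.volume_Ioo, sub_zero]
  · rw [indicator_of_notMem (by simpa using hy)]
    convert measure_empty (μ := (volume : Measure ℝ)) using 2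
    rw [← disjoint_iff_inter_eq_empty, Set.disjoint_left]
    intro u hu hu'
    have h1 := hpos u hu'
    have h2 : 0 < f u * r := by positivity
    have h3 : f u * r < y := hu
    linarith

/-- The mixing law is that of the product of a variable with law F and an independent scale that
represents exp(−r). -/
theorem IsLaplace.isErfcMixture {φ : ℝ≥0 → ℝ} (h : IsLaplace φ) : IsErfcMixture φ := by
  obtain ⟨F, hF, hF0, hφ⟩ := h
  obtain ⟨G, hG, hG0, hGe⟩ := exists_erfc_mixture_exp
  have hm : Measurable fun p : ℝ × ℝ => p.1 * p.2 := by fun_prop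
  have hae : ∀ᵐ p ∂(F.prod G), 0 < p.1 * p.2 := by
    have h1 := Measure.quasiMeasurePreserving_fst (μ := F) (ν := G) |>.ae (ae_pos_of_Iic hF0)
    have h2 := Measure.quasiMeasurePreserving_snd (μ := F) (ν := G) |>.ae (ae_pos_of_Iic hG0)
    filter_upwards [h1, h2] with p a b using mul_pos a b
  refine ⟨(F.prod G).map fun p => p.1 * p.2, Measure.isProbabilityMeasure_map hm.aemeasurable, ?_,
    fun r => ?_⟩
  · rw [Measure.map_apply hm measurableSet_Iic]
    refine measure_mono_null (fun p hp => ?_) (ae_iff.1 hae)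
    simpa using hp
  · have hcr : Continuous fun s : ℝ => erfc (s * r) := continuous_erfc.comp (by fun_prop)
    have hcp : Measurable fun p : ℝ × ℝ => ENNReal.ofReal (erfc (p.1 * p.2 * r)) :=
      hcr.measurable.ennreal_ofReal.comp hm
    rw [hφ, integral_eq_lintegral_of_nonneg_ae (ae_of_all _ fun _ => (Real.exp_pos _).le)
      (by fun_prop), integral_eq_lintegral_of_nonneg_ae (ae_of_all _ fun _ => erfc_nonneg _)
      hcr.aestronglyMeasurable, lintegral_map hcr.measurable.ennreal_ofReal hm, lintegral_prod _ hcp.aemeasurable]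
    congr 1
    refine lintegral_congr_ae ?_
    filter_upwards [ae_pos_of_Iic hF0] with a ha
    rw [← hGe (a * r) (by positivity)]
    refine lintegral_congr fun s => ?_
    congr 2
    ring

/-! ### Positive stable laws -/

theorem integral_exp_neg_blockSum {S : Type*} [MeasurableSpace S] (m : Measure S)
    [IsProbabilityMeasure m] {h : S → ℝ} (hh : Measurable h) (h0 : ∀ y, 0 ≤ h y) {r : ℝ}
    (hr : 0 ≤ r) :
    ∫ p, Real.exp (-(r * blockSum h p)) ∂(blockMeasure m)
      = Real.exp (-∫ y, (1 - Real.exp (-(r * h y))) ∂m) := by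
  have := integral_block_prod m (g := fun y => ((Real.exp (-(r * h y)) : ℝ) : ℂ)) (by fun_prop)
    (fun y => by
      rw [Complex.norm_real, Real.norm_of_nonneg (Real.exp_pos _).le, Real.exp_le_one_iff]
      nlinarith [h0 y, mul_nonneg hr (h0 y)])
  have e1 : ∀ p : ℕ × (ℕ → S), ∏ i ∈ Finset.range p.1, ((Real.exp (-(r * h (p.2 i))) : ℝ) : ℂ)
      = ((Real.exp (-(r * blockSum h p)) : ℝ) : ℂ) := fun p => by
    rw [← Complex.ofReal_prod, ← Real.exp_sum, blockSum, Finset.mul_sum, Finset.sum_neg_distrib]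
  have e2 : ∀ y, ((Real.exp (-(r * h y)) : ℝ) : ℂ) - 1
      = ((-(1 - Real.exp (-(r * h y))) : ℝ) : ℂ) := fun y => by push_cast; ring
  simp only [e1, e2] at this
  rw [integral_complex_ofReal, integral_complex_ofReal, ← Complex.ofReal_exp, Complex.ofReal_inj,
    integral_neg] at this
  exact this

theorem tendsto_integral_exp_neg {Ω : Type*} [MeasurableSpace Ω] {P : Measure Ω}
    [IsFiniteMeasure P] {T : Ω → ℝ} (hT : Measurable T) (h0 : ∀ ω, 0 ≤ T ω) (A : Set Ω) (hA : MeasurableSet A) :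
    Tendsto (fun n : ℕ => ∫ ω, A.indicator (fun ω => Real.exp (-((n + 1 : ℝ)⁻¹ * T ω))) ω ∂P) atTop
      (𝓝 (P.real A)) := by
  have : P.real A = ∫ ω, A.indicator (fun _ => (1 : ℝ)) ω ∂P := by
    rw [integral_indicator hA]; simp
  rw [this]
  refine tendsto_integral_of_dominated_convergence (fun _ => 1) (fun n => ?_) (integrable_const _)
    (fun n => ae_of_all _ fun ω => ?_) (ae_of_all _ fun ω => ?_)
  · exact (Measurable.indicator (by fun_prop) hA).aestronglyMeasurable
  · by_cases h : ω ∈ A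
    · rw [indicator_of_mem h, Real.norm_of_nonneg (Real.exp_pos _).le, Real.exp_le_one_iff]
      have := h0 ω
      have : 0 ≤ ((n : ℝ) + 1)⁻¹ * T ω := by positivity
      linarith
    · rw [indicator_of_notMem h]; simp
  · by_cases h : ω ∈ A
    · simp only [indicator_of_mem h]
      have h1 : Tendsto (fun n : ℕ => ((n : ℝ) + 1)⁻¹) atTop (𝓝 0) := by
        simpa using tendsto_one_div_add_atTop_nhds_zero_nat (𝕜 := ℝ)
      have h2 := (Real.continuous_exp.tendsto _).comp ((h1.mul_const (T ω)).neg)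
      simp only [zero_mul, neg_zero, Real.exp_zero] at h2
      exact h2
    · simp only [indicator_of_notMem h]
      exact tendsto_const_nhds

/-- Campbell's formula: T is the sum of h over a Poisson process. The exponents add up over the
independent blocks, and T is almost surely finite because exp(−c(r)) → 1 as r → 0. -/
theorem exists_sum_of_hasSum_laplaceExponent {S : Type} [MeasurableSpace S] (m : ℕ → Measure S)
    [∀ k, IsProbabilityMeasure (m k)] {h : S → ℝ} (hh : Measurable h) (h0 : ∀ y, 0 ≤ h y)
    {c : ℝ → ℝ} (hc : ∀ r, 0 < r → HasSum (fun k => ∫ y, (1 - Real.exp (-(r * h y))) ∂(m k)) (c r))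
    (hc0 : Tendsto c (𝓝[>] 0) (𝓝 0)) :
    ∃ (Ω : Type) (_ : MeasurableSpace Ω) (P : Measure Ω) (T : Ω → ℝ), IsProbabilityMeasure P ∧
      Measurable T ∧ (∀ ω, 0 ≤ T ω) ∧
      ∀ r, 0 < r → ∫ ω, Real.exp (-(r * T ω)) ∂P = Real.exp (-c r) := by
  let Ω := ℕ → ℕ × (ℕ → S)
  let P : Measure Ω := Measure.infinitePi fun k => blockMeasure (m k)
  have hmp : ∀ k, MeasurePreserving (fun ω : Ω => ω k) P (blockMeasure (m k)) := fun k =>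
    measurePreserving_eval_infinitePi _ k
  have hb : Measurable (blockSum h) := measurable_blockSum hh
  have hb0 : ∀ p, 0 ≤ blockSum h p := fun p => Finset.sum_nonneg fun i _ => h0 _
  let B : ℕ → Ω → ℝ := fun k ω => blockSum h (ω k)
  have hB : ∀ k, Measurable (B k) := fun k => hb.comp (measurable_pi_apply k)
  have hind : iIndepFun B P := iIndepFun_infinitePi (X := fun _ => blockSum h) fun _ => hb
  let E : Ω → ℝ≥0∞ := fun ω => ∑' k, ENNReal.ofReal (B k ω)
  have hE : Measurable E := Measurable.tsum fun k => (hB k).ennreal_ofReal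
  let A : Set Ω := {ω | E ω ≠ ∞}
  have hA : MeasurableSet A := hE (measurableSet_singleton _).compl
  let T : Ω → ℝ := fun ω => (E ω).toReal
  have hT : Measurable T := hE.ennreal_toReal
  have hT0 : ∀ ω, 0 ≤ T ω := fun ω => ENNReal.toReal_nonneg
  have hpart : ∀ r, 0 < r → ∀ K : ℕ, ∫ ω, Real.exp (-(r * ∑ k ∈ Finset.range K, B k ω)) ∂P
      = Real.exp (-∑ k ∈ Finset.range K, ∫ y, (1 - Real.exp (-(r * h y))) ∂(m k)) := by
    intro r hr K
    have hi : iIndepFun (fun (k : Finset.range K) ω => B k ω) P := hind.precomp Subtype.val_injective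
    have := iIndepFun.integral_fun_prod_comp (X := fun (k : Finset.range K) ω => B k ω) (μ := P) hi
      (f := fun _ x => Real.exp (-(r * x))) (fun k => (hB k).aemeasurable)
      (fun _ => Continuous.aestronglyMeasurable (by fun_prop))
    have e : ∀ k, ∫ ω, Real.exp (-(r * B k ω)) ∂P
        = Real.exp (-∫ y, (1 - Real.exp (-(r * h y))) ∂(m k)) := fun k => by
      have hm : Measurable fun p => Real.exp (-(r * blockSum h p)) := by fun_prop
      rw [← integral_exp_neg_blockSum (m k) hh h0 hr.le, ← (hmp k).map_eq,
        integral_map (hmp k).measurable.aemeasurable hm.aestronglyMeasurable]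
    rw [← Finset.sum_neg_distrib, Real.exp_sum, ← Finset.prod_coe_sort]
    simp only [← e]
    rw [← this]
    congr 1
    funext ω
    rw [← Real.exp_sum, Finset.sum_coe_sort (Finset.range K) fun k => -(r * B k ω),
      Finset.sum_neg_distrib, Finset.mul_sum]
  -- Off `A` the partial sums diverge and the exponentials tend to zero, whereas `toReal` sets T to
  -- 0 there; hence the indicator.
  have hlim : ∀ r, 0 < r → ∫ ω, A.indicator (fun ω => Real.exp (-(r * T ω))) ω ∂P
      = Real.exp (-c r) := by
    intro r hr
    have h1 : Tendsto (fun K : ℕ => ∫ ω, Real.exp (-(r * ∑ k ∈ Finset.range K, B k ω)) ∂P) atTop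
        (𝓝 (∫ ω, A.indicator (fun ω => Real.exp (-(r * T ω))) ω ∂P)) := by
      refine tendsto_integral_of_dominated_convergence (fun _ => 1) (fun K => ?_) (integrable_const _)
        (fun K => ae_of_all _ fun ω => ?_) (ae_of_all _ fun ω => ?_)
      · have : Measurable fun ω => ∑ k ∈ Finset.range K, B k ω :=
          Finset.measurable_fun_sum _ fun k _ => hB k
        exact (by fun_prop : Measurable fun ω => Real.exp (-(r * ∑ k ∈ Finset.range K, B k ω))).aestronglyMeasurable
      · rw [Real.norm_of_nonneg (Real.exp_pos _).le, Real.exp_le_one_iff]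
        have : 0 ≤ ∑ k ∈ Finset.range K, B k ω := Finset.sum_nonneg fun k _ => hb0 _
        have : 0 ≤ r * ∑ k ∈ Finset.range K, B k ω := by positivity
        linarith
      · have hs0 : ∀ k, 0 ≤ B k ω := fun k => hb0 _
        by_cases hω : ω ∈ A
        · rw [indicator_of_mem hω]
          have hsum : Summable fun k => B k ω := by
            have := ENNReal.summable_toReal hω
            simpa [ENNReal.toReal_ofReal (hs0 _)] using this
          have hTs : HasSum (fun k => B k ω) (T ω) := by
            have : T ω = ∑' k, B k ω := by
              change (∑' k, ENNReal.ofReal (B k ω)).toReal = _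
              rw [← ENNReal.ofReal_tsum_of_nonneg hs0 hsum, ENNReal.toReal_ofReal (tsum_nonneg hs0)]
            rw [this]; exact hsum.hasSum
          exact (Real.continuous_exp.tendsto _).comp ((hTs.tendsto_sum_nat.const_mul r).neg)
        · rw [indicator_of_notMem hω]
          have hns : ¬ Summable fun k => B k ω := fun hs => hω hs.tsum_ofReal_ne_top
          have := (not_summable_iff_tendsto_nat_atTop_of_nonneg hs0).1 hns
          exact Real.tendsto_exp_atBot.comp
            (tendsto_neg_atTop_atBot.comp (this.const_mul_atTop hr))
    refine tendsto_nhds_unique h1 ?_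
    simp only [hpart r hr]
    exact (Real.continuous_exp.tendsto _).comp ((hc r hr).tendsto_sum_nat.neg)
  -- As r → 0 the left side of `hlim` tends to P(A) and the right side to 1.
  have hA1 : P.real A = 1 := by
    refine tendsto_nhds_unique (tendsto_integral_exp_neg hT hT0 A hA) ?_
    have h1 : Tendsto (fun n : ℕ => ((n : ℝ) + 1)⁻¹) atTop (𝓝[>] 0) := by
      rw [tendsto_nhdsWithin_iff]
      exact ⟨by simpa using tendsto_one_div_add_atTop_nhds_zero_nat (𝕜 := ℝ),
        Eventually.of_forall fun n => mem_Ioi.2 (by positivity)⟩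
    have h2 := (Real.continuous_exp.tendsto _).comp (hc0.comp h1).neg
    simp only [neg_zero, Real.exp_zero] at h2
    exact h2.congr fun n => (hlim _ (by positivity)).symm
  refine ⟨Ω, inferInstance, P, T, inferInstance, hT, hT0, fun r hr => ?_⟩
  rw [← hlim r hr]
  have hae : ∀ᵐ ω ∂P, ω ∈ A := by
    have hP1 : P A = 1 := by
      rw [measureReal_def] at hA1
      exact (ENNReal.toReal_eq_one_iff _).1 hA1
    exact (prob_compl_eq_zero_iff hA).2 hP1
  refine integral_congr_ae ?_
  filter_upwards [hae] with ω hω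
  rw [indicator_of_mem hω]

theorem lintegral_invSqMeasure_scale {c : ℝ} (hc : 0 < c) (f : ℝ → ℝ≥0∞) (hf : Measurable f) :
    ∫⁻ u, f (c * u) ∂invSqMeasure = ENNReal.ofReal c * ∫⁻ u, f u ∂invSqMeasure := by
  have hm : Measurable fun u : ℝ => ENNReal.ofReal ((u ^ 2)⁻¹) := by fun_prop
  have him : (fun u : ℝ => c * u) '' Ioi 0 = Ioi 0 := by
    ext x
    simp only [mem_image, mem_Ioi]
    refine ⟨?_, fun hx => ⟨x / c, by positivity, by field_simp⟩⟩
    rintro ⟨y, hy, rfl⟩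
    positivity
  have := lintegral_image_eq_lintegral_abs_deriv_mul (s := Ioi (0 : ℝ)) (f := fun u => c * u)
    (f' := fun _ => c) measurableSet_Ioi (fun y _ => by
      simpa using ((hasDerivAt_id y).const_mul c).hasDerivWithinAt)
    (fun x _ y _ h => mul_left_cancel₀ hc.ne' h) fun u => ENNReal.ofReal ((u ^ 2)⁻¹) * f u
  rw [him] at this
  rw [invSqMeasure, lintegral_withDensity_eq_lintegral_mul _ hm hf,
    lintegral_withDensity_eq_lintegral_mul _ hm (by fun_prop)]
  simp only [Pi.mul_apply]
  rw [this, ← lintegral_const_mul _ (by fun_prop)]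
  refine setLIntegral_congr_fun measurableSet_Ioi fun u hu => ?_
  have hu' : 0 < u := hu
  simp only [abs_of_pos hc, ← mul_assoc]
  congr 1
  rw [← ENNReal.ofReal_mul hc.le, ← ENNReal.ofReal_mul (by positivity)]
  congr 1
  field_simp

/-- Near zero 1 − e^{−x} ≤ x leaves u^{1/β − 2}, which is integrable because β < 1; at infinity u⁻²
suffices. -/
theorem lintegral_one_sub_exp_invSqMeasure {β : ℝ} (hβ : 0 < β) (hβ1 : β < 1) :
    ∫⁻ u, ENNReal.ofReal (1 - Real.exp (-|u| ^ β⁻¹)) ∂invSqMeasure ≠ ∞ := by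
  have hm : Measurable fun u : ℝ => ENNReal.ofReal ((u ^ 2)⁻¹) := by fun_prop
  rw [invSqMeasure, lintegral_withDensity_eq_lintegral_mul _ hm (by fun_prop)]
  rw [← Ioc_union_Ioi_eq_Ioi zero_le_one, lintegral_union measurableSet_Ioi
    (Ioc_disjoint_Ioi le_rfl)]
  have hβi : 1 < β⁻¹ := (one_lt_inv₀ hβ).2 hβ1
  refine ENNReal.add_ne_top.2 ⟨?_, ?_⟩
  · have h1 : IntegrableOn (fun u : ℝ => u ^ (β⁻¹ - 2)) (Ioc 0 1) :=
      (intervalIntegrable_iff_integrableOn_Ioc_of_le zero_le_one).1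
        (intervalIntegral.intervalIntegrable_rpow' (by linarith))
    have h2 := h1.lintegral_lt_top
    refine ne_top_of_le_ne_top h2.ne (setLIntegral_mono' measurableSet_Ioc fun u hu => ?_)
    have hu' : 0 < u := hu.1
    rw [Pi.mul_apply, ← ENNReal.ofReal_mul (by positivity), abs_of_pos hu']
    refine ENNReal.ofReal_le_ofReal ?_
    rw [Real.rpow_sub hu', Real.rpow_ofNat, div_eq_inv_mul]
    gcongr
    linarith [Real.add_one_le_exp (-u ^ β⁻¹)]
  · have h1 : IntegrableOn (fun u : ℝ => u ^ (-2 : ℝ)) (Ioi 1) :=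
      integrableOn_Ioi_rpow_of_lt (by norm_num) one_pos
    have h2 := h1.lintegral_lt_top
    refine ne_top_of_le_ne_top h2.ne (setLIntegral_mono' measurableSet_Ioi fun u hu => ?_)
    have hu' : 0 < u := one_pos.trans hu
    rw [Pi.mul_apply, ← ENNReal.ofReal_mul (by positivity)]
    refine ENNReal.ofReal_le_ofReal ?_
    rw [Real.rpow_neg hu'.le, Real.rpow_ofNat]
    refine mul_le_of_le_one_right (by positivity) ?_
    linarith [Real.exp_pos (-|u| ^ β⁻¹)]

/-- Since r u^{1/β} = (r^β u)^{1/β} for u > 0, the scaling of u⁻² du extracts the factor r^β. The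
constant c serves both stable laws and fractional Brownian variograms, and its value is irrelevant.
-/
theorem exists_lintegral_one_sub_exp_mul {β : ℝ} (hβ : 0 < β) (hβ1 : β < 1) :
    ∃ c : ℝ, 0 < c ∧ ∀ r, 0 < r →
      ∫⁻ u, ENNReal.ofReal (1 - Real.exp (-(r * |u| ^ β⁻¹))) ∂invSqMeasure
        = ENNReal.ofReal (r ^ β * c) := by
  set c := (∫⁻ u, ENNReal.ofReal (1 - Real.exp (-|u| ^ β⁻¹)) ∂invSqMeasure).toReal with hcdef
  have hfin := lintegral_one_sub_exp_invSqMeasure hβ hβ1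
  have hscale : ∀ r, 0 < r → ∫⁻ u, ENNReal.ofReal (1 - Real.exp (-(r * |u| ^ β⁻¹))) ∂invSqMeasure
      = ENNReal.ofReal (r ^ β * c) := by
    intro r hr
    have h1 := lintegral_invSqMeasure_scale (c := r ^ β) (by positivity)
      (fun u => ENNReal.ofReal (1 - Real.exp (-|u| ^ β⁻¹))) (by fun_prop)
    rw [ENNReal.ofReal_mul (by positivity), hcdef, ENNReal.ofReal_toReal hfin, ← h1]
    refine lintegral_congr fun u => ?_
    rw [abs_mul, Real.mul_rpow (abs_nonneg _) (abs_nonneg _), abs_of_pos (by positivity : 0 < r ^ β),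
      ← Real.rpow_mul hr.le, mul_inv_cancel₀ hβ.ne', Real.rpow_one]
  have hcpos : 0 < c := by
    refine ENNReal.toReal_pos (fun h => ?_) hfin
    rw [lintegral_eq_zero_iff (by fun_prop)] at h
    have h2 : invSqMeasure (Ioi 1) = 0 := by
      refine measure_mono_null (fun u hu => ?_) (ae_iff.1 h)
      have hu' : 0 < u := one_pos.trans hu
      simp only [Pi.zero_apply, ENNReal.ofReal_eq_zero, not_le, mem_ofPred_eq, sub_pos,
        Real.exp_lt_one_iff, abs_of_pos hu']
      have : 0 < u ^ β⁻¹ := by positivity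
      linarith
    rw [invSqMeasure_Ioi one_pos] at h2
    simp at h2
  exact ⟨c, hcpos, hscale⟩

theorem isLaplace_of_law {Ω : Type*} [MeasurableSpace Ω] {P : Measure Ω} [IsProbabilityMeasure P]
    {T : Ω → ℝ} (hT : AEMeasurable T P) (hpos : ∀ᵐ ω ∂P, 0 < T ω) {φ : ℝ≥0 → ℝ}
    (hφ : ∀ r : ℝ≥0, φ r = ∫ ω, Real.exp (-(T ω * r)) ∂P) : IsLaplace φ := by
  refine ⟨P.map T, Measure.isProbabilityMeasure_map hT, ?_, fun r => ?_⟩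
  · rw [Measure.map_apply_of_aemeasurable hT measurableSet_Iic]
    refine measure_mono_null (fun ω h => ?_) (ae_iff.1 hpos)
    simpa using h
  · rw [integral_map hT (by fun_prop), hφ]

/-- The sum of |u|^{1/β} over a Poisson process with intensity u⁻² du is positive β-stable with
exponent c r^β, and the factor c^{−1/β} normalizes it. It is almost surely positive because P(T = 0)
≤ E e^{−rT} → 0 as r → ∞. -/
theorem isLaplace_exp_neg_rpow {β : ℝ} (hβ : 0 < β) (hβ1 : β ≤ 1) :
    IsLaplace fun r => Real.exp (-(r : ℝ) ^ β) := by
  rcases hβ1.eq_or_lt with rfl | hβ1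
  · exact ⟨Measure.dirac 1, inferInstance, by simp, fun r => by simp⟩
  have hprob : ∀ k, IsProbabilityMeasure (invSqMeasure.restrict (invSqPiece 1 k)) := fun k =>
    ⟨by rw [Measure.restrict_apply_univ, invSqMeasure_piece one_pos]; simp⟩
  obtain ⟨c, hcpos, hscale⟩ := exists_lintegral_one_sub_exp_mul hβ hβ1
  obtain ⟨Ω, _, P, T, hP, hT, hT0, hTL⟩ := exists_sum_of_hasSum_laplaceExponent
    (fun k => invSqMeasure.restrict (invSqPiece 1 k)) (h := fun u => |u| ^ β⁻¹) (by fun_prop)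
    (fun u => by positivity) (c := fun r => r ^ β * c) (fun r hr => by
      have hnn : ∀ u : ℝ, 0 ≤ 1 - Real.exp (-(r * |u| ^ β⁻¹)) := fun u => by
        rw [sub_nonneg, Real.exp_le_one_iff]
        have : 0 ≤ r * |u| ^ β⁻¹ := by positivity
        linarith
      have h1 := hscale r hr
      rw [invSqMeasure_eq_sum 1, lintegral_sum_measure] at h1
      have h2 : ∑' k, ∫⁻ u, ENNReal.ofReal (1 - Real.exp (-(r * |u| ^ β⁻¹)))
          ∂(invSqMeasure.restrict (invSqPiece 1 k)) ≠ ∞ := by rw [h1]; exact ENNReal.ofReal_ne_top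
      have h3 := ENNReal.hasSum_toReal h2
      rw [← ENNReal.tsum_toReal_eq (ENNReal.ne_top_of_tsum_ne_top h2), h1,
        ENNReal.toReal_ofReal (by positivity)] at h3
      convert h3 using 2 with k
      exact integral_eq_lintegral_of_nonneg_ae (ae_of_all _ hnn)
        (by fun_prop : Measurable fun u : ℝ =>
          1 - Real.exp (-(r * |u| ^ β⁻¹))).aestronglyMeasurable)
    (by
      have : Tendsto (fun r : ℝ => r ^ β * c) (𝓝 0) (𝓝 (0 ^ β * c)) :=
        ((Real.continuousAt_rpow_const 0 β (Or.inr hβ.le)).tendsto).mul_const c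
      rw [Real.zero_rpow hβ.ne', zero_mul] at this
      exact this.mono_left nhdsWithin_le_nhds)
  have hTpos : ∀ᵐ ω ∂P, 0 < T ω := by
    have hle : ∀ n : ℕ, P.real {ω | T ω = 0} ≤ Real.exp (-(((n : ℝ) + 1) ^ β * c)) := fun n => by
      rw [← hTL _ (by positivity)]
      have hmz : MeasurableSet {ω | T ω = 0} := hT (measurableSet_singleton 0)
      have : P.real {ω | T ω = 0} = ∫ ω, {ω | T ω = 0}.indicator (fun _ => (1 : ℝ)) ω ∂P := by
        rw [integral_indicator hmz]; simp
      rw [this]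
      refine integral_mono ((integrable_const _).indicator hmz)
        (Integrable.of_bound (C := 1) (by fun_prop) (ae_of_all _ fun ω => ?_)) fun ω => ?_
      · rw [Real.norm_of_nonneg (Real.exp_pos _).le, Real.exp_le_one_iff]
        have := hT0 ω
        have : 0 ≤ ((n : ℝ) + 1) * T ω := by positivity
        linarith
      · by_cases hω : T ω = 0
        · simp [indicator, hω]
        · simp only [indicator, mem_ofPred_eq, hω, if_false]
          positivity
    have hlim : Tendsto (fun n : ℕ => Real.exp (-(((n : ℝ) + 1) ^ β * c))) atTop (𝓝 0) := by
      refine Real.tendsto_exp_atBot.comp (tendsto_neg_atTop_atBot.comp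
        (Tendsto.atTop_mul_const hcpos ((tendsto_rpow_atTop hβ).comp ?_)))
      exact tendsto_atTop_add_const_right _ _ tendsto_natCast_atTop_atTop
    have h0 : P.real {ω | T ω = 0} = 0 :=
      le_antisymm (ge_of_tendsto' hlim hle) measureReal_nonneg
    have h0' : P {ω | T ω = 0} = 0 := by
      rwa [measureReal_def, ENNReal.toReal_eq_zero_iff, or_iff_left (measure_ne_top _ _)] at h0
    rw [ae_iff]
    refine measure_mono_null (fun ω hω => ?_) h0'
    simp only [mem_ofPred_eq, not_lt] at hω ⊢
    exact le_antisymm hω (hT0 ω)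
  refine isLaplace_of_law (P := P) (T := fun ω => c ^ (-β⁻¹) * T ω) (by fun_prop)
    (hTpos.mono fun ω h => by positivity) fun r => ?_
  rcases eq_or_ne r 0 with rfl | hr
  · simp [Real.zero_rpow hβ.ne']
  have hr' : 0 < (r : ℝ) := by positivity
  have h1 := hTL (c ^ (-β⁻¹) * r) (by positivity)
  rw [Real.mul_rpow (by positivity) (by positivity), ← Real.rpow_mul hcpos.le, neg_mul,
    inv_mul_cancel₀ hβ.ne', Real.rpow_neg_one] at h1
  have e : c⁻¹ * (r : ℝ) ^ β * c = (r : ℝ) ^ β := by field_simp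
  rw [e] at h1
  rw [← h1]
  congr 1
  funext ω
  congr 2
  ring

/-! ### The functions `r ↦ erfc (r ^ α)` as Laplace transforms -/

theorem integrable_exp_neg_of_ae_pos {F : Measure ℝ} [IsFiniteMeasure F] (h : F (Iic 0) = 0) (r : ℝ≥0) :
    Integrable (fun a => Real.exp (-(a * r))) F := by
  refine Integrable.of_bound (C := 1) (by fun_prop) ?_
  filter_upwards [ae_pos_of_Iic h] with a ha
  rw [Real.norm_of_nonneg (Real.exp_pos _).le, Real.exp_le_one_iff]
  have : 0 ≤ a * r := by positivity
  linarith

theorem IsLaplace.mul {φ ψ : ℝ≥0 → ℝ} (hφ : IsLaplace φ) (hψ : IsLaplace ψ) :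
    IsLaplace fun r => φ r * ψ r := by
  obtain ⟨F, hF, hF0, hφ⟩ := hφ
  obtain ⟨G, hG, hG0, hψ⟩ := hψ
  refine isLaplace_of_law (P := F.prod G) (T := fun p => p.1 + p.2) (by fun_prop) ?_ fun r => ?_
  · have h1 := Measure.quasiMeasurePreserving_fst (μ := F) (ν := G) |>.ae (ae_pos_of_Iic hF0)
    have h2 := Measure.quasiMeasurePreserving_snd (μ := F) (ν := G) |>.ae (ae_pos_of_Iic hG0)
    filter_upwards [h1, h2] with p a b using add_pos a b
  · rw [hφ, hψ, ← integral_prod_mul]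
    congr 1
    funext p
    rw [← Real.exp_add]
    congr 1
    ring

/-- The distribution of the absolute value of a centred normal variable with variance `1 / 2`. -/
noncomputable def halfNormal : Measure ℝ :=
  (volume.restrict (Ioi 0)).withDensity fun w => ENNReal.ofReal (2 / √Real.pi * Real.exp (-w ^ 2))

theorem integral_halfNormal (f : ℝ → ℝ) :
    ∫ w, f w ∂halfNormal = 2 / √Real.pi * ∫ w in Ioi (0 : ℝ), Real.exp (-w ^ 2) * f w := by
  rw [halfNormal, integral_withDensity_eq_integral_toReal_smul (by fun_prop)
    (ae_of_all _ fun _ => ENNReal.ofReal_lt_top), ← integral_const_mul]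
  congr 1
  funext w
  rw [ENNReal.toReal_ofReal (by positivity), smul_eq_mul, mul_assoc]

instance : IsProbabilityMeasure halfNormal := ⟨by
  rw [halfNormal, withDensity_apply _ MeasurableSet.univ, Measure.restrict_univ,
    ← ofReal_integral_eq_lintegral_ofReal (integrable_exp_neg_sq.integrableOn.const_mul _)
      (ae_of_all _ fun _ => by positivity), integral_const_mul]
  have := erfc_zero
  rw [erfc] at this
  rw [this, ENNReal.ofReal_one]⟩

theorem halfNormal_ae_pos : ∀ᵐ w ∂halfNormal, 0 < w :=
  (withDensity_absolutelyContinuous _ _).ae_le (ae_restrict_mem measurableSet_Ioi)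

/-- In erfc(x) = e^{−x²} E e^{−2wx} with w half-normal, put x = r^α. The first factor is stable of
index 2α, which is where α ≤ 1/2 enters. The second is the Laplace transform of (2w)^{1/α} times an
independent α-stable variable. -/
theorem isLaplace_erfc_rpow {α : ℝ} (h0 : 0 < α) (h1 : α ≤ 1 / 2) :
    IsLaplace fun r => erfc ((r : ℝ) ^ α) := by
  have hA := isLaplace_exp_neg_rpow (β := 2 * α) (by linarith) (by linarith)
  obtain ⟨F, hF, hF0, hFα⟩ := isLaplace_exp_neg_rpow h0 (by linarith)
  have hB : IsLaplace fun r => ∫ w, Real.exp (-(2 * w * (r : ℝ) ^ α)) ∂halfNormal := by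
    refine isLaplace_of_law (P := halfNormal.prod F) (T := fun p => (2 * p.1) ^ α⁻¹ * p.2)
      (by fun_prop) ?_ fun r => ?_
    · have h1 := Measure.quasiMeasurePreserving_fst (μ := halfNormal) (ν := F) |>.ae
        halfNormal_ae_pos
      have h2 := Measure.quasiMeasurePreserving_snd (μ := halfNormal) (ν := F) |>.ae
        (ae_pos_of_Iic hF0)
      filter_upwards [h1, h2] with p a b
      positivity
    · rw [integral_prod]
      · refine integral_congr_ae ?_
        filter_upwards [halfNormal_ae_pos] with w hw
        have h2w : 0 < (2 * w) ^ α⁻¹ := by positivity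
        have := hFα (((2 * w) ^ α⁻¹).toNNReal * r)
        simp only [NNReal.coe_mul, Real.coe_toNNReal _ h2w.le] at this
        rw [Real.mul_rpow h2w.le r.coe_nonneg, ← Real.rpow_mul (by positivity), inv_mul_cancel₀ h0.ne',
          Real.rpow_one] at this
        rw [this]
        congr 1
        funext a
        congr 2
        ring
      · refine Integrable.of_bound (C := 1) (by fun_prop) ?_
        have h1 := Measure.quasiMeasurePreserving_fst (μ := halfNormal) (ν := F) |>.ae
          halfNormal_ae_pos
        have h2 := Measure.quasiMeasurePreserving_snd (μ := halfNormal) (ν := F) |>.ae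
          (ae_pos_of_Iic hF0)
        filter_upwards [h1, h2] with p a b
        rw [Real.norm_of_nonneg (Real.exp_pos _).le, Real.exp_le_one_iff]
        have : 0 ≤ (2 * p.1) ^ α⁻¹ * p.2 * r := by positivity
        linarith
  convert hA.mul hB using 2 with r
  rw [erfc_eq_exp_mul, integral_halfNormal, mul_comm 2 α, Real.rpow_mul r.coe_nonneg, Real.rpow_ofNat]

/-- A Laplace transform equals 1 at zero, is continuous there, and is at least δe^{−Mr} for some δ,
M with δ > 0. These facts exclude α = 0, α < 0 and α > 1/2 respectively, the last because erfc(r^α)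
≤ exp(−r^{2α}). -/
theorem mem_Ioc_of_isLaplace_erfc_rpow {α : ℝ} (h : IsLaplace fun r => erfc ((r : ℝ) ^ α)) :
    α ∈ Ioc (0 : ℝ) (1 / 2) := by
  obtain ⟨F, hF, hF0, hφ⟩ := h
  have hφ : ∀ r : ℝ≥0, erfc ((r : ℝ) ^ α) = ∫ a, Real.exp (-(a * r)) ∂F := hφ
  have hpos := ae_pos_of_Iic hF0
  have h1 : α ≠ 0 := by
    rintro rfl
    have h2 := hφ 0
    simp only [NNReal.coe_zero, Real.rpow_zero, mul_zero, neg_zero, Real.exp_zero, integral_const,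
      probReal_univ, smul_eq_mul, mul_one] at h2
    have h3 := erfc_le_exp zero_le_one
    rw [h2, ← Real.exp_zero, Real.exp_le_exp] at h3
    norm_num at h3
  have hu : Tendsto (fun n : ℕ => ((n : ℝ) + 1)) atTop atTop :=
    tendsto_atTop_add_const_right _ _ tendsto_natCast_atTop_atTop
  -- For α < 0 the convention 0^α = 0 makes both sides 1 at r = 0, so the contradiction comes from r
  -- → 0 along 1/(n+1).
  have h2 : 0 ≤ α := by
    by_contra hα
    rw [not_le] at hα
    have hl : Tendsto (fun n : ℕ => ∫ a, Real.exp (-(a * ((n : ℝ) + 1)⁻¹)) ∂F) atTop (𝓝 1) := by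
      have e : (1 : ℝ) = ∫ a, (1 : ℝ) ∂F := by simp
      nth_rw 2 [e]
      refine tendsto_integral_of_dominated_convergence (fun _ => 1) (fun n => by fun_prop)
        (integrable_const _) (fun n => ?_) (ae_of_all _ fun a => ?_)
      · filter_upwards [hpos] with a ha
        rw [Real.norm_of_nonneg (Real.exp_pos _).le, Real.exp_le_one_iff]
        have : 0 ≤ a * ((n : ℝ) + 1)⁻¹ := by positivity
        linarith
      · have h2 := (Real.continuous_exp.tendsto _).comp
          ((hu.inv_tendsto_atTop.const_mul a).neg)
        simp only [mul_zero, neg_zero, Real.exp_zero] at h2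
        exact h2
    have hr : Tendsto (fun n : ℕ => erfc ((((n : ℝ) + 1)⁻¹) ^ α)) atTop (𝓝 0) := by
      have h3 := tendsto_erfc_atTop.comp ((tendsto_rpow_atTop (neg_pos.2 hα)).comp hu)
      refine h3.congr fun n => ?_
      simp only [Function.comp_apply]
      rw [Real.rpow_neg (by positivity), Real.inv_rpow (by positivity)]
    have := tendsto_nhds_unique hl (hr.congr fun n => by
      simpa using hφ ((n : ℝ≥0) + 1)⁻¹)
    norm_num at this
  refine ⟨lt_of_le_of_ne h2 h1.symm, ?_⟩
  by_contra hα
  rw [not_le] at hα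
  obtain ⟨M, hM⟩ : ∃ M : ℕ, 0 < F (Iic (M : ℝ)) := by
    by_contra hcon
    push Not at hcon
    have : F (⋃ M : ℕ, Iic (M : ℝ)) = 0 := measure_iUnion_null fun M => le_antisymm (hcon M) bot_le
    have hU : ⋃ M : ℕ, Iic (M : ℝ) = univ := by
      ext x
      simpa using exists_nat_ge x
    rw [hU, measure_univ] at this
    exact one_ne_zero this
  have hδ : 0 < F.real (Iic (M : ℝ)) := ENNReal.toReal_pos hM.ne' (measure_ne_top _ _)
  have hlow : ∀ r : ℝ≥0, F.real (Iic (M : ℝ)) * Real.exp (-(M * r)) ≤ erfc ((r : ℝ) ^ α) := by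
    intro r
    rw [hφ]
    have e : F.real (Iic (M : ℝ)) * Real.exp (-(M * r))
        = ∫ a, (Iic (M : ℝ)).indicator (fun _ => Real.exp (-(M * r))) a ∂F := by
      rw [integral_indicator measurableSet_Iic]; simp
    rw [e]
    refine integral_mono ((integrable_const _).indicator measurableSet_Iic)
      (integrable_exp_neg_of_ae_pos hF0 r) fun a => ?_
    by_cases ha : a ∈ Iic (M : ℝ)
    · rw [indicator_of_mem ha]
      have : a ≤ M := ha
      dsimp only
      gcongr
    · rw [indicator_of_notMem ha]
      positivity
  have hup : ∀ r : ℝ≥0, erfc ((r : ℝ) ^ α) ≤ Real.exp (-(r : ℝ) ^ (2 * α)) := fun r => by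
    have := erfc_le_exp (x := (r : ℝ) ^ α) (by positivity)
    rwa [← Real.rpow_mul_natCast r.coe_nonneg, Nat.cast_ofNat, mul_comm α 2] at this
  have hbd : ∀ n : ℕ, F.real (Iic (M : ℝ)) ≤
      Real.exp (-(((n : ℝ) + 1) * (((n : ℝ) + 1) ^ (2 * α - 1) - M))) := fun n => by
    have h3 := (hlow ((n : ℝ≥0) + 1)).trans (hup _)
    rw [← le_div_iff₀ (Real.exp_pos _), ← Real.exp_sub] at h3
    refine h3.trans_eq ?_
    congr 1
    push_cast
    rw [Real.rpow_sub_one (by positivity)]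
    field_simp
    ring
  have hlim : Tendsto (fun n : ℕ =>
      Real.exp (-(((n : ℝ) + 1) * (((n : ℝ) + 1) ^ (2 * α - 1) - M)))) atTop (𝓝 0) := by
    refine Real.tendsto_exp_atBot.comp (tendsto_neg_atTop_atBot.comp (hu.atTop_mul_atTop₀ ?_))
    exact tendsto_atTop_add_const_right _ _ ((tendsto_rpow_atTop (by linarith)).comp hu)
  exact absurd (ge_of_tendsto' hlim hbd) (not_le.2 hδ)

/-! ### Fractional Brownian fields -/

theorem integral_cos_inner_stdGaussian {d : ℕ} (y : Euc d) :
    ∫ x, Real.cos (inner ℝ x y) ∂(stdGaussian (Euc d)) = Real.exp (-(‖y‖ ^ 2 / 2)) := by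
  have h := charFun_stdGaussian (E := Euc d) y
  rw [charFun_apply] at h
  have hi : Integrable (fun x : Euc d => Complex.exp (inner ℝ x y * Complex.I))
      (stdGaussian (Euc d)) :=
    Integrable.of_bound (C := 1) (by fun_prop) (ae_of_all _ fun x => by
      rw [Complex.norm_exp_ofReal_mul_I])
  have h2 := integral_re hi
  rw [h] at h2
  have e : ∀ x : Euc d, RCLike.re (Complex.exp (inner ℝ x y * Complex.I))
      = Real.cos (inner ℝ x y) := fun x => Complex.exp_ofReal_mul_I_re _
  have e2 : RCLike.re (Complex.exp (-‖y‖ ^ 2 / 2)) = Real.exp (-(‖y‖ ^ 2 / 2)) := by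
    rw [RCLike.re_eq_complex_re, ← neg_div]
    norm_cast
  rw [e2] at h2
  simp only [e] at h2
  exact h2

/-- The measure on scales and directions of the spectral representation of fractional Brownian
fields. -/
noncomputable def scaleMeasure (d : ℕ) : Measure (ℝ × Euc d) :=
  invSqMeasure.prod (stdGaussian (Euc d))

/-- The factor √2|u|^{1/(2α)} makes the Gaussian mean of the cosine of the phase equal to
exp(−|u|^{1/α}‖t‖²). -/
noncomputable def phase {d : ℕ} (α : ℝ) (t : Euc d) (p : ℝ × Euc d) : ℝ :=
  inner ℝ p.2 ((√2 * |p.1| ^ (α⁻¹ / 2)) • t)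

theorem measurable_phase {d : ℕ} (α : ℝ) (t : Euc d) : Measurable (phase α t) := by
  unfold phase
  fun_prop

theorem phase_sub {d : ℕ} (α : ℝ) (s t : Euc d) (p : ℝ × Euc d) :
    phase α (s - t) p = phase α s p - phase α t p := by
  simp only [phase, smul_sub, inner_sub_right]

/-- Integrating over the Gaussian direction leaves twice the Lévy integral of the α-stable law at
‖t‖², hence a multiple of ‖t‖^{2α}. Its convergence requires α < 1. -/
theorem exists_lintegral_phase {α : ℝ} (hα : 0 < α) (hα1 : α < 1) : ∃ c : ℝ, 0 < c ∧
    ∀ (d : ℕ) (t : Euc d), ∫⁻ p, ENNReal.ofReal (2 - 2 * Real.cos (phase α t p)) ∂(scaleMeasure d)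
      = ENNReal.ofReal (c * ‖t‖ ^ (2 * α)) := by
  obtain ⟨c, hc, hcr⟩ := exists_lintegral_one_sub_exp_mul hα hα1
  refine ⟨2 * c, by positivity, fun d t => ?_⟩
  rcases eq_or_ne t 0 with rfl | ht
  · simp [phase, Real.zero_rpow (by positivity : 2 * α ≠ 0)]
  have ht' : 0 < ‖t‖ := norm_pos_iff.2 ht
  have h2 : ∀ x : ℝ, (2 : ℝ≥0∞) * ENNReal.ofReal x = ENNReal.ofReal (2 * x) := fun x => by
    rw [ENNReal.ofReal_mul two_pos.le, ENNReal.ofReal_ofNat]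
  have hm := measurable_phase α t
  rw [scaleMeasure, lintegral_prod _ (by fun_prop)]
  have h1 : ∀ u : ℝ, ∫⁻ g, ENNReal.ofReal (2 - 2 * Real.cos (phase α t (u, g)))
      ∂(stdGaussian (Euc d)) = 2 * ENNReal.ofReal (1 - Real.exp (-(‖t‖ ^ 2 * |u| ^ α⁻¹))) := by
    intro u
    have hmu : Measurable fun g : Euc d => phase α t (u, g) := hm.comp measurable_prodMk_left
    have hi : Integrable (fun g : Euc d => Real.cos (phase α t (u, g))) (stdGaussian (Euc d)) :=
      Integrable.of_bound (C := 1) hmu.cos.aestronglyMeasurable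
        (ae_of_all _ fun x => Real.abs_cos_le_one _)
    have hi2 : Integrable (fun g : Euc d => 2 - 2 * Real.cos (phase α t (u, g)))
        (stdGaussian (Euc d)) := (integrable_const _).sub (hi.const_mul 2)
    rw [← ofReal_integral_eq_lintegral_ofReal hi2
      (ae_of_all _ fun g => by
        have := Real.cos_le_one (phase α t (u, g))
        simp only [Pi.zero_apply]
        linarith), integral_sub (integrable_const _) (hi.const_mul 2), integral_const_mul]
    have e : ∫ g, Real.cos (phase α t (u, g)) ∂(stdGaussian (Euc d))
        = Real.exp (-(‖t‖ ^ 2 * |u| ^ α⁻¹)) := by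
      simp only [phase]
      rw [integral_cos_inner_stdGaussian, norm_smul, mul_pow, Real.norm_of_nonneg (by positivity),
        mul_pow, Real.sq_sqrt (by norm_num), ← Real.rpow_mul_natCast (abs_nonneg u)]
      congr 1
      push_cast
      rw [div_mul_cancel₀ _ two_ne_zero]
      ring
    rw [e, h2]
    congr 1
    simp only [integral_const, probReal_univ, smul_eq_mul]
    ring
  simp only [h1]
  rw [lintegral_const_mul _ (by fun_prop), hcr _ (by positivity), h2]
  congr 1
  rw [Real.rpow_mul (norm_nonneg _), Real.rpow_ofNat]
  ring

theorem norm_cexp_sub_sq (a b : ℝ) :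
    ‖Complex.exp (a * Complex.I) - Complex.exp (b * Complex.I)‖ ^ 2 = 2 - 2 * Real.cos (a - b) := by
  rw [← Complex.normSq_eq_norm_sq, Complex.normSq_apply]
  simp only [Complex.sub_re, Complex.sub_im, Complex.exp_ofReal_mul_I_re,
    Complex.exp_ofReal_mul_I_im, Real.cos_sub]
  nlinarith [Real.sin_sq_add_cos_sq a, Real.sin_sq_add_cos_sq b]

theorem exists_hilbert_of_features {T X : Type} [MeasurableSpace X] (μ : Measure X) {f : T → X → ℂ}
    (hf : ∀ t, Measurable (f t)) (t₀ : T) (h0 : ∀ x, f t₀ x = 0) {D : T → T → ℝ}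
    (hD : ∀ s t, 0 ≤ D s t)
    (h : ∀ s t, ∫⁻ x, ENNReal.ofReal (‖f s x - f t x‖ ^ 2) ∂μ = ENNReal.ofReal (D s t)) :
    ∃ (H : Type) (_ : NormedAddCommGroup H) (_ : InnerProductSpace ℝ H) (_ : CompleteSpace H)
      (k : T → H), k t₀ = 0 ∧ ∀ s t, ‖k s - k t‖ ^ 2 = D s t := by
  have hL : ∀ t, MemLp (f t) 2 μ := fun t => by
    rw [memLp_two_iff_integrable_sq_norm (hf t).aestronglyMeasurable]
    refine ⟨((hf t).norm.pow_const 2).aestronglyMeasurable, ?_⟩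
    rw [hasFiniteIntegral_iff_ofReal (ae_of_all _ fun p => sq_nonneg _)]
    have := h t t₀
    simp only [h0, sub_zero] at this
    rw [this]
    exact ENNReal.ofReal_lt_top
  refine ⟨Lp ℂ 2 μ, inferInstance, inferInstance, inferInstance, fun t => (hL t).toLp _, ?_,
    fun s t => ?_⟩
  · dsimp only
    rw [Lp.eq_zero_iff_ae_eq_zero]
    exact (hL t₀).coeFn_toLp.trans (ae_of_all _ h0)
  · dsimp only
    rw [← MemLp.toLp_sub, ← real_inner_self_eq_norm_sq, L2.inner_def]
    have h1 : ∀ᵐ p ∂μ, inner ℝ (((hL s).sub (hL t)).toLp (f s - f t) p)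
        (((hL s).sub (hL t)).toLp (f s - f t) p) = ‖f s p - f t p‖ ^ 2 := by
      filter_upwards [((hL s).sub (hL t)).coeFn_toLp] with p hp
      rw [hp, real_inner_self_eq_norm_sq, Pi.sub_apply]
    have hm : Measurable fun p => ‖f s p - f t p‖ ^ 2 := ((hf s).sub (hf t)).norm.pow_const 2
    rw [integral_congr_ae h1, integral_eq_lintegral_of_nonneg_ae (ae_of_all _ fun p => sq_nonneg _)
      hm.aestronglyMeasurable, h, ENNReal.toReal_ofReal (hD s t)]

/-- The features are e^{i·phase} minus the same expression at t = 0, which is 1. The subtraction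
makes them square-integrable against the infinite measure and cancels in differences, so squared
distances are the integrals of 2 − 2cos. -/
theorem exists_hilbert_embedding_rpow {α : ℝ} (hα : 0 < α) (hα1 : α < 1) (d : ℕ) :
    ∃ (H : Type) (_ : NormedAddCommGroup H) (_ : InnerProductSpace ℝ H) (_ : CompleteSpace H)
      (k : Euc d → H), k 0 = 0 ∧ ∀ s t, ‖k s - k t‖ ^ 2 = ‖s - t‖ ^ (2 * α) := by
  obtain ⟨c, hc, hcd⟩ := exists_lintegral_phase hα hα1
  obtain ⟨H, h1, h2, h3, k, hk0, hk⟩ := exists_hilbert_of_features (scaleMeasure d)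
    (f := fun (t : Euc d) p =>
      Complex.exp (phase α t p * Complex.I) - Complex.exp (phase α 0 p * Complex.I))
    (fun t => by
      have h1 := measurable_phase α t
      have h2 := measurable_phase α (0 : Euc d)
      fun_prop) 0 (fun p => sub_self _) (D := fun s t => c * ‖s - t‖ ^ (2 * α))
    (fun s t => by positivity) (fun s t => by
      simp only [sub_sub_sub_cancel_right, norm_cexp_sub_sq, ← phase_sub]
      exact hcd d (s - t))
  refine ⟨H, h1, h2, h3, fun t => (√c)⁻¹ • k t, ?_, fun s t => ?_⟩
  · simp only [hk0, smul_zero]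
  · rw [← smul_sub, norm_smul, mul_pow, hk, norm_inv, Real.norm_of_nonneg (by positivity), inv_pow,
      Real.sq_sqrt hc.le]
    field_simp

/-- Fractional Brownian motion with variance 8‖t‖^{2α}; the tail correlation function is
erfc√(Var/8). -/
theorem radial_erfc_rpow_mem_tcfBR {α : ℝ} (hα : 0 < α) (hα1 : α < 1) (d : ℕ) :
    radial d (fun r => erfc ((r : ℝ) ^ α)) ∈ tcfBR d := by
  obtain ⟨H, _, _, _, k, hk0, hk⟩ := exists_hilbert_embedding_rpow hα hα1 d
  obtain ⟨S, _, Q, J, hQ, hJ⟩ := exists_isonormal H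
  have hk8 : ∀ s t : Euc d, ‖√8 • k s - √8 • k t‖ ^ 2 = 8 * ‖s - t‖ ^ (2 * α) := fun s t => by
    rw [← smul_sub, norm_smul, mul_pow, Real.norm_of_nonneg (by positivity),
      Real.sq_sqrt (by norm_num), hk]
  have hW := isAdmissibleGaussian_isonormal (d := d) (Q := Q) hJ (k := fun t => √8 • k t)
    (g := fun r => 8 * r ^ (2 * α)) (fun a ha b _ hab => by
      simp only [mem_Ici] at ha
      dsimp only
      gcongr) ((tendsto_rpow_atTop (by positivity)).const_mul_atTop (by norm_num)) hk8
  have h0 : J (√8 • k 0) =ᵐ[Q] 0 := by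
    rw [hk0, smul_zero, map_zero]; exact Lp.coeFn_zero _ _ _
  convert mem_tcfBR_of_admissible hW h0 using 1
  funext t
  rw [radial, variance_isonormal hJ]
  have := hk8 t 0
  rw [hk0, smul_zero, sub_zero, sub_zero] at this
  rw [this, mul_div_cancel_left₀ _ (by norm_num), mul_comm 2 α, Real.rpow_mul (norm_nonneg _),
    Real.rpow_ofNat, Real.sqrt_sq (by positivity)]
  rfl

/-! ### Cells of hyperplane mosaics -/

theorem norm_sphere {d : ℕ} (u : Metric.sphere (0 : Euc d) 1) : ‖(u : Euc d)‖ = 1 := by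
  simp

theorem continuous_side {d : ℕ} (h : HyperplaneParam d) : Continuous (side h) := by
  unfold side; fun_prop

theorem measurable_side {d : ℕ} :
    Measurable fun p : HyperplaneParam d × Euc d => side p.1 p.2 := by
  unfold side
  have h1 : Measurable fun p : HyperplaneParam d × Euc d => (p.1.1 : Euc d) :=
    measurable_subtype_coe.comp (measurable_fst.comp measurable_fst)
  fun_prop

theorem side_add {d : ℕ} (h : HyperplaneParam d) (x y : Euc d) :
    side h (x + y) = inner ℝ (h.1 : Euc d) y - (h.2 - inner ℝ (h.1 : Euc d) x) := by
  rw [side, inner_add_right]; ring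

/-- The hyperplanes that strictly separate `x` from `y`. -/
def separating {d : ℕ} (x y : Euc d) : Set (HyperplaneParam d) := {h | side h x * side h y < 0}

theorem mem_cellAt_iff {d : ℕ} {H : ℕ → HyperplaneParam d} {x y : Euc d} :
    y ∈ cellAt H x ↔ ∀ n, H n ∉ separating x y := by
  simp [cellAt, separating]

theorem isClosed_cellAt {d : ℕ} (H : ℕ → HyperplaneParam d) (x : Euc d) : IsClosed (cellAt H x) := by
  have : cellAt H x = ⋂ n, {y | 0 ≤ side (H n) x * side (H n) y} := by
    ext y; simp [cellAt]
  rw [this]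
  exact isClosed_iInter fun n =>
    isClosed_le continuous_const (continuous_const.mul (continuous_side _))

theorem convex_cellAt {d : ℕ} (H : ℕ → HyperplaneParam d) (x : Euc d) : Convex ℝ (cellAt H x) := by
  have : cellAt H x = ⋂ n, {y | side (H n) x * (H n).2 ≤
      inner ℝ (side (H n) x • ((H n).1 : Euc d)) y} := by
    ext y
    simp only [cellAt, mem_ofPred_eq, mem_iInter]
    refine forall_congr' fun n => ?_
    rw [real_inner_smul_left, side.eq_1 (H n) y, mul_sub, sub_nonneg]
  rw [this]
  exact convex_iInter fun n => convex_halfSpace_ge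
    ⟨fun y z => inner_add_right _ _ _, fun c y => by rw [inner_smul_right, smul_eq_mul]⟩ _

theorem self_mem_cellAt {d : ℕ} (H : ℕ → HyperplaneParam d) (x : Euc d) : x ∈ cellAt H x :=
  fun _ => mul_self_nonneg _

/-- The points that lie on none of the hyperplanes. -/
def offSet {d : ℕ} (H : ℕ → HyperplaneParam d) : Set (Euc d) := {x | ∀ n, side (H n) x ≠ 0}

theorem ae_mem_offSet {d : ℕ} (H : ℕ → HyperplaneParam d) : ∀ᵐ x : Euc d, x ∈ offSet H := by
  refine ae_all_iff.2 fun n => ?_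
  have hu : ((H n).1 : Euc d) ≠ 0 := by
    rw [← norm_pos_iff, norm_sphere]; exact one_pos
  rw [ae_iff]
  refine measure_mono_null (fun x hx => ?_) (volume_hyperplane hu (H n).2)
  simpa [side, sub_eq_zero] using hx

theorem cellAt_eq_of_mem {d : ℕ} {H : ℕ → HyperplaneParam d} {x y : Euc d} (hx : x ∈ offSet H)
    (hy : y ∈ offSet H) (h : y ∈ cellAt H x) : cellAt H y = cellAt H x := by
  ext z
  refine forall_congr' fun n => ?_
  have h1 : 0 < side (H n) x * side (H n) y :=
    lt_of_le_of_ne (h n) (mul_ne_zero (hx n) (hy n)).symm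
  rcases pos_and_pos_or_neg_and_neg_of_mul_pos h1 with ⟨a, b⟩ | ⟨a, b⟩
  · rw [mul_nonneg_iff_of_pos_left a, mul_nonneg_iff_of_pos_left b]
  · rw [← neg_mul_neg, ← neg_mul_neg (side (H n) x), mul_nonneg_iff_of_pos_left (neg_pos.2 a),
      mul_nonneg_iff_of_pos_left (neg_pos.2 b)]

/-- A family of hyperplanes is regular if it is locally finite and its normals and distances
are so rich that all cells are bounded. -/
structure IsRegularFamily {d : ℕ} (H : ℕ → HyperplaneParam d) : Prop where
  finite : ∀ R : ℕ, {n | |(H n).2| ≤ R}.Finite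
  rich : ∀ (s : Finset (Fin d)) (M : ℕ), ∃ n,
    (∀ i, 0 < (if i ∈ s then 1 else -1) * ((H n).1 : Euc d) i) ∧ (M : ℝ) < (H n).2

theorem isBounded_setOf_abs_le {d : ℕ} (B : Fin d → ℝ) :
    Bornology.IsBounded {y : Euc d | ∀ i, |y i| ≤ B i} := by
  rw [isBounded_iff_forall_norm_le]
  refine ⟨√(∑ i, B i ^ 2), fun y hy => ?_⟩
  rw [EuclideanSpace.norm_eq]
  refine Real.sqrt_le_sqrt (Finset.sum_le_sum fun i _ => ?_)
  have := hy i
  rw [Real.norm_eq_abs]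
  gcongr

/-- For each sign pattern there is a hyperplane with normal in that open orthant and distance larger
than ‖x‖. It keeps x on the side of the origin and cuts the orthant down to a bounded simplex, and
there are finitely many orthants. -/
theorem IsRegularFamily.isBounded_cellAt {d : ℕ} {H : ℕ → HyperplaneParam d}
    (hH : IsRegularFamily H) (x : Euc d) : Bornology.IsBounded (cellAt H x) := by
  obtain ⟨M, hM⟩ := exists_nat_ge ‖x‖
  choose n hn hnM using fun s => hH.rich s M
  let e : Finset (Fin d) → Fin d → ℝ := fun s i => if i ∈ s then 1 else -1
  let B : Finset (Fin d) → Set (Euc d) := fun s =>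
    {y | ∀ i, |y i| ≤ (H (n s)).2 / (e s i * ((H (n s)).1 : Euc d) i)}
  refine ((Bornology.isBounded_iUnion (s := B)).2 fun s => isBounded_setOf_abs_le _).subset ?_
  intro y hy
  classical
  let s : Finset (Fin d) := Finset.univ.filter fun i => 0 ≤ y i
  refine mem_iUnion.2 ⟨s, fun i => ?_⟩
  have habs : ∀ j, e s j * y j = |y j| := fun j => by
    by_cases hj : 0 ≤ y j
    · simp [e, s, hj, abs_of_nonneg hj]
    · simp [e, s, hj, abs_of_neg (not_le.1 hj)]
  have hsq : ∀ j, e s j * e s j = 1 := fun j => by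
    by_cases hj : j ∈ s <;> simp [e, hj]
  have hin : ∀ z : Euc d, inner ℝ ((H (n s)).1 : Euc d) z = ∑ j, ((H (n s)).1 : Euc d) j * z j :=
    fun z => by simp [PiLp.inner_apply, mul_comm]
  have hx : side (H (n s)) x < 0 := by
    have h1 := real_inner_le_norm ((H (n s)).1 : Euc d) x
    rw [norm_sphere, one_mul] at h1
    have h2 := hnM s
    rw [side]
    linarith
  have hy' : side (H (n s)) y ≤ 0 := by
    have := hy (n s)
    exact nonpos_of_mul_nonneg_right this hx
  have hle : ∑ j, (e s j * ((H (n s)).1 : Euc d) j) * |y j| ≤ (H (n s)).2 := by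
    rw [side, hin] at hy'
    refine le_trans (le_of_eq (Finset.sum_congr rfl fun j _ => ?_)) (sub_nonpos.1 hy')
    rw [← habs]
    linear_combination ((H (n s)).1 : Euc d) j * y j * hsq j
  rw [le_div_iff₀ (hn s i), mul_comm]
  refine le_trans ?_ hle
  exact Finset.single_le_sum (f := fun j => e s j * ((H (n s)).1 : Euc d) j * |y j|)
    (fun j _ => mul_nonneg (hn s j).le (abs_nonneg _)) (Finset.mem_univ i)

theorem side_mul_pos_of_lt {d : ℕ} {h : HyperplaneParam d} {x y : Euc d} {R : ℝ} (hR : R < |h.2|)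
    (hx : ‖x‖ ≤ R) (hy : ‖y‖ ≤ R) : 0 < side h x * side h y := by
  have key : ∀ z : Euc d, ‖z‖ ≤ R → |inner ℝ (h.1 : Euc d) z| ≤ R := fun z hz => by
    have := abs_real_inner_le_norm (h.1 : Euc d) z
    rw [norm_sphere, one_mul] at this
    exact this.trans hz
  have h1 := abs_le.1 (key x hx)
  have h2 := abs_le.1 (key y hy)
  rcases lt_abs.1 hR with h3 | h3
  · exact mul_pos_of_neg_of_neg (by rw [side]; linarith) (by rw [side]; linarith)
  · exact mul_pos (by rw [side]; linarith) (by rw [side]; linarith)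

/-- Only the finitely many hyperplanes meeting a ball around the origin can bound the cell near x,
and x lies strictly off each of them. -/
theorem IsRegularFamily.cellAt_mem_nhds {d : ℕ} {H : ℕ → HyperplaneParam d}
    (hH : IsRegularFamily H) {x : Euc d} (hx : x ∈ offSet H) : cellAt H x ∈ 𝓝 x := by
  obtain ⟨R, hR⟩ := exists_nat_ge (‖x‖ + 1)
  have h1 : ∀ᶠ y in 𝓝 x, ∀ n ∈ {n | |(H n).2| ≤ R}, 0 < side (H n) x * side (H n) y := by
    rw [eventually_all_finite (hH.finite R)]
    intro n _
    refine (continuous_const.mul (continuous_side (H n))).continuousAt.eventually_const_lt ?_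
    exact mul_self_pos.2 (hx n)
  filter_upwards [h1, Metric.ball_mem_nhds x one_pos] with y hy hy1
  intro n
  by_cases hn : |(H n).2| ≤ R
  · exact (hy n hn).le
  · refine (side_mul_pos_of_lt (not_le.1 hn) (by linarith) ?_).le
    have : ‖y - x‖ < 1 := by simpa [dist_eq_norm] using hy1
    have h2 : ‖y‖ ≤ ‖x‖ + ‖y - x‖ := by simpa using norm_add_le x (y - x)
    linarith

theorem IsRegularFamily.isCompact_cellAt {d : ℕ} {H : ℕ → HyperplaneParam d}
    (hH : IsRegularFamily H) (x : Euc d) : IsCompact (cellAt H x) :=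
  Metric.isCompact_of_isClosed_isBounded (isClosed_cellAt H x) (hH.isBounded_cellAt x)

/-! ### Convex bodies and their traces on a countable dense set -/

/-- The closure of the part of the dense sequence that is selected by `D`. -/
def traceClosure {d : ℕ} (D : Set ℕ) : Set (Euc d) := closure (TopologicalSpace.denseSeq (Euc d) '' D)

theorem isClosed_traceClosure {d : ℕ} (D : Set ℕ) : IsClosed (traceClosure D : Set (Euc d)) :=
  isClosed_closure

theorem mem_traceClosure_iff {d : ℕ} {D : Set ℕ} {y : Euc d} : y ∈ traceClosure D ↔
    ∀ k : ℕ, ∃ i, i ∈ D ∧ dist y (TopologicalSpace.denseSeq (Euc d) i) < ((k : ℝ) + 1)⁻¹ := by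
  rw [traceClosure, Metric.mem_closure_iff]
  constructor
  · intro h k
    obtain ⟨_, ⟨i, hi, rfl⟩, h2⟩ := h ((k : ℝ) + 1)⁻¹ (by positivity)
    exact ⟨i, hi, h2⟩
  · intro h ε hε
    obtain ⟨k, hk⟩ := exists_nat_one_div_lt hε
    obtain ⟨i, hi, h2⟩ := h k
    exact ⟨_, ⟨i, hi, rfl⟩, h2.trans (by rwa [one_div] at hk)⟩

/-- Subsets of ℕ code the cells, so that membership, volume and centre become measurable functions
of countably many events. -/
theorem measurableSet_mem_traceClosure {d : ℕ} :
    MeasurableSet {p : Set ℕ × Euc d | p.2 ∈ traceClosure p.1} := by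
  have : {p : Set ℕ × Euc d | p.2 ∈ traceClosure p.1} = ⋂ k : ℕ, ⋃ i : ℕ,
      ({p : Set ℕ × Euc d | i ∈ p.1} ∩
        {p | dist p.2 (TopologicalSpace.denseSeq (Euc d) i) < ((k : ℝ) + 1)⁻¹}) := by
    ext p
    simp only [mem_ofPred_eq, mem_traceClosure_iff, mem_iInter, mem_iUnion, mem_inter_iff]
  rw [this]
  refine MeasurableSet.iInter fun k => MeasurableSet.iUnion fun i => MeasurableSet.inter ?_ ?_
  · exact (measurableSet_mem i).preimage measurable_fst
  · exact measurableSet_lt (by fun_prop) measurable_const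

/-- Such a convex set is the closure of its interior, and the dense sequence is dense in that
interior. -/
theorem traceClosure_eq {d : ℕ} {K : Set (Euc d)} (hc : IsClosed K) (hK : Convex ℝ K)
    (hi : (interior K).Nonempty) :
    traceClosure {i | TopologicalSpace.denseSeq (Euc d) i ∈ K} = K := by
  refine Subset.antisymm (closure_minimal ?_ hc) ?_
  · rintro _ ⟨i, hi, rfl⟩
    exact hi
  · have hcl : closure (interior K) = K := by
      rw [hK.closure_interior_eq_closure_of_nonempty_interior hi, hc.closure_eq]
    nth_rw 1 [← hcl]
    refine closure_minimal ?_ isClosed_closure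
    refine ((TopologicalSpace.denseRange_denseSeq (Euc d)).open_subset_closure_inter
      isOpen_interior).trans (closure_mono ?_)
    rintro _ ⟨h1, ⟨i, rfl⟩⟩
    have h2 : TopologicalSpace.denseSeq (Euc d) i ∈ K := interior_subset h1
    exact ⟨i, h2, rfl⟩

theorem measurable_volume_traceClosure {d : ℕ} :
    Measurable fun D : Set ℕ => volume (traceClosure D : Set (Euc d)) :=
  measurable_measure_prodMk_left measurableSet_mem_traceClosure

theorem measurable_cellCentre_traceClosure {d : ℕ} :
    Measurable fun D : Set ℕ => cellCentre (traceClosure D : Set (Euc d)) := by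
  have h1 : StronglyMeasurable fun D : Set ℕ => ∫ y : Euc d,
      {p : Set ℕ × Euc d | p.2 ∈ traceClosure p.1}.indicator (fun p => p.2) (D, y) :=
    StronglyMeasurable.integral_prod_right'
      (Measurable.indicator measurable_snd measurableSet_mem_traceClosure).stronglyMeasurable
  have h2 : (fun D : Set ℕ => cellCentre (traceClosure D : Set (Euc d))) = fun D =>
      (volume (traceClosure D : Set (Euc d))).toReal⁻¹ • ∫ y : Euc d,
        {p : Set ℕ × Euc d | p.2 ∈ traceClosure p.1}.indicator (fun p => p.2) (D, y) := by
    funext D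
    rw [cellCentre, setAverage_eq, measureReal_def,
      ← integral_indicator (isClosed_traceClosure D).measurableSet]
    rfl
  rw [h2]
  exact measurable_volume_traceClosure.ennreal_toReal.inv.smul h1.measurable

theorem measurableSet_mem_centredCell_traceClosure {d : ℕ} :
    MeasurableSet {p : Set ℕ × Euc d | p.2 ∈ centredCell (traceClosure p.1)} := by
  have : Measurable fun p : Set ℕ × Euc d => (p.1, p.2 + cellCentre (traceClosure p.1)) :=
    measurable_fst.prodMk
      (measurable_snd.add (measurable_cellCentre_traceClosure.comp measurable_fst))
  exact measurableSet_mem_traceClosure.preimage this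

theorem measurable_centredCell_traceClosure {d : ℕ} :
    Measurable fun D : Set ℕ => centredCell (traceClosure D : Set (Euc d)) := by
  refine measurable_set_iff.2 fun y => measurableSet_setOfPred.1 ?_
  exact measurableSet_mem_centredCell_traceClosure.preimage
    (measurable_id.prodMk measurable_const)

theorem cellCentre_translate {d : ℕ} {K : Set (Euc d)} (hK : IsCompact K) (h0 : volume K ≠ 0)
    (x : Euc d) : cellCentre {y | x + y ∈ K} = cellCentre K - x := by
  have hmp : MeasurePreserving (fun y : Euc d => x + y) volume volume :=
    measurePreserving_add_left volume x
  have hme : MeasurableEmbedding (fun y : Euc d => x + y) := measurableEmbedding_addLeft x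
  have hr : volume.real K ≠ 0 := (ENNReal.toReal_pos h0 hK.measure_lt_top.ne).ne'
  have hv : volume.real {y : Euc d | x + y ∈ K} = volume.real K := by
    rw [measureReal_def, measureReal_def]
    congr 1
    exact hmp.measure_preimage hK.measurableSet.nullMeasurableSet
  have hint : IntegrableOn (fun y : Euc d => y) K := continuous_id.continuousOn.integrableOn_compact hK
  have h1 : ∫ y in {y : Euc d | x + y ∈ K}, y = ∫ y in K, (y - x) := by
    have := hmp.setIntegral_preimage_emb hme (fun y => y - x) K
    rw [← this]
    simp only [add_sub_cancel_left]
    rfl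
  rw [cellCentre, cellCentre, setAverage_eq, setAverage_eq, hv, h1,
    integral_sub hint (integrableOn_const hK.measure_lt_top.ne), smul_sub, setIntegral_const,
    smul_smul, inv_mul_cancel₀ hr, one_smul]

theorem centredCell_translate {d : ℕ} {K : Set (Euc d)} (hK : IsCompact K) (h0 : volume K ≠ 0)
    (x : Euc d) : centredCell {y | x + y ∈ K} = centredCell K := by
  ext y
  simp only [centredCell, mem_ofPred_eq, cellCentre_translate hK h0]
  rw [show x + (y + (cellCentre K - x)) = y + cellCentre K by abel]

theorem cellCentre_mem {d : ℕ} {K : Set (Euc d)} (hK : IsCompact K) (hc : Convex ℝ K)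
    (h0 : volume K ≠ 0) : cellCentre K ∈ K :=
  hc.set_average_mem hK.isClosed h0 hK.measure_lt_top.ne
    (ae_restrict_mem hK.measurableSet) (continuous_id.continuousOn.integrableOn_compact hK)

/-! ### The intensity measure of the hyperplane process -/

theorem isProbabilityMeasure_sphereUniform {d : ℕ} (hd : 1 ≤ d) :
    IsProbabilityMeasure (sphereUniform d) := by
  have : Nonempty (Fin d) := ⟨⟨0, hd⟩⟩
  have : Nontrivial (Euc d) := inferInstance
  refine ⟨?_⟩
  rw [sphereUniform, Measure.smul_apply, smul_eq_mul, ENNReal.inv_mul_cancel]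
  · exact Measure.measure_univ_ne_zero.2 (Measure.toSphere_ne_zero _)
  · exact measure_ne_top _ _

instance isFiniteMeasure_sphereUniform (d : ℕ) : IsFiniteMeasure (sphereUniform d) := by
  rcases Nat.eq_zero_or_pos d with rfl | hd
  · have : IsEmpty (Metric.sphere (0 : Euc 0) 1) := by
      refine ⟨fun u => ?_⟩
      have h1 := norm_sphere u
      rw [Subsingleton.elim (u : Euc 0) 0, norm_zero] at h1
      exact zero_ne_one h1
    exact ⟨by rw [univ_eq_empty_iff.2 this]; simp⟩
  · have := isProbabilityMeasure_sphereUniform hd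
    infer_instance

/-- Translation keeps the normal u and shifts the distance by ⟨u,x⟩, so it preserves Lebesgue
measure on each fibre. -/
theorem measurePreserving_hyperplane_translate {d : ℕ} (x : Euc d) :
    MeasurePreserving (fun h : HyperplaneParam d => ((h.1, h.2 - inner ℝ (h.1 : Euc d) x) :
      HyperplaneParam d)) (hyperplaneIntensity d) (hyperplaneIntensity d) := by
  refine (MeasurePreserving.id (sphereUniform d)).skew_product
    (g := fun u r => r - inner ℝ (u : Euc d) x) ?_ (ae_of_all _ fun u => ?_)
  · have h1 : Measurable fun p : HyperplaneParam d => (p.1 : Euc d) :=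
      measurable_subtype_coe.comp measurable_fst
    exact measurable_snd.sub (h1.inner measurable_const)
  · exact (measurePreserving_sub_right volume _).map_eq

theorem measurableSet_separating {d : ℕ} (x y : Euc d) : MeasurableSet (separating x y) := by
  have h : ∀ z : Euc d, Measurable fun h : HyperplaneParam d => side h z := fun z =>
    measurable_side.comp (measurable_id.prodMk measurable_const)
  exact measurableSet_lt ((h x).mul (h y)) measurable_const

theorem separating_translate {d : ℕ} (x a b : Euc d) : separating (x + a) (x + b) =
    (fun h : HyperplaneParam d => ((h.1, h.2 - inner ℝ (h.1 : Euc d) x) : HyperplaneParam d)) ⁻¹'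
      separating a b := by
  ext h
  simp only [separating, mem_ofPred_eq, mem_preimage, side_add]
  rfl

theorem volume_setOf_neg_mul_sub (a : ℝ) : volume {r : ℝ | -r * (a - r) < 0} = ENNReal.ofReal |a| := by
  rcases le_total 0 a with h | h
  · have : {r : ℝ | -r * (a - r) < 0} = Ioo 0 a := by
      ext r
      simp only [mem_ofPred_eq, mem_Ioo]
      constructor
      · intro hr
        constructor <;> by_contra hc <;> nlinarith
      · rintro ⟨h1, h2⟩; nlinarith [mul_pos h1 (sub_pos.2 h2)]
    rw [this, Real.volume_Ioo, sub_zero, abs_of_nonneg h]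
  · have : {r : ℝ | -r * (a - r) < 0} = Ioo a 0 := by
      ext r
      simp only [mem_ofPred_eq, mem_Ioo]
      constructor
      · intro hr
        constructor <;> by_contra hc <;> nlinarith
      · rintro ⟨h1, h2⟩; nlinarith [mul_pos (sub_pos.2 h1) (neg_pos.2 h2)]
    rw [this, Real.volume_Ioo, zero_sub, abs_of_nonpos h]

theorem hyperplaneIntensity_separating_zero {d : ℕ} (t : Euc d) :
    hyperplaneIntensity d (separating 0 t)
      = ∫⁻ u, ENNReal.ofReal |inner ℝ (u : Euc d) t| ∂(sphereUniform d) := by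
  rw [hyperplaneIntensity, Measure.prod_apply (measurableSet_separating 0 t)]
  refine lintegral_congr fun u => ?_
  rw [← volume_setOf_neg_mul_sub]
  congr 1
  ext r
  simp [separating, side]

theorem hyperplaneIntensity_separating_ne_top {d : ℕ} (x y : Euc d) :
    hyperplaneIntensity d (separating x y) ≠ ∞ := by
  have h1 := separating_translate x 0 (y - x)
  rw [add_zero, add_sub_cancel] at h1
  rw [h1, (measurePreserving_hyperplane_translate x).measure_preimage
    (measurableSet_separating _ _).nullMeasurableSet, hyperplaneIntensity_separating_zero]
  refine ne_top_of_le_ne_top (b := ∫⁻ _ : Metric.sphere (0 : Euc d) 1, ENNReal.ofReal ‖y - x‖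
    ∂(sphereUniform d)) ?_ (lintegral_mono fun u => ENNReal.ofReal_le_ofReal ?_)
  · rw [lintegral_const]
    exact ENNReal.mul_ne_top ENNReal.ofReal_ne_top (measure_ne_top _ _)
  · have := abs_real_inner_le_norm (u : Euc d) (y - x)
    rwa [norm_sphere, one_mul] at this

/-! ### Rotation invariance -/

-- The intensity is the mean of |⟨u,t⟩|. Reflections exchange vectors of equal norm and preserve the
-- uniform distribution, and the mean is homogeneous in t. The constant is never evaluated, as the
-- law of Λ absorbs it.
open scoped Pointwise in
theorem exists_hyperplaneIntensity_separating_zero {d : ℕ} (hd : 1 ≤ d) :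
    ∃ c : ℝ, 0 < c ∧ ∀ t : Euc d,
      hyperplaneIntensity d (separating 0 t) = ENNReal.ofReal (c * ‖t‖) := by
  have hprob := isProbabilityMeasure_sphereUniform hd
  have hne : Nonempty (Fin d) := ⟨⟨0, hd⟩⟩
  let g : Euc d → ℝ≥0∞ := fun t => ∫⁻ u, ENNReal.ofReal |inner ℝ (u : Euc d) t| ∂(sphereUniform d)
  have hmu : ∀ t : Euc d, Measurable fun u : Metric.sphere (0 : Euc d) 1 =>
      ENNReal.ofReal |inner ℝ (u : Euc d) t| := fun t => by
    have h1 : Measurable fun p : Metric.sphere (0 : Euc d) 1 => (p : Euc d) :=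
      measurable_subtype_coe
    fun_prop
  have hrot : ∀ (A : Euc d ≃ₗᵢ[ℝ] Euc d) t, g (A t) = g t := by
    intro A t
    let B : Metric.sphere (0 : Euc d) 1 → Metric.sphere (0 : Euc d) 1 := fun u =>
      ⟨A u, by simp⟩
    have hB : Measurable B := (A.continuous.measurable.comp measurable_subtype_coe).subtype_mk
    have hmap : (sphereUniform d).map B = sphereUniform d := by
      rw [sphereUniform, Measure.map_smul]
      congr 1
      ext s hs
      rw [Measure.map_apply hB hs, Measure.toSphere_apply' _ (hB hs), Measure.toSphere_apply' _ hs]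
      congr 1
      have heq : Ioo (0 : ℝ) 1 • (((↑) : Metric.sphere (0 : Euc d) 1 → Euc d) '' (B ⁻¹' s))
          = A ⁻¹' (Ioo (0 : ℝ) 1 • (((↑) : Metric.sphere (0 : Euc d) 1 → Euc d) '' s)) := by
        ext x
        constructor
        · rintro ⟨r, hr, _, ⟨v, hv, rfl⟩, rfl⟩
          exact ⟨r, hr, _, ⟨B v, hv, rfl⟩, (A.map_smul r v).symm⟩
        · rintro ⟨r, hr, _, ⟨v, hv, rfl⟩, hx⟩
          have hx : r • (v : Euc d) = A x := hx
          refine ⟨r, hr, _, ⟨⟨A.symm v, by simp⟩, ?_, rfl⟩, ?_⟩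
          · have : B ⟨A.symm v, by simp⟩ = v := by ext1; simp [B]
            rw [mem_preimage, this]; exact hv
          · change r • A.symm (v : Euc d) = x
            rw [← A.symm.map_smul, hx, A.symm_apply_apply]
      rw [heq, A.measurePreserving.measure_preimage_emb A.toHomeomorph.measurableEmbedding]
    change ∫⁻ u, _ ∂_ = ∫⁻ u, _ ∂_
    nth_rw 1 [← hmap]
    rw [lintegral_map (hmu _) hB]
    refine lintegral_congr fun u => ?_
    rw [show ((B u : Metric.sphere (0 : Euc d) 1) : Euc d) = A u from rfl, A.inner_map_map]
  have hnorm : ∀ s t : Euc d, ‖s‖ = ‖t‖ → g s = g t := fun s t h => by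
    rw [← Submodule.reflection_sub h]
    exact (hrot _ _).symm
  let e : Euc d := EuclideanSpace.single ⟨0, hd⟩ 1
  have he : ‖e‖ = 1 := by simp [e]
  have hfin : g e ≠ ∞ := by
    have := hyperplaneIntensity_separating_ne_top 0 e
    rwa [hyperplaneIntensity_separating_zero] at this
  have hsmul : ∀ t : Euc d, g t = ENNReal.ofReal ‖t‖ * g e := fun t => by
    rw [hnorm t (‖t‖ • e) (by simp [norm_smul, he]), ← lintegral_const_mul _ (hmu e)]
    refine lintegral_congr fun u => ?_
    rw [inner_smul_right, abs_mul, abs_norm, ENNReal.ofReal_mul (norm_nonneg _)]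
  have hpos : g e ≠ 0 := fun h0 => by
    rw [lintegral_eq_zero_iff (hmu e)] at h0
    let V : Set (Metric.sphere (0 : Euc d) 1) := {u | inner ℝ (u : Euc d) e ≠ 0}
    have hV : IsOpen V := isOpen_ne_fun (by fun_prop) continuous_const
    have hVn : V.Nonempty := ⟨⟨e, by simp [he]⟩, by
      simp only [V, mem_ofPred_eq, real_inner_self_eq_norm_sq, he]; norm_num⟩
    have hV0 : sphereUniform d V = 0 := by
      refine measure_mono_null (fun u hu => ?_) (ae_iff.1 h0)
      have : 0 < |inner ℝ (u : Euc d) e| := abs_pos.2 hu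
      simpa using this
    rw [sphereUniform, Measure.smul_apply, smul_eq_mul, mul_eq_zero] at hV0
    rcases hV0 with h | h
    · exact measure_ne_top _ _ (ENNReal.inv_eq_zero.1 h)
    · exact (hV.measure_pos _ hVn).ne' h
  refine ⟨(g e).toReal, ENNReal.toReal_pos hpos hfin, fun t => ?_⟩
  rw [hyperplaneIntensity_separating_zero, mul_comm, ENNReal.ofReal_mul (norm_nonneg _),
    ENNReal.ofReal_toReal hfin]
  exact hsmul t

/-! ### Almost sure properties of the hyperplane process -/

theorem pointCount_eq_encard {Ω S : Type*} (Φ : ℕ → Ω → S) (A : Set S) (ω : Ω) :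
    pointCount Φ A ω = (({n | Φ n ω ∈ A}.encard : ℕ∞) : ℝ≥0∞) := by
  rw [← ENNReal.tsum_set_one, tsum_subtype {n | Φ n ω ∈ A} fun _ => (1 : ℝ≥0∞)]
  rfl

theorem IsPoissonProcess.ae_finite {Ω S : Type*} [MeasurableSpace Ω] [MeasurableSpace S]
    {Φ : ℕ → Ω → S} {μ : Measure S} {P : Measure Ω} (h : IsPoissonProcess Φ μ P) {A : Set S}
    (hA : MeasurableSet A) (hfin : μ A ≠ ∞) : ∀ᵐ ω ∂P, {n | Φ n ω ∈ A}.Finite := by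
  have h1 : P (pointCount Φ A ⁻¹' {∞}) = 0 := by
    rw [← Measure.map_apply (h.measurable_pointCount hA) (measurableSet_singleton _),
      h.count_law A hA hfin, Measure.map_apply (by fun_prop) (measurableSet_singleton _)]
    convert measure_empty (μ := poissonMeasure (μ A).toNNReal) using 2
    ext k
    simp
  rw [ae_iff]
  refine measure_mono_null (fun ω hω => ?_) h1
  simp only [mem_preimage, mem_singleton_iff, pointCount_eq_encard]
  have : {n | Φ n ω ∈ A}.encard = ⊤ := Set.encard_eq_top_iff.2 hω
  rw [this]
  rfl

theorem IsPoissonProcess.ae_notMem {Ω S : Type*} [MeasurableSpace Ω] [MeasurableSpace S]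
    {Φ : ℕ → Ω → S} {μ : Measure S} {P : Measure Ω} [IsProbabilityMeasure P]
    (h : IsPoissonProcess Φ μ P) {A : Set S} (hA : MeasurableSet A) (h0 : μ A = 0) :
    ∀ᵐ ω ∂P, ∀ n, Φ n ω ∉ A := by
  have h1 := h.measure_void hA (by simp [h0])
  rw [h0] at h1
  simp only [ENNReal.toReal_zero, neg_zero, Real.exp_zero, ENNReal.ofReal_one] at h1
  have hm : MeasurableSet {ω | ∀ n, Φ n ω ∉ A} := by
    rw [ofPred_forall]
    exact MeasurableSet.iInter fun n => (h.measurable n hA).compl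
  exact (prob_compl_eq_zero_iff hm).2 h1

theorem IsPoissonProcess.ae_exists_mem {Ω S : Type*} [MeasurableSpace Ω] [MeasurableSpace S]
    {Φ : ℕ → Ω → S} {μ : Measure S} {P : Measure Ω} (h : IsPoissonProcess Φ μ P) {A : ℕ → Set S}
    (hA : ∀ k, MeasurableSet (A k)) (hfin : ∀ k, μ (A k) ≠ ∞)
    (hlim : Tendsto (fun k => (μ (A k)).toReal) atTop atTop) :
    ∀ᵐ ω ∂P, ∃ n, Φ n ω ∈ ⋃ k, A k := by
  rw [ae_iff]
  have hle : ∀ k, P {ω | ¬ ∃ n, Φ n ω ∈ ⋃ k, A k} ≤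
      ENNReal.ofReal (Real.exp (-(μ (A k)).toReal)) := fun k => by
    rw [← h.measure_void (hA k) (hfin k)]
    refine measure_mono fun ω hω n hn => hω ⟨n, mem_iUnion.2 ⟨k, hn⟩⟩
  have hl : Tendsto (fun k => ENNReal.ofReal (Real.exp (-(μ (A k)).toReal))) atTop (𝓝 0) := by
    rw [← ENNReal.ofReal_zero]
    exact ENNReal.tendsto_ofReal
      (Real.tendsto_exp_atBot.comp (tendsto_neg_atTop_atBot.comp hlim))
  exact le_antisymm (ge_of_tendsto' hl hle) bot_le

section hyperplanes

variable {d : ℕ} {Ω : Type} [MeasurableSpace Ω] {P : Measure Ω} {Φ : ℕ → Ω → HyperplaneParam d}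

theorem hyperplaneIntensity_abs_le (hd : 1 ≤ d) (R : ℝ) :
    hyperplaneIntensity d {h | |h.2| ≤ R} = ENNReal.ofReal (2 * R) := by
  have := isProbabilityMeasure_sphereUniform hd
  have e : {h : HyperplaneParam d | |h.2| ≤ R} = univ ×ˢ Icc (-R) R := by
    ext h; simp [abs_le]
  rw [e, hyperplaneIntensity, Measure.prod_prod, measure_univ, one_mul, Real.volume_Icc]
  congr 1
  ring

theorem measurableSet_abs_le (R : ℝ) : MeasurableSet {h : HyperplaneParam d | |h.2| ≤ R} :=
  measurableSet_le (by fun_prop) measurable_const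

/-- The unit vectors whose coordinates have the signs prescribed by `s`. -/
def orthant (s : Finset (Fin d)) : Set (Metric.sphere (0 : Euc d) 1) :=
  {u | ∀ i, 0 < (if i ∈ s then 1 else -1) * (u : Euc d) i}

theorem isOpen_orthant (s : Finset (Fin d)) : IsOpen (orthant s) := by
  have : orthant s = ⋂ i, {u : Metric.sphere (0 : Euc d) 1 |
      0 < (if i ∈ s then 1 else -1) * (u : Euc d) i} := by
    ext; simp [orthant]
  rw [this]
  exact isOpen_iInter_of_finite fun i => isOpen_lt continuous_const (by fun_prop)

theorem sphereUniform_orthant_pos (hd : 1 ≤ d) (s : Finset (Fin d)) :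
    0 < sphereUniform d (orthant s) := by
  have hne : Nonempty (Fin d) := ⟨⟨0, hd⟩⟩
  let e : Euc d := WithLp.toLp 2 fun i => if i ∈ s then 1 else -1
  have hepos : 0 < ‖e‖ := by
    rw [norm_pos_iff]
    intro h0
    have h1 : e ⟨0, hd⟩ = 0 := by rw [h0]; rfl
    by_cases h2 : (⟨0, hd⟩ : Fin d) ∈ s <;> simp [e, h2] at h1
  have hVn : (orthant s).Nonempty := by
    refine ⟨⟨‖e‖⁻¹ • e, by simp [norm_smul, hepos.ne']⟩, fun i => ?_⟩
    have h3 : (if i ∈ s then (1 : ℝ) else -1) * e i = 1 := by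
      by_cases h2 : i ∈ s <;> simp [e, h2]
    simp only [PiLp.smul_apply, smul_eq_mul]
    rw [mul_left_comm, h3, mul_one]
    positivity
  rw [sphereUniform, Measure.smul_apply, smul_eq_mul]
  exact ENNReal.mul_pos (ENNReal.inv_ne_zero.2 (measure_ne_top _ _)) ((isOpen_orthant s).measure_pos _ hVn).ne'

/-- A slab |r| ≤ R has finite intensity. An open orthant of normals combined with distances in (M, M
+ k] has intensity growing without bound in k, so it is almost surely hit for some k. -/
theorem IsPoissonProcess.ae_isRegularFamily (hd : 1 ≤ d)
    (hΦ : IsPoissonProcess Φ (hyperplaneIntensity d) P) :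
    ∀ᵐ ω ∂P, IsRegularFamily fun n => Φ n ω := by
  have h1 : ∀ᵐ ω ∂P, ∀ R : ℕ, {n | |(Φ n ω).2| ≤ R}.Finite := by
    rw [ae_all_iff]
    intro R
    exact hΦ.ae_finite (measurableSet_abs_le (R : ℝ))
      (by rw [hyperplaneIntensity_abs_le hd]; exact ENNReal.ofReal_ne_top)
  have h2 : ∀ᵐ ω ∂P, ∀ (s : Finset (Fin d)) (M : ℕ), ∃ n,
      (∀ i, 0 < (if i ∈ s then 1 else -1) * ((Φ n ω).1 : Euc d) i) ∧ (M : ℝ) < (Φ n ω).2 := by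
    rw [ae_all_iff]
    intro s
    rw [ae_all_iff]
    intro M
    let U : Set (Metric.sphere (0 : Euc d) 1) := orthant s
    have hU : MeasurableSet U := (isOpen_orthant s).measurableSet
    have hμ : ∀ k : ℕ, hyperplaneIntensity d (U ×ˢ Ioc (M : ℝ) (M + k))
        = sphereUniform d U * ENNReal.ofReal k := fun k => by
      rw [hyperplaneIntensity, Measure.prod_prod, Real.volume_Ioc, add_sub_cancel_left]
    have := hΦ.ae_exists_mem (A := fun k : ℕ => U ×ˢ Ioc (M : ℝ) (M + k))
      (fun k => hU.prod measurableSet_Ioc)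
      (fun k => by
        rw [hμ]
        exact ENNReal.mul_ne_top (measure_ne_top _ _) ENNReal.ofReal_ne_top)
      (by
        have hpos : 0 < (sphereUniform d U).toReal :=
          ENNReal.toReal_pos (sphereUniform_orthant_pos hd s).ne' (measure_ne_top _ _)
        refine (tendsto_natCast_atTop_atTop.const_mul_atTop hpos).congr fun k => ?_
        rw [hμ, ENNReal.toReal_mul, ENNReal.toReal_ofReal (Nat.cast_nonneg k)])
    filter_upwards [this] with ω hω
    obtain ⟨n, hn⟩ := hω
    obtain ⟨k, hk⟩ := mem_iUnion.1 hn
    exact ⟨n, hk.1, hk.2.1⟩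
  filter_upwards [h1, h2] with ω a b using ⟨a, b⟩

theorem IsPoissonProcess.ae_mem_offSet [IsProbabilityMeasure P]
    (hΦ : IsPoissonProcess Φ (hyperplaneIntensity d) P) (x : Euc d) :
    ∀ᵐ ω ∂P, x ∈ offSet fun n => Φ n ω := by
  have hm : Measurable fun h : HyperplaneParam d => side h x :=
    measurable_side.comp (measurable_id.prodMk measurable_const)
  have hA : MeasurableSet {h : HyperplaneParam d | side h x = 0} := hm (measurableSet_singleton 0)
  have h0 : hyperplaneIntensity d {h : HyperplaneParam d | side h x = 0} = 0 := by
    rw [hyperplaneIntensity, Measure.prod_apply hA]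
    simp only [lintegral_eq_zero_iff (measurable_measure_prodMk_left hA)]
    refine ae_of_all _ fun u => ?_
    have : Prod.mk u ⁻¹' {h : HyperplaneParam d | side h x = 0} = {inner ℝ (u : Euc d) x} := by
      ext r
      simp only [mem_preimage, mem_ofPred_eq, side, mem_singleton_iff]
      rw [sub_eq_zero, eq_comm]
    simp only [this, Real.volume_singleton, Pi.zero_apply]
  exact hΦ.ae_notMem hA h0

/-! ### Stationarity -/

/-- The indices of the members of the dense sequence that lie in the cell of `x`, as seen
from `x`. -/
def cellTrace (H : ℕ → HyperplaneParam d) (x : Euc d) : Set ℕ :=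
  {i | x + TopologicalSpace.denseSeq (Euc d) i ∈ cellAt H x}

theorem measurableSet_mem_cellAt (hΦ : ∀ n, Measurable (Φ n)) {X : Type*} [MeasurableSpace X]
    {f g : X → Euc d} {k : X → Ω} (hk : Measurable k) (hf : Measurable f) (hg : Measurable g) :
    MeasurableSet {p | g p ∈ cellAt (fun n => Φ n (k p)) (f p)} := by
  have : {p | g p ∈ cellAt (fun n => Φ n (k p)) (f p)}
      = ⋂ n, {p | 0 ≤ side (Φ n (k p)) (f p) * side (Φ n (k p)) (g p)} := by
    ext p; simp [cellAt]
  rw [this]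
  refine MeasurableSet.iInter fun n => measurableSet_le measurable_const ?_
  exact (measurable_side.comp (((hΦ n).comp hk).prodMk hf)).mul
    (measurable_side.comp (((hΦ n).comp hk).prodMk hg))

theorem measurable_cellTrace_prod (hΦ : ∀ n, Measurable (Φ n)) :
    Measurable fun p : Ω × Euc d => cellTrace (fun n => Φ n p.1) p.2 := by
  refine measurable_set_iff.2 fun i => measurableSet_setOfPred.1 ?_
  exact measurableSet_mem_cellAt hΦ measurable_fst measurable_snd (by fun_prop)

theorem measurable_cellTrace (hΦ : ∀ n, Measurable (Φ n)) (x : Euc d) :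
    Measurable fun ω => cellTrace (fun n => Φ n ω) x := by
  refine measurable_set_iff.2 fun i => measurableSet_setOfPred.1 ?_
  exact measurableSet_mem_cellAt hΦ measurable_id measurable_const measurable_const

theorem measurableSet_superset (F : Finset ℕ) : MeasurableSet {D : Set ℕ | (F : Set ℕ) ⊆ D} := by
  have : {D : Set ℕ | (F : Set ℕ) ⊆ D} = ⋂ i ∈ F, {D | i ∈ D} := by
    ext D; simp [subset_def]
  rw [this]
  exact Finset.measurableSet_biInter _ fun i _ => measurableSet_mem i

theorem generateFrom_superset_eq : Set.instMeasurableSpace =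
      MeasurableSpace.generateFrom (range fun F : Finset ℕ => {D : Set ℕ | (F : Set ℕ) ⊆ D}) := by
  refine le_antisymm ?_ (MeasurableSpace.generateFrom_le ?_)
  · refine iSup_le fun i => ?_
    refine Measurable.comap_le (f := fun D : Set ℕ => i ∈ D) ?_
    refine (@measurableSet_setOfPred _ (MeasurableSpace.generateFrom _) _).1 ?_
    exact MeasurableSpace.measurableSet_generateFrom ⟨{i}, by ext D; simp⟩
  · rintro _ ⟨F, rfl⟩
    exact measurableSet_superset F

/-- The events that the trace contains a finite set form a π-system. Each is a void event for a
union of separating sets, and its probability is invariant because the intensity is. -/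
theorem IsPoissonProcess.map_cellTrace [IsProbabilityMeasure P]
    (hΦ : IsPoissonProcess Φ (hyperplaneIntensity d) P) (x : Euc d) :
    P.map (fun ω => cellTrace (fun n => Φ n ω) x) = P.map fun ω => cellTrace (fun n => Φ n ω) 0 := by
  have hm := measurable_cellTrace hΦ.measurable
  have := Measure.isProbabilityMeasure_map (μ := P) (hm x).aemeasurable
  have := Measure.isProbabilityMeasure_map (μ := P) (hm 0).aemeasurable
  refine ext_of_generate_finite _ generateFrom_superset_eq ?_ ?_ (by simp)
  · rintro _ ⟨F, rfl⟩ _ ⟨G, rfl⟩ -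
    refine ⟨F ∪ G, ?_⟩
    ext D
    simp
  · rintro _ ⟨F, rfl⟩
    have hF := measurableSet_superset F
    let A : Euc d → Set (HyperplaneParam d) := fun y =>
      ⋃ i ∈ F, separating y (y + TopologicalSpace.denseSeq (Euc d) i)
    have hA : ∀ y, MeasurableSet (A y) := fun y =>
      Finset.measurableSet_biUnion _ fun i _ => measurableSet_separating _ _
    have hfin : ∀ y, hyperplaneIntensity d (A y) ≠ ∞ := fun y =>
      (measure_biUnion_lt_top F.finite_toSet fun i _ =>
        (hyperplaneIntensity_separating_ne_top _ _).lt_top).ne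
    have key : ∀ y, P.map (fun ω => cellTrace (fun n => Φ n ω) y) {D : Set ℕ | (F : Set ℕ) ⊆ D}
        = ENNReal.ofReal (Real.exp (-(hyperplaneIntensity d (A y)).toReal)) := fun y => by
      rw [Measure.map_apply (hm y) hF, ← hΦ.measure_void (hA y) (hfin y)]
      congr 1
      ext ω
      simp only [mem_preimage, mem_ofPred_eq, subset_def, cellTrace, mem_cellAt_iff, A, mem_iUnion,
        not_exists, Finset.mem_coe]
      exact ⟨fun h n i hi => h i hi n, fun h i hi n => h n i hi⟩
    rw [key, key]
    have : A x = (fun h : HyperplaneParam d =>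
        ((h.1, h.2 - inner ℝ (h.1 : Euc d) x) : HyperplaneParam d)) ⁻¹' A 0 := by
      simp only [A, preimage_iUnion, ← separating_translate, add_zero, zero_add]
    rw [this, (measurePreserving_hyperplane_translate x).measure_preimage
      (hA 0).nullMeasurableSet]

end hyperplanes

/-! ### Counting cells by integration -/

theorem dense_offSet {d : ℕ} (H : ℕ → HyperplaneParam d) : Dense (offSet H) :=
  Measure.dense_of_ae (ae_mem_offSet H)

theorem eq_cellAt_of_mem {d : ℕ} {H : ℕ → HyperplaneParam d} {K : Set (Euc d)}
    (hK : K ∈ mosaicCells H) {y : Euc d} (hy : y ∈ offSet H) (h : y ∈ K) : cellAt H y = K := by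
  obtain ⟨x, hx, rfl⟩ := hK
  exact cellAt_eq_of_mem hx hy h

namespace IsRegularFamily

variable {d : ℕ} {H : ℕ → HyperplaneParam d}

theorem volume_cellAt_ne_zero (hH : IsRegularFamily H) {x : Euc d} (hx : x ∈ offSet H) : volume (cellAt H x) ≠ 0 :=
  (Measure.measure_pos_of_mem_nhds _ (hH.cellAt_mem_nhds hx)).ne'

theorem volume_cellAt_ne_top (hH : IsRegularFamily H) (x : Euc d) : volume (cellAt H x) ≠ ∞ :=
  (hH.isCompact_cellAt x).measure_lt_top.ne

theorem countable_mosaicCells (hH : IsRegularFamily H) : (mosaicCells H).Countable := by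
  refine PairwiseDisjoint.countable_of_isOpen (s := interior) ?_ (fun _ _ => isOpen_interior) ?_
  · intro K hK L hL hne
    refine Set.disjoint_iff_inter_eq_empty.2 (not_nonempty_iff_eq_empty.1 fun hn => hne ?_)
    obtain ⟨y, hy, hyo⟩ := (dense_offSet H).inter_open_nonempty _
      (isOpen_interior.inter isOpen_interior) hn
    rw [← eq_cellAt_of_mem hK hyo (interior_subset hy.1),
      ← eq_cellAt_of_mem hL hyo (interior_subset hy.2)]
  · rintro _ ⟨x, hx, rfl⟩
    exact ⟨x, mem_interior_iff_mem_nhds.2 (hH.cellAt_mem_nhds hx)⟩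

theorem encard_mosaicCells_inter (hH : IsRegularFamily H) (𝒜 : Set (Set (Euc d))) :
    ((mosaicCells H ∩ 𝒜).encard : ℝ≥0∞) =
      ∫⁻ x, {x | cellAt H x ∈ 𝒜}.indicator (fun x => (volume (cellAt H x))⁻¹) x := by
  have hc : (mosaicCells H ∩ 𝒜).Countable := hH.countable_mosaicCells.mono inter_subset_left
  have := hc.to_subtype
  have hae : ∀ᵐ x : Euc d, {x | cellAt H x ∈ 𝒜}.indicator (fun x => (volume (cellAt H x))⁻¹) x =
      ∑' K : ↥(mosaicCells H ∩ 𝒜), (K : Set (Euc d)).indicator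
        (fun _ => (volume (K : Set (Euc d)))⁻¹) x := by
    filter_upwards [ae_mem_offSet H] with x hx
    by_cases h : cellAt H x ∈ 𝒜
    · rw [indicator_of_mem (by exact h), tsum_eq_single ⟨cellAt H x, ⟨x, hx, rfl⟩, h⟩]
      · rw [indicator_of_mem (self_mem_cellAt H x)]
      · intro K hK
        refine indicator_of_notMem (fun hxK => hK ?_) _
        exact Subtype.ext (eq_cellAt_of_mem K.2.1 hx hxK).symm
    · rw [indicator_of_notMem (by exact h)]
      refine (ENNReal.tsum_eq_zero.2 fun K => indicator_of_notMem (fun hxK => h ?_) _).symm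
      rw [eq_cellAt_of_mem K.2.1 hx hxK]
      exact K.2.2
  have hm : ∀ K : ↥(mosaicCells H ∩ 𝒜), MeasurableSet (K : Set (Euc d)) := by
    rintro ⟨_, ⟨x, hx, rfl⟩, -⟩
    exact (isClosed_cellAt H x).measurableSet
  rw [lintegral_congr_ae hae, lintegral_tsum fun K => (measurable_const.indicator (hm K)).aemeasurable,
    ← ENNReal.tsum_set_one]
  refine tsum_congr fun K => ?_
  rw [lintegral_indicator_const (hm K)]
  obtain ⟨_, ⟨x, hx, rfl⟩, -⟩ := K
  exact (ENNReal.inv_mul_cancel (hH.volume_cellAt_ne_zero hx) (hH.volume_cellAt_ne_top x)).symm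

theorem traceClosure_cellTrace (hH : IsRegularFamily H) {x : Euc d} (hx : x ∈ offSet H) :
    traceClosure (cellTrace H x) = {y | x + y ∈ cellAt H x} := by
  have hcont : Continuous fun y : Euc d => x + y := by fun_prop
  have hcl : IsClosed {y | x + y ∈ cellAt H x} := (isClosed_cellAt H x).preimage hcont
  refine traceClosure_eq hcl ?_ ⟨0, ?_⟩
  · exact (convex_cellAt H x).translate_preimage_right x
  · rw [mem_interior_iff_mem_nhds]
    refine hcont.continuousAt.preimage_mem_nhds ?_
    rw [add_zero]
    exact hH.cellAt_mem_nhds hx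

theorem volume_traceClosure_cellTrace (hH : IsRegularFamily H) {x : Euc d} (hx : x ∈ offSet H) :
    volume (traceClosure (cellTrace H x) : Set (Euc d)) = volume (cellAt H x) := by
  rw [hH.traceClosure_cellTrace hx]
  exact (measurePreserving_add_left volume x).measure_preimage
    (isClosed_cellAt H x).measurableSet.nullMeasurableSet

theorem cellCentre_traceClosure_cellTrace (hH : IsRegularFamily H) {x : Euc d} (hx : x ∈ offSet H) :
    cellCentre (traceClosure (cellTrace H x) : Set (Euc d)) = cellCentre (cellAt H x) - x := by
  rw [hH.traceClosure_cellTrace hx,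
    cellCentre_translate (hH.isCompact_cellAt x) (hH.volume_cellAt_ne_zero hx)]

theorem centredCell_traceClosure_cellTrace (hH : IsRegularFamily H) {x : Euc d} (hx : x ∈ offSet H) :
    centredCell (traceClosure (cellTrace H x) : Set (Euc d)) = centredCell (cellAt H x) := by
  rw [hH.traceClosure_cellTrace hx,
    centredCell_translate (hH.isCompact_cellAt x) (hH.volume_cellAt_ne_zero hx)]

end IsRegularFamily

/-! ### Mass transport -/

section transport

variable {d : ℕ} {Ω : Type} [MeasurableSpace Ω] {P : Measure Ω} [IsProbabilityMeasure P]
  {Φ : ℕ → Ω → HyperplaneParam d}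

theorem IsPoissonProcess.lintegral_cellTrace (hΦ : IsPoissonProcess Φ (hyperplaneIntensity d) P)
    {G : Euc d × Set ℕ → ℝ≥0∞} (hG : Measurable G) :
    ∫⁻ ω, (∫⁻ x, G (x, cellTrace (fun n => Φ n ω) x)) ∂P =
      ∫⁻ ω, (∫⁻ x, G (x, cellTrace (fun n => Φ n ω) 0)) ∂P := by
  have h1 : Measurable fun p : Ω × Euc d => G (p.2, cellTrace (fun n => Φ n p.1) p.2) :=
    hG.comp (measurable_snd.prodMk (measurable_cellTrace_prod hΦ.measurable))
  have h2 : Measurable fun p : Ω × Euc d => G (p.2, cellTrace (fun n => Φ n p.1) 0) :=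
    hG.comp (measurable_snd.prodMk ((measurable_cellTrace hΦ.measurable 0).comp measurable_fst))
  rw [lintegral_lintegral_swap h1.aemeasurable,
    lintegral_lintegral_swap (f := fun ω x => G (x, cellTrace (fun n => Φ n ω) 0))
      h2.aemeasurable]
  refine lintegral_congr fun x => ?_
  have hGx : Measurable fun D => G (x, D) := hG.comp (measurable_const.prodMk measurable_id)
  rw [← lintegral_map hGx (measurable_cellTrace hΦ.measurable x), hΦ.map_cellTrace,
    lintegral_map hGx (measurable_cellTrace hΦ.measurable 0)]

theorem measurableSet_unitCube (d : ℕ) : MeasurableSet (unitCube d) := by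
  have : unitCube d = ⋂ i, {x : Euc d | 0 ≤ x i ∧ x i < 1} := by ext; simp [unitCube]
  rw [this]
  refine MeasurableSet.iInter fun i => ?_
  have hm : Measurable fun x : Euc d => x i := by fun_prop
  exact (measurableSet_le measurable_const hm).inter (measurableSet_lt hm measurable_const)

theorem volume_unitCube (d : ℕ) : volume (unitCube d) = 1 := by
  have h := (EuclideanSpace.volume_preserving_symm_measurableEquiv_toLp (Fin d))
  have : unitCube d = (MeasurableEquiv.toLp 2 (Fin d → ℝ)).symm ⁻¹' univ.pi fun _ => Ico 0 1 := by
    ext x; simp [unitCube]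
  rw [this, h.measure_preimage
    (MeasurableSet.univ_pi fun _ => measurableSet_Ico).nullMeasurableSet, volume_pi_pi]
  simp

/-- The law of the typical cell is that of the cell of the origin weighted with its inverse
volume. -/
theorem IsPoissonProcess.cellIntensity_eq (hd : 1 ≤ d)
    (hΦ : IsPoissonProcess Φ (hyperplaneIntensity d) P) {A : Set (Set (Euc d))}
    (hA : MeasurableSet A) :
    cellIntensity Φ P A = ∫⁻ ω, {D : Set ℕ | centredCell (traceClosure D : Set (Euc d)) ∈ A}.indicator
      (fun D => (volume (traceClosure D : Set (Euc d)))⁻¹) (cellTrace (fun n => Φ n ω) 0) ∂P := by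
  classical
  let B : Set (Euc d × Set ℕ) := {p | p.1 + cellCentre (traceClosure p.2) ∈ unitCube d ∧
    centredCell (traceClosure p.2 : Set (Euc d)) ∈ A}
  have hB : MeasurableSet B := by
    refine MeasurableSet.inter ?_ ?_
    · exact (measurable_fst.add (measurable_cellCentre_traceClosure.comp measurable_snd))
        (measurableSet_unitCube d)
    · exact (measurable_centredCell_traceClosure.comp measurable_snd) hA
  let G : Euc d × Set ℕ → ℝ≥0∞ := B.indicator fun p => (volume (traceClosure p.2 : Set (Euc d)))⁻¹
  have hG : Measurable G :=
    (measurable_volume_traceClosure.comp measurable_snd).inv.indicator hB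
  -- The count is written as an integral over x of data of the cell seen from x: its volume, its
  -- centred shape, and its centre relative to x.
  have h1 : cellIntensity Φ P A = ∫⁻ ω, (∫⁻ x, G (x, cellTrace (fun n => Φ n ω) x)) ∂P := by
    refine lintegral_congr_ae ?_
    filter_upwards [hΦ.ae_isRegularFamily hd] with ω hω
    refine (hω.encard_mosaicCells_inter
      {K | cellCentre K ∈ unitCube d ∧ centredCell K ∈ A}).trans (lintegral_congr_ae ?_)
    filter_upwards [_root_.ae_mem_offSet fun n => Φ n ω] with x hx
    simp only [indicator_apply, G, B, mem_ofPred_eq, hω.cellCentre_traceClosure_cellTrace hx,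
      hω.centredCell_traceClosure_cellTrace hx, hω.volume_traceClosure_cellTrace hx,
      add_sub_cancel]
  -- Now x enters only through the condition that a translate of it lies in the unit cube, which
  -- contributes volume one.
  rw [h1, hΦ.lintegral_cellTrace hG]
  refine lintegral_congr fun ω => ?_
  set D := cellTrace (fun n => Φ n ω) 0
  have h2 : ∀ x : Euc d, G (x, D) = {x | x + cellCentre (traceClosure D) ∈ unitCube d}.indicator
      (fun _ => {D : Set ℕ | centredCell (traceClosure D : Set (Euc d)) ∈ A}.indicator
      (fun D => (volume (traceClosure D : Set (Euc d)))⁻¹) D) x := fun x => by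
    by_cases h : x + cellCentre (traceClosure D) ∈ unitCube d <;>
      simp [G, B, indicator_apply, h]
  have hadd : Measurable fun x : Euc d => x + cellCentre (traceClosure D) := by fun_prop
  have hm : MeasurableSet {x : Euc d | x + cellCentre (traceClosure D) ∈ unitCube d} :=
    hadd (measurableSet_unitCube d)
  simp_rw [h2]
  rw [lintegral_indicator_const hm]
  have h3 : volume {x | x + cellCentre (traceClosure D) ∈ unitCube d} = volume (unitCube d) :=
    (measurePreserving_add_right volume _).measure_preimage
      (measurableSet_unitCube d).nullMeasurableSet
  rw [h3, volume_unitCube, mul_one]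

theorem IsPoissonProcess.measure_mem_cellAt_zero {d : ℕ} {Ω : Type} [MeasurableSpace Ω]
    {P : Measure Ω} {Φ : ℕ → Ω → HyperplaneParam d}
    (hΦ : IsPoissonProcess Φ (hyperplaneIntensity d) P) (t : Euc d) :
    P {ω | t ∈ cellAt (fun n => Φ n ω) 0} =
      ENNReal.ofReal (Real.exp (-(hyperplaneIntensity d (separating 0 t)).toReal)) := by
  rw [← hΦ.measure_void (measurableSet_separating 0 t) (hyperplaneIntensity_separating_ne_top 0 t)]
  simp only [mem_cellAt_iff]

/-- Mass transport identifies the covariogram of the typical cell, up to the cell intensity, with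
the probability that 0 and t share a cell. -/
theorem IsPoissonProcess.lintegral_cellIntensity (hd : 1 ≤ d)
    (hΦ : IsPoissonProcess Φ (hyperplaneIntensity d) P) (t : Euc d) :
    ∫⁻ z, cellIntensity Φ P {K | z ∈ K ∧ z + t ∈ K} =
      ENNReal.ofReal (Real.exp (-(hyperplaneIntensity d (separating 0 t)).toReal)) := by
  classical
  let Z : Set ℕ → Set (Euc d) := traceClosure
  have hAm : ∀ z : Euc d, MeasurableSet {K : Set (Euc d) | z ∈ K ∧ z + t ∈ K} := fun z =>
    (measurableSet_mem z).inter (measurableSet_mem (z + t))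
  let v : Set ℕ → ℝ≥0∞ := fun D => (volume (Z D))⁻¹
  have hv : Measurable v := measurable_volume_traceClosure.inv
  -- Seen from y, the origin sits at −y and the point y + t at t.
  let B : Set (Euc d × Set ℕ) := {p | -p.1 ∈ Z p.2 ∧ t ∈ Z p.2}
  have hB : MeasurableSet B :=
    (measurableSet_mem_traceClosure.preimage (measurable_snd.prodMk measurable_fst.neg)).inter
      (measurableSet_mem_traceClosure.preimage (measurable_snd.prodMk measurable_const))
  have hG : Measurable (B.indicator fun p => v p.2) := (hv.comp measurable_snd).indicator hB
  have h0 : ∀ᵐ ω ∂P, (0 : Euc d) ∈ offSet fun n => Φ n ω := hΦ.ae_mem_offSet 0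
  have hmc : Measurable fun p : Euc d × Ω => (p.1, cellTrace (fun n => Φ n p.2) 0) :=
    measurable_fst.prodMk ((measurable_cellTrace hΦ.measurable 0).comp measurable_snd)
  let E : Set (Euc d × Set ℕ) := {p | p.1 ∈ centredCell (Z p.2) ∧ p.1 + t ∈ centredCell (Z p.2)}
  have hE : MeasurableSet E :=
    (measurableSet_mem_centredCell_traceClosure.preimage
      (measurable_snd.prodMk measurable_fst)).inter
      (measurableSet_mem_centredCell_traceClosure.preimage
        (measurable_snd.prodMk (measurable_fst.add measurable_const)))
  have hEm : Measurable fun p : Euc d × Ω =>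
      E.indicator (fun p => v p.2) (p.1, cellTrace (fun n => Φ n p.2) 0) :=
    ((hv.comp measurable_snd).indicator hE).comp hmc
  calc ∫⁻ z, cellIntensity Φ P {K | z ∈ K ∧ z + t ∈ K}
      = ∫⁻ z, ∫⁻ ω, E.indicator (fun p => v p.2) (z, cellTrace (fun n => Φ n ω) 0) ∂P := by
        refine lintegral_congr fun z => ?_
        rw [hΦ.cellIntensity_eq hd (hAm z)]
        rfl
    _ = ∫⁻ ω, (∫⁻ z, E.indicator (fun p => v p.2) (z, cellTrace (fun n => Φ n ω) 0)) ∂P :=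
        lintegral_lintegral_swap hEm.aemeasurable
    -- Substitute z = y − centre. For y in the cell of the origin the two cells coincide, so all
    -- data can be read off from y; for other y both sides vanish.
    _ = ∫⁻ ω, (∫⁻ y, B.indicator (fun p => v p.2) (y, cellTrace (fun n => Φ n ω) y)) ∂P := by
        refine lintegral_congr_ae ?_
        filter_upwards [hΦ.ae_isRegularFamily hd, h0] with ω hω hω0
        set H : ℕ → HyperplaneParam d := fun n => Φ n ω
        rw [← lintegral_sub_right_eq_self _ (cellCentre (Z (cellTrace H 0)))]
        refine lintegral_congr_ae ?_
        filter_upwards [_root_.ae_mem_offSet H] with y hy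
        have hZ0 : Z (cellTrace H 0) = cellAt H 0 := by
          simp only [Z, hω.traceClosure_cellTrace hω0, zero_add, ofPred_mem_eq]
        have hZy : Z (cellTrace H y) = {x | y + x ∈ cellAt H y} := hω.traceClosure_cellTrace hy
        have hvy : v (cellTrace H y) = (volume (cellAt H y))⁻¹ := by
          simp only [v, Z, hω.volume_traceClosure_cellTrace hy]
        by_cases h : y ∈ cellAt H 0
        · have he := cellAt_eq_of_mem hω0 hy h
          have h' : (0 : Euc d) ∈ cellAt H 0 := self_mem_cellAt H 0
          simp only [indicator_apply, E, B, mem_ofPred_eq, centredCell, sub_add_cancel, hZ0, hZy,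
            add_neg_cancel, h', h, true_and, hvy, he]
          rw [show y - cellCentre (cellAt H 0) + t + cellCentre (cellAt H 0) = y + t by abel]
          simp only [v, hZ0]
        · have h' : (0 : Euc d) ∉ cellAt H y := fun h' =>
            h (fun n => by rw [mul_comm]; exact h' n)
          simp only [indicator_apply, E, B, mem_ofPred_eq, centredCell, sub_add_cancel, hZ0, hZy,
            add_neg_cancel, h', h, false_and, if_false]
    _ = ∫⁻ ω, (∫⁻ y, B.indicator (fun p => v p.2) (y, cellTrace (fun n => Φ n ω) 0)) ∂P :=
        hΦ.lintegral_cellTrace hG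
    -- The integral over y of the inverse volume runs over the reflected cell and equals one.
    _ = ∫⁻ ω, {ω | t ∈ cellAt (fun n => Φ n ω) 0}.indicator 1 ω ∂P := by
        refine lintegral_congr_ae ?_
        filter_upwards [hΦ.ae_isRegularFamily hd, h0] with ω hω hω0
        set H : ℕ → HyperplaneParam d := fun n => Φ n ω
        have hZ0 : Z (cellTrace H 0) = cellAt H 0 := by
          simp only [Z, hω.traceClosure_cellTrace hω0, zero_add, ofPred_mem_eq]
        have h1 : ∀ y, B.indicator (fun p => v p.2) (y, cellTrace H 0) =
            (-cellAt H 0).indicator (fun _ => {ω | t ∈ cellAt (fun n => Φ n ω) 0}.indicator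
              (fun _ => (volume (cellAt H 0))⁻¹) ω) y := fun y => by
          by_cases h : -y ∈ cellAt H 0 <;>
            simp [indicator_apply, B, hZ0, h, H, v]
        simp_rw [h1]
        rw [lintegral_indicator_const (isClosed_cellAt H 0).measurableSet.neg, Measure.measure_neg]
        by_cases h : t ∈ cellAt H 0
        · rw [indicator_of_mem (by exact h), indicator_of_mem (by exact h)]
          exact ENNReal.inv_mul_cancel (hω.volume_cellAt_ne_zero hω0) (hω.volume_cellAt_ne_top 0)
        · rw [indicator_of_notMem (by exact h), indicator_of_notMem (by exact h), zero_mul]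
    _ = _ := by
        rw [lintegral_indicator_one, hΦ.measure_mem_cellAt_zero]
        exact measurableSet_mem_cellAt hΦ.measurable measurable_id measurable_const measurable_const

end transport

/-! ### Finiteness of the cell intensity -/

theorem norm_le_of_mem_unitCube {d : ℕ} {x : Euc d} (hx : x ∈ unitCube d) : ‖x‖ ≤ √d := by
  rw [EuclideanSpace.norm_eq]
  refine Real.sqrt_le_sqrt ?_
  have : ∀ i ∈ Finset.univ, ‖x i‖ ^ 2 ≤ (1 : ℝ) := fun i _ => by
    have h1 := hx i
    rw [Real.norm_eq_abs, sq_abs]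
    nlinarith
  simpa using Finset.sum_le_card_nsmul _ _ _ this

theorem IsRegularFamily.exists_cellAt_eq {d : ℕ} {H : ℕ → HyperplaneParam d}
    (hH : IsRegularFamily H) {K : Set (Euc d)} (hK : K ∈ mosaicCells H) {R : ℝ}
    (hR : ‖cellCentre K‖ < R) : ∃ x ∈ offSet H, ‖x‖ ≤ R ∧ cellAt H x = K := by
  obtain ⟨x₀, hx₀, rfl⟩ := hK
  set K := cellAt H x₀
  have hi : (interior K).Nonempty := ⟨x₀, mem_interior_iff_mem_nhds.2 (hH.cellAt_mem_nhds hx₀)⟩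
  have hmem : cellCentre K ∈ closure (interior K) := by
    rw [(convex_cellAt H x₀).closure_interior_eq_closure_of_nonempty_interior hi]
    exact subset_closure (cellCentre_mem (hH.isCompact_cellAt x₀) (convex_cellAt H x₀)
      (hH.volume_cellAt_ne_zero hx₀))
  have hb : cellCentre K ∈ Metric.ball (0 : Euc d) R := by simpa using hR
  obtain ⟨y, hy, hyo⟩ := (dense_offSet H).inter_open_nonempty _
    (Metric.isOpen_ball.inter isOpen_interior)
    (mem_closure_iff.1 hmem _ Metric.isOpen_ball hb)
  refine ⟨y, hyo, ?_, cellAt_eq_of_mem hx₀ hyo (interior_subset hy.2)⟩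
  have := hy.1
  rw [mem_ball_zero_iff] at this
  exact this.le

/-- Such a cell contains a point of the ball of radius R off the hyperplanes. Hyperplanes at
distance beyond R do not cut the ball, so the signs with respect to the others determine the cell.
-/
theorem IsRegularFamily.encard_mosaicCells_le {d : ℕ} {H : ℕ → HyperplaneParam d}
    (hH : IsRegularFamily H) (R : ℕ) :
    {K ∈ mosaicCells H | ‖cellCentre K‖ < R}.encard ≤
      ((2 ^ (hH.finite R).toFinset.card : ℕ) : ℕ∞) := by
  classical
  set F := (hH.finite R).toFinset
  have key : ∀ K ∈ {K ∈ mosaicCells H | ‖cellCentre K‖ < R},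
      ∃ x ∈ offSet H, ‖x‖ ≤ R ∧ cellAt H x = K := fun K hK => hH.exists_cellAt_eq hK.1 hK.2
  choose! x hxo hxR hxK using key
  rw [← Finset.card_powerset, ← Set.encard_coe_eq_coe_finsetCard]
  refine encard_le_encard_of_injOn (f := fun K => F.filter fun n => 0 < side (H n) (x K))
    (fun K _ => by
      simp only [Finset.mem_coe, Finset.mem_powerset, Finset.filter_subset]) ?_
  intro K hK L hL he
  rw [← hxK K hK, ← hxK L hL]
  refine cellAt_eq_of_mem (hxo L hL) (hxo K hK) fun n => ?_
  by_cases hn : n ∈ F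
  · have h1 := Finset.ext_iff.1 he n
    simp only [Finset.mem_filter, hn, true_and] at h1
    by_cases h2 : 0 < side (H n) (x K)
    · exact (mul_pos (h1.1 h2) h2).le
    · exact mul_nonneg_of_nonpos_of_nonpos (not_lt.1 fun h3 => h2 (h1.2 h3)) (not_lt.1 h2)
  · have hn' : (R : ℝ) < |(H n).2| := by simpa [F] using hn
    exact (side_mul_pos_of_lt hn' (hxR L hL) (hxR K hK)).le

theorem lintegral_two_pow_poisson_ne_top (r : ℝ≥0) :
    ∫⁻ k : ℕ, ENNReal.ofReal (2 ^ k) ∂(poissonMeasure r) ≠ ∞ := by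
  rw [lintegral_countable']
  simp_rw [poissonMeasure_singleton]
  have : ∀ k : ℕ, ENNReal.ofReal (2 ^ k) * ENNReal.ofReal (Real.exp (-r) * r ^ k / k.factorial) =
      ENNReal.ofReal (Real.exp (-r) * ((2 * r) ^ k / k.factorial)) := fun k => by
    rw [← ENNReal.ofReal_mul (by positivity), mul_pow]
    congr 1
    ring
  simp_rw [this]
  exact ((Real.summable_pow_div_factorial (2 * r)).mul_left _).tsum_ofReal_ne_top

/-- At most 2^N cells have their centre in the unit cube, where N is the Poisson number of
hyperplanes at distance at most R from the origin, and E 2^N is finite. Hence the law of the typical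
cell can be normalized. -/
theorem IsPoissonProcess.cellIntensity_univ_ne_top {d : ℕ} (hd : 1 ≤ d) {Ω : Type}
    [MeasurableSpace Ω] {P : Measure Ω} {Φ : ℕ → Ω → HyperplaneParam d}
    (hΦ : IsPoissonProcess Φ (hyperplaneIntensity d) P) : cellIntensity Φ P univ ≠ ∞ := by
  obtain ⟨R, hR⟩ := exists_nat_gt (√d)
  set A : Set (HyperplaneParam d) := {h | |h.2| ≤ R}
  have hA : MeasurableSet A := measurableSet_abs_le (R : ℝ)
  have hfin : hyperplaneIntensity d A ≠ ∞ := by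
    rw [hyperplaneIntensity_abs_le hd]; exact ENNReal.ofReal_ne_top
  let g : ℝ≥0∞ → ℝ≥0∞ := fun x => ENNReal.ofReal ((2 : ℝ) ^ x.toReal)
  have hg : Measurable g := by fun_prop
  have hle : cellIntensity Φ P univ ≤ ∫⁻ ω, g (pointCount Φ A ω) ∂P := by
    refine lintegral_mono_ae ?_
    filter_upwards [hΦ.ae_isRegularFamily hd] with ω hω
    have h1 : ({K ∈ mosaicCells (fun n => Φ n ω) |
        cellCentre K ∈ unitCube d ∧ centredCell K ∈ univ}.encard : ℕ∞) ≤
        ((2 ^ (hω.finite R).toFinset.card : ℕ) : ℕ∞) :=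
      le_trans (encard_le_encard fun K hK => show _ ∧ _ from
        ⟨hK.1, (norm_le_of_mem_unitCube hK.2.1).trans_lt hR⟩) (hω.encard_mosaicCells_le R)
    have h2 : pointCount Φ A ω = ((hω.finite R).toFinset.card : ℝ≥0∞) := by
      rw [pointCount_eq_encard]
      have : {n | Φ n ω ∈ A} = ((hω.finite R).toFinset : Set ℕ) := by ext; simp [A]
      rw [this, Set.encard_coe_eq_coe_finsetCard]
      rfl
    rw [h2]
    refine (ENat.toENNReal_le.2 h1).trans (le_of_eq ?_)
    simp only [g, ENNReal.toReal_natCast, Real.rpow_natCast]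
    rw [ENat.toENNReal_coe, ENNReal.ofReal_pow (by norm_num)]
    push_cast
    simp
  refine ne_top_of_le_ne_top ?_ hle
  rw [← lintegral_map hg (hΦ.measurable_pointCount hA), hΦ.count_law A hA hfin,
    lintegral_map hg (by fun_prop)]
  simpa [g] using lintegral_two_pow_poisson_ne_top _

/-! ### Existence of the typical cell -/

theorem exists_isPoissonProcess_hyperplaneIntensity {d : ℕ} (hd : 1 ≤ d) :
    ∃ (Ω : Type) (_ : MeasurableSpace Ω) (P : Measure Ω) (Φ : ℕ → Ω → HyperplaneParam d),
      IsProbabilityMeasure P ∧ IsPoissonProcess Φ (hyperplaneIntensity d) P := by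
  have := isProbabilityMeasure_sphereUniform hd
  have hI : ∀ k : ℤ, IsProbabilityMeasure ((volume : Measure ℝ).restrict (Ico (k : ℝ) (k + 1))) :=
    fun k => ⟨by simp⟩
  have h := exists_isPoissonProcess_of_countable
    fun k : ℤ => (sphereUniform d).prod ((volume : Measure ℝ).restrict (Ico (k : ℝ) (k + 1)))
  have hs : Measure.sum (fun k : ℤ => (volume : Measure ℝ).restrict (Ico (k : ℝ) (k + 1)))
      = volume := by
    rw [← Measure.restrict_iUnion (pairwise_disjoint_Ico_intCast ℝ) fun _ => measurableSet_Ico,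
      iUnion_Ico_intCast, Measure.restrict_univ]
  rwa [← Measure.prod_sum_right, hs] at h

theorem IsPoissonProcess.cellIntensity_univ_ne_zero {d : ℕ} (hd : 1 ≤ d) {Ω : Type}
    [MeasurableSpace Ω] {P : Measure Ω} [IsProbabilityMeasure P] {Φ : ℕ → Ω → HyperplaneParam d}
    (hΦ : IsPoissonProcess Φ (hyperplaneIntensity d) P) : cellIntensity Φ P univ ≠ 0 := by
  intro h0
  have h1 := hΦ.lintegral_cellIntensity hd 0
  have h2 : ∀ z : Euc d, cellIntensity Φ P {K | z ∈ K ∧ z + 0 ∈ K} = 0 := fun z => by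
    refine le_antisymm (le_of_le_of_eq (lintegral_mono fun ω => ?_) h0) bot_le
    exact ENat.toENNReal_le.2 (encard_le_encard fun K hK => ⟨hK.1, hK.2.1, trivial⟩)
  simp only [h2, lintegral_zero] at h1
  exact (ENNReal.ofReal_pos.2 (Real.exp_pos _)).ne h1

theorem isConvexBody_centredCell {d : ℕ} {K : Set (Euc d)} (h1 : IsCompact K) (h2 : Convex ℝ K)
    (h3 : (interior K).Nonempty) : IsCompact (centredCell K) ∧ Convex ℝ (centredCell K) ∧
      (interior (centredCell K)).Nonempty := by
  refine ⟨(Homeomorph.addRight (cellCentre K)).isCompact_preimage.2 h1,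
    h2.translate_preimage_left (cellCentre K), ?_⟩
  have : interior (centredCell K) = Homeomorph.addRight (cellCentre K) ⁻¹' interior K :=
    ((Homeomorph.addRight (cellCentre K)).preimage_interior K).symm
  rw [this]
  exact h3.preimage (Homeomorph.addRight (cellCentre K)).surjective

/-- The typical cell is realized as the centred cell of the origin under the law with density
proportional to its inverse volume. -/
theorem exists_isTypicalCell {d : ℕ} (hd : 1 ≤ d) :
    ∃ (S : Type) (_ : MeasurableSpace S) (Q : Measure S) (C : S → Set (Euc d)),
      IsProbabilityMeasure Q ∧ IsTypicalCell C Q := by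
  classical
  obtain ⟨Ω, _, P, Φ, hP, hΦ⟩ := exists_isPoissonProcess_hyperplaneIntensity hd
  let D : Ω → Set ℕ := fun ω => cellTrace (fun n => Φ n ω) 0
  have hD : Measurable D := measurable_cellTrace hΦ.measurable 0
  let C₀ : Ω → Set (Euc d) := fun ω => centredCell (traceClosure (D ω))
  have hgood : ∀ᵐ ω ∂P, IsCompact (C₀ ω) ∧ Convex ℝ (C₀ ω) ∧ (interior (C₀ ω)).Nonempty := by
    filter_upwards [hΦ.ae_isRegularFamily hd, hΦ.ae_mem_offSet 0] with ω hω hω0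
    simp only [C₀, D, hω.centredCell_traceClosure_cellTrace hω0]
    exact isConvexBody_centredCell (hω.isCompact_cellAt 0) (convex_cellAt _ 0)
      ⟨0, mem_interior_iff_mem_nhds.2 (hω.cellAt_mem_nhds hω0)⟩
  set T : Set Ω := toMeasurable P
    {ω | ¬ (IsCompact (C₀ ω) ∧ Convex ℝ (C₀ ω) ∧ (interior (C₀ ω)).Nonempty)}
  have hTm : MeasurableSet T := measurableSet_toMeasurable _ _
  have hT0 : P T = 0 := (measure_toMeasurable _).trans (ae_iff.1 hgood)
  have hTsub : ∀ ω, ω ∉ T → IsCompact (C₀ ω) ∧ Convex ℝ (C₀ ω) ∧ (interior (C₀ ω)).Nonempty :=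
    fun ω h => by_contra fun h' => h (subset_toMeasurable _ _ h')
  -- `IsTypicalCell` asks for a convex body in every realization, so a ball is substituted on a
  -- measurable null set.
  let C : Ω → Set (Euc d) := fun ω => if ω ∈ T then Metric.closedBall 0 1 else C₀ ω
  have hgraph : MeasurableSet {p : Ω × Euc d | p.2 ∈ C p.1} := by
    have : {p : Ω × Euc d | p.2 ∈ C p.1} = (T ×ˢ Metric.closedBall 0 1) ∪
        ((Prod.fst ⁻¹' T)ᶜ ∩ {p | p.2 ∈ C₀ p.1}) := by
      ext p
      by_cases h : p.1 ∈ T <;> simp [C, h]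
    rw [this]
    refine (hTm.prod Metric.isClosed_closedBall.measurableSet).union
      ((measurable_fst hTm).compl.inter ?_)
    exact measurableSet_mem_centredCell_traceClosure.preimage
      ((hD.comp measurable_fst).prodMk measurable_snd)
  have hCm : Measurable C := measurable_set_iff.2 fun x => measurableSet_setOfPred.1
    (hgraph.preimage (measurable_id.prodMk measurable_const))
  have hCae : ∀ᵐ ω ∂P, C ω = C₀ ω := by
    have : ∀ᵐ ω ∂P, ω ∉ T := measure_eq_zero_iff_ae_notMem.1 hT0
    filter_upwards [this] with ω hω
    simp [C, hω]
  set N := cellIntensity Φ P univ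
  have hN0 : N ≠ 0 := hΦ.cellIntensity_univ_ne_zero hd
  have hNt : N ≠ ∞ := hΦ.cellIntensity_univ_ne_top hd
  let v : Set ℕ → ℝ≥0∞ := fun D => (volume (traceClosure D : Set (Euc d)))⁻¹
  have hv : Measurable v := measurable_volume_traceClosure.inv
  have hvD : Measurable fun ω => v (D ω) := hv.comp hD
  let Q : Measure Ω := P.withDensity fun ω => N⁻¹ * v (D ω)
  have hlaw : ∀ A : Set (Set (Euc d)), MeasurableSet A →
      Q (C ⁻¹' A) = cellIntensity Φ P A / N := fun A hA => by
    rw [withDensity_apply _ (hCm hA), lintegral_const_mul _ hvD, hΦ.cellIntensity_eq hd hA,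
      ENNReal.div_eq_inv_mul, ← lintegral_indicator (hCm hA)]
    congr 1
    refine lintegral_congr_ae ?_
    filter_upwards [hCae] with ω hω
    simp only [indicator_apply, mem_preimage, hω]
    rfl
  refine ⟨Ω, _, Q, C, ⟨?_⟩, fun ω => ?_, hgraph, Ω, _, P, Φ, hP, hΦ, hlaw⟩
  · rw [← preimage_univ (f := C), hlaw _ MeasurableSet.univ]
    exact ENNReal.div_self hN0 hNt
  · by_cases h : ω ∈ T
    · simp only [C, h, if_true]
      refine ⟨isCompact_closedBall _ _, convex_closedBall _ _, 0, ?_⟩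
      exact Metric.ball_subset_interior_closedBall (Metric.mem_ball_self one_pos)
    · simp only [C, h, if_false]
      exact hTsub ω h

/-! ### Tail correlation functions of mixed Poisson storms -/

section storms

variable {d : ℕ} {S : Type} [MeasurableSpace S] {Q : Measure S}
  {C : S → Set (Euc d)} {c : ℝ}

/-- Fubini reduces the mean covariogram to `IsPoissonProcess.lintegral_cellIntensity`. Taking t = 0
shows that m is the mean volume of the typical cell. -/
theorem IsTypicalCell.exists_lintegral_volume_inter [IsProbabilityMeasure Q] (hd : 1 ≤ d) (hC : IsTypicalCell C Q)
    (hc : 0 ≤ c) (hsep : ∀ t : Euc d,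
      hyperplaneIntensity d (separating 0 t) = ENNReal.ofReal (c * ‖t‖)) :
    ∃ m : ℝ≥0∞, m ≠ 0 ∧ m ≠ ∞ ∧ ∀ t : Euc d, ∫⁻ s, volume {z | z ∈ C s ∧ z + t ∈ C s} ∂Q =
      ENNReal.ofReal (Real.exp (-(c * ‖t‖))) * m := by
  obtain ⟨Ω, _, P, Φ, hP, hΦ, hlaw⟩ := hC.law
  set N := cellIntensity Φ P univ
  have hN : N / N = 1 := by rw [← hlaw univ MeasurableSet.univ, preimage_univ, measure_univ]
  have hN0 : N ≠ 0 := fun h => by simp [h] at hN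
  have hNt : N ≠ ∞ := fun h => by simp [h] at hN
  refine ⟨N⁻¹, ENNReal.inv_ne_zero.2 hNt, ENNReal.inv_ne_top.2 hN0, fun t => ?_⟩
  have hE : MeasurableSet {p : S × Euc d | p.2 ∈ C p.1 ∧ p.2 + t ∈ C p.1} :=
    hC.measurable_graph.inter (hC.measurable_graph.preimage
      (measurable_fst.prodMk (measurable_snd.add measurable_const)))
  have h1 : ∫⁻ s, volume {z | z ∈ C s ∧ z + t ∈ C s} ∂Q =
      ∫⁻ z, Q {s | z ∈ C s ∧ z + t ∈ C s} :=
    (Measure.prod_apply hE).symm.trans (Measure.prod_apply_symm hE)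
  have h2 : ∀ z : Euc d, Q {s | z ∈ C s ∧ z + t ∈ C s} =
      cellIntensity Φ P {K | z ∈ K ∧ z + t ∈ K} * N⁻¹ := fun z => by
    rw [← div_eq_mul_inv]
    exact hlaw _ ((measurableSet_mem z).inter (measurableSet_mem (z + t)))
  simp_rw [h1, h2]
  rw [lintegral_mul_const' _ _ (ENNReal.inv_ne_top.2 hN0), hΦ.lintegral_cellIntensity hd, hsep,
    ENNReal.toReal_ofReal (by positivity)]

theorem volume_setOf_smul_mem {a : ℝ} (ha : a ≠ 0) (B : Set (Euc d)) :
    volume {t : Euc d | a • t ∈ B} = ENNReal.ofReal |(a ^ d)⁻¹| * volume B := by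
  have := Measure.addHaar_preimage_smul (volume : Measure (Euc d)) ha B
  rwa [finrank_euclideanSpace_fin] at this

theorem IsTypicalCell.stormHeight_mul [IsProbabilityMeasure Q] (hd : 1 ≤ d) (hC : IsTypicalCell C Q)
    (hc : 0 ≤ c) (hsep : ∀ t : Euc d,
      hyperplaneIntensity d (separating 0 t) = ENNReal.ofReal (c * ‖t‖)) {a : ℝ} (ha : 0 < a)
    (t : Euc d) :
    stormHeight C Q a * ∫⁻ s, volume {z | a • z ∈ C s ∧ a • (z + t) ∈ C s} ∂Q =
      ENNReal.ofReal (Real.exp (-(c * (a * ‖t‖)))) := by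
  obtain ⟨m, hm0, hmt, hm⟩ := hC.exists_lintegral_volume_inter hd hc hsep
  set k := ENNReal.ofReal |(a ^ d)⁻¹|
  have hk0 : k ≠ 0 := (ENNReal.ofReal_pos.2 (by positivity)).ne'
  have hkt : k ≠ ∞ := ENNReal.ofReal_ne_top
  have h1 : ∀ s, volume {z | a • z ∈ C s ∧ a • (z + t) ∈ C s} =
      k * volume {z | z ∈ C s ∧ z + a • t ∈ C s} := fun s => by
    rw [← volume_setOf_smul_mem ha.ne']
    simp only [smul_add, mem_ofPred_eq]
  have h2 : ∀ s, volume {z | a • z ∈ C s} = k * volume {z | z ∈ C s ∧ z + 0 ∈ C s} := fun s => by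
    rw [volume_setOf_smul_mem ha.ne']
    simp only [add_zero, and_self, ofPred_mem_eq]
    rfl
  have h3 := hm 0
  simp only [norm_zero, mul_zero, neg_zero, Real.exp_zero, ENNReal.ofReal_one, one_mul] at h3
  simp_rw [stormHeight, h1, h2]
  rw [lintegral_const_mul' _ _ hkt, lintegral_const_mul' _ _ hkt, h3, hm, norm_smul,
    Real.norm_eq_abs, abs_of_pos ha]
  have hkm0 : k * m ≠ 0 := mul_ne_zero hk0 hm0
  have hkmt : k * m ≠ ∞ := ENNReal.mul_ne_top hkt hmt
  rw [mul_left_comm k, mul_left_comm, ENNReal.inv_mul_cancel hkm0 hkmt, mul_one]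

/-- The shape function of a mixed Poisson storm. -/
noncomputable def stormShape (C : S → Set (Euc d)) (Q : Measure S) (p : ℝ × S) (t : Euc d) : ℝ≥0∞ :=
  {t : Euc d | p.1 • t ∈ C p.2}.indicator (fun _ => stormHeight C Q p.1) t

theorem IsTypicalCell.measurableSet_smul_mem (hC : IsTypicalCell C Q) :
    MeasurableSet {p : (ℝ × S) × Euc d | p.1.1 • p.2 ∈ C p.1.2} :=
  hC.measurable_graph.preimage ((measurable_snd.comp measurable_fst).prodMk
    ((measurable_fst.comp measurable_fst).smul measurable_snd))

theorem IsTypicalCell.measurable_stormHeight [SFinite Q] (hC : IsTypicalCell C Q) :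
    Measurable (stormHeight C Q) :=
  (Measurable.lintegral_prod_right' (f := fun p : ℝ × S => volume {t : Euc d | p.1 • t ∈ C p.2})
    (measurable_measure_prodMk_left hC.measurableSet_smul_mem)).inv

theorem IsTypicalCell.measurable_stormShape [SFinite Q] (hC : IsTypicalCell C Q) :
    Measurable fun p : (ℝ × S) × Euc d => stormShape C Q p.1 p.2 :=
  (hC.measurable_stormHeight.comp (measurable_fst.comp measurable_fst)).indicator
    hC.measurableSet_smul_mem

/-- The minimum of two shifted indicators is the indicator of an intersection, so each a contributes
a normalized covariogram at at, equal to exp(−ca‖t‖). -/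
theorem IsTypicalCell.lintegral_min_stormShape [IsProbabilityMeasure Q] (hd : 1 ≤ d) (hC : IsTypicalCell C Q)
    (hc : 0 ≤ c) (hsep : ∀ t : Euc d,
      hyperplaneIntensity d (separating 0 t) = ENNReal.ofReal (c * ‖t‖))
    {F : Measure ℝ} [IsProbabilityMeasure F] (hF : F (Iic 0) = 0) (t : Euc d) :
    ∫⁻ p, min (stormShape C Q p.2 (0 - p.1)) (stormShape C Q p.2 (t - p.1))
        ∂((volume : Measure (Euc d)).prod (F.prod Q)) =
      ∫⁻ a, ENNReal.ofReal (Real.exp (-(c * a * ‖t‖))) ∂F := by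
  classical
  have hmeas : ∀ t : Euc d, Measurable fun p : Euc d × ℝ × S => stormShape C Q p.2 (t - p.1) :=
    fun t => hC.measurable_stormShape.comp
      (measurable_snd.prodMk (measurable_const.sub measurable_fst))
  have hm := (hmeas 0).min (hmeas t)
  have hE : MeasurableSet {p : (ℝ × S) × Euc d | p.1.1 • p.2 ∈ C p.1.2 ∧
      p.1.1 • (p.2 + t) ∈ C p.1.2} :=
    hC.measurableSet_smul_mem.inter (hC.measurableSet_smul_mem.preimage
      (measurable_fst.prodMk (measurable_snd.add measurable_const)))
  have hv : Measurable fun q : ℝ × S =>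
      volume {z : Euc d | q.1 • z ∈ C q.2 ∧ q.1 • (z + t) ∈ C q.2} :=
    measurable_measure_prodMk_left hE
  rw [lintegral_prod_symm _ hm.aemeasurable]
  have h1 : ∀ q : ℝ × S, ∫⁻ z, min (stormShape C Q q (0 - z)) (stormShape C Q q (t - z)) =
      stormHeight C Q q.1 * volume {z : Euc d | q.1 • z ∈ C q.2 ∧ q.1 • (z + t) ∈ C q.2} := fun q => by
    have h2 : ∀ z : Euc d, min (stormShape C Q q (0 - z)) (stormShape C Q q (t - z)) =
        (fun z => {z : Euc d | q.1 • z ∈ C q.2 ∧ q.1 • (z + t) ∈ C q.2}.indicator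
          (fun _ => stormHeight C Q q.1) z) (0 - z) := fun z => by
      have e : 0 - z + t = t - z := by abel
      simp only [stormShape, indicator_apply, mem_ofPred_eq, e]
      by_cases h3 : q.1 • (0 - z) ∈ C q.2 <;> by_cases h4 : q.1 • (t - z) ∈ C q.2 <;>
        simp only [h3, h4, if_true, if_false, min_self, and_self, and_true, and_false, zero_le,
          min_eq_left, min_eq_right]
    simp_rw [h2]
    rw [lintegral_sub_left_eq_self, lintegral_indicator_const]
    exact hE.preimage (measurable_const.prodMk measurable_id)
  simp_rw [h1]
  have hp : Measurable fun q : ℝ × S => stormHeight C Q q.1 *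
      volume {z : Euc d | q.1 • z ∈ C q.2 ∧ q.1 • (z + t) ∈ C q.2} :=
    (hC.measurable_stormHeight.comp measurable_fst).mul hv
  rw [lintegral_prod _ hp.aemeasurable]
  have hpos : ∀ᵐ a ∂F, 0 < a := by
    rw [ae_iff]
    exact measure_mono_null (fun a ha => not_lt.1 ha) hF
  refine lintegral_congr_ae ?_
  filter_upwards [hpos] with a ha
  have hva : Measurable fun s => volume {z : Euc d | a • z ∈ C s ∧ a • (z + t) ∈ C s} :=
    hv.comp (measurable_const.prodMk measurable_id)
  rw [lintegral_const_mul _ hva, hC.stormHeight_mul hd hc hsep ha, mul_assoc]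

/-- The right side involves the dimension only through the norm, which allows a storm in one
dimension to be compared with M3r processes in all others. -/
theorem mem_tcfMPS_iff {d : ℕ} (hd : 1 ≤ d) (χ : Euc d → ℝ) :
    χ ∈ tcfMPS d ↔ ∃ φ, IsLaplace φ ∧ χ = radial d φ := by
  obtain ⟨c, hc, hsep⟩ := exists_hyperplaneIntensity_separating_zero hd
  constructor
  · rintro ⟨Ω, _, P, X, hP, ⟨S, _, Q, C, F, hQ, hC, hFp, hF, hM⟩, hχ⟩
    have h := (hM.spectral.isTCF_iff χ).1 hχ
    have hpos : ∀ᵐ a ∂F, 0 < c * a := by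
      have : ∀ᵐ a ∂F, 0 < a := by
        rw [ae_iff]
        exact measure_mono_null (fun a ha => not_lt.1 ha) hF
      filter_upwards [this] with a ha using mul_pos hc ha
    refine ⟨fun r => ∫ a, Real.exp (-(c * a * r)) ∂F, isLaplace_of_law (T := fun a => c * a)
      (by fun_prop) hpos fun r => rfl, ?_⟩
    funext t
    rw [h t, radial]
    refine (congrArg ENNReal.toReal
      (hC.lintegral_min_stormShape hd hc.le hsep hF t)).trans ?_
    rw [integral_eq_lintegral_of_nonneg_ae (ae_of_all _ fun a => (Real.exp_pos _).le)
      (by fun_prop)]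
    rfl
  · rintro ⟨φ, ⟨F₀, hF₀p, hF₀, hφ⟩, rfl⟩
    obtain ⟨S, _, Q, C, hQ, hC⟩ := exists_isTypicalCell hd
    -- Dividing Λ by the constant c of the hyperplane intensity turns exp(−ca‖t‖) into exp(−a‖t‖).
    let F : Measure ℝ := F₀.map fun a => c⁻¹ * a
    have hcm : Measurable fun a : ℝ => c⁻¹ * a := by fun_prop
    have hFp : IsProbabilityMeasure F := Measure.isProbabilityMeasure_map hcm.aemeasurable
    have hF : F (Iic 0) = 0 := by
      rw [Measure.map_apply hcm measurableSet_Iic]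
      refine measure_mono_null (fun a ha => ?_) hF₀
      have : c⁻¹ * a ≤ 0 := ha
      exact nonpos_of_mul_nonpos_right this (inv_pos.2 hc)
    have hmeas : ∀ t : Euc d, Measurable fun p : Euc d × ℝ × S => stormShape C Q p.2 (t - p.1) :=
      fun t => hC.measurable_stormShape.comp
        (measurable_snd.prodMk (measurable_const.sub measurable_fst))
    have hmin := fun t => hC.lintegral_min_stormShape hd hc.le hsep hF t
    have hshape : ∫⁻ q, (∫⁻ t, stormShape C Q q t) ∂(F.prod Q) = 1 := by
      have h0 := hmin 0
      simp only [min_self, norm_zero, mul_zero, neg_zero, Real.exp_zero, ENNReal.ofReal_one,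
        lintegral_const, measure_univ, mul_one] at h0
      rw [lintegral_prod_symm _ (hmeas 0).aemeasurable] at h0
      rw [← h0]
      refine lintegral_congr fun q => ?_
      exact (lintegral_sub_left_eq_self (stormShape C Q q) 0).symm
    have hone : ∀ t : Euc d, ∫⁻ p, stormShape C Q p.2 (t - p.1)
        ∂((volume : Measure (Euc d)).prod (F.prod Q)) = 1 := fun t => by
      rw [lintegral_prod_symm _ (hmeas t).aemeasurable, ← hshape]
      exact lintegral_congr fun q => lintegral_sub_left_eq_self (stormShape C Q q) t
    obtain ⟨Ω, _, P, X, hP, hX⟩ := exists_hasSpectralRepresentation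
      ((volume : Measure (Euc d)).prod (F.prod Q)) hmeas hone
    refine ⟨Ω, _, P, X, hP, ⟨S, _, Q, C, F, hQ, hC, hFp, hF, inferInstance,
      hC.measurable_stormShape, hshape, hX⟩, (hX.isTCF_iff _).2 fun t => ?_⟩
    rw [hmin t, radial, hφ, lintegral_map (by fun_prop) hcm,
      integral_eq_lintegral_of_nonneg_ae (ae_of_all _ fun a => (Real.exp_pos _).le) (by fun_prop)]
    simp only [mul_inv_cancel_left₀ hc.ne', coe_nnnorm]

end storms

/-! ### Assembly of the three claims -/

theorem radial_injective {d : ℕ} (hd : 1 ≤ d) : Function.Injective (radial d) := by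
  intro φ ψ h
  funext r
  have hx : ‖EuclideanSpace.single (⟨0, hd⟩ : Fin d) (r : ℝ)‖₊ = r := by
    ext; simp
  have := congrFun h (EuclideanSpace.single (⟨0, hd⟩ : Fin d) (r : ℝ))
  rwa [radial, radial, hx] at this

theorem proposition3p2 (d : ℕ) (hd : 1 ≤ d) :
    (tcfMPS d ⊆ radial d '' tcfM3rInfty ∧ radial d '' tcfM3rInfty ⊆ tcfM3r d) ∧
    tcfBR d ∪ radial d '' tcfM3rInfty ⊆ tcfVBR d ∧
    (∀ α : ℝ, radial d (fun r => erfc ((r : ℝ) ^ α)) ∈ tcfMPS d ∩ tcfBR d ↔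
      α ∈ Set.Ioc (0 : ℝ) (1 / 2)) ∧
    (tcfMPS d ∩ tcfBR d).Nonempty := by
  have hmem : ∀ φ, φ ∈ tcfM3rInfty ↔ ∀ k, 1 ≤ k → radial k φ ∈ tcfM3r k := fun φ => by
    simp [tcfM3rInfty]
  have hiff : ∀ α : ℝ, radial d (fun r => erfc ((r : ℝ) ^ α)) ∈ tcfMPS d ∩ tcfBR d ↔
      α ∈ Set.Ioc (0 : ℝ) (1 / 2) := by
    intro α
    constructor
    -- Necessity uses only the MPS half: the BR half already allows every α in (0, 1).
    · rintro ⟨h, -⟩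
      obtain ⟨φ, hφ, he⟩ := (mem_tcfMPS_iff hd _).1 h
      rw [← radial_injective hd he] at hφ
      exact mem_Ioc_of_isLaplace_erfc_rpow hφ
    · rintro ⟨h0, h1⟩
      exact ⟨(mem_tcfMPS_iff hd _).2 ⟨_, isLaplace_erfc_rpow h0 h1, rfl⟩,
        radial_erfc_rpow_mem_tcfBR h0 (by linarith) d⟩
  refine ⟨⟨?_, ?_⟩, union_subset (tcfBR_subset_tcfVBR d) ?_, hiff,
    ⟨_, (hiff (1 / 2)).2 ⟨by norm_num, le_rfl⟩⟩⟩
  · intro χ hχ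
    obtain ⟨φ, hφ, rfl⟩ := (mem_tcfMPS_iff hd _).1 hχ
    exact ⟨φ, (hmem φ).2 fun k _ => hφ.isErfcMixture.radial_mem_tcfM3r k, rfl⟩
  · rintro _ ⟨φ, hφ, rfl⟩
    exact (hmem φ).1 hφ d hd
  · rintro _ ⟨φ, hφ, rfl⟩
    exact (isErfcMixture_of_mem_tcfM3rInfty hφ).radial_mem_tcfVBR d
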